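/- Let $q,t\in\mathbb C^*$ be such that none of $q,t,q/t$ is a root of unity. For $m\in\mathbb Z$ put $\kappa_m=(1-q^m)(1-t^{-m})(1-(t/q)^m)$ and let $G^\pm(z)=(1-q^{\pm1}z)(1-t^{\mp1}z)(1-(q/t)^{\mp1}z)$, $\delta(z)=\sum_{n\in\mathbb Z}z^n$, and $g(z;s)=\exp\Big(\sum_{m>0}\frac{\kappa_m}{m}\frac{s^m}{1-s^m}z^m\Big)$. **The algebra.** $U_{q,t,p}(\mathfrak{gl}_{1,tor})$ is generated by $\alpha_m$ $(m\in\mathbb Z\setminus\{0\})$, $x^\pm_n$ $(n\in\mathbb Z)$ and invertible central elements $\psi_0^\pm,\gamma^{1/2}$. Put $p^*=p\gamma^{-2}$, $x^\pm(z)=\sum_n x_n^\pm z^{-n}$ and $$\psi^+(z)=\psi_0^+\exp\Big(-\sum_{m>0}\tfrac{p^m}{1-p^m}\alpha_{-m}(\gamma^{-1/2}z)^m\Big)\exp\Big(\sum_{m>0}\tfrac{1}{1-p^m}\alpha_m(\gamma^{-1/2}z)^{-m}\Big),$$ $$\psi^-(z)=\psi_0^-\exp\Big(-\sum_{m>0}\tfrac{1}{1-p^m}\alpha_{-m}(\gamma^{1/2}z)^m\Big)\exp\Big(\sum_{m>0}\tfrac{p^m}{1-p^m}\alpha_m(\gamma^{1/2}z)^{-m}\Big).$$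 The relations, for $m,n\neq0$, are $$[\alpha_m,\alpha_n]=-\tfrac{\kappa_m}{m}(\gamma^m-\gamma^{-m})\gamma^{-m}\tfrac{1-p^m}{1-p^{*m}}\delta_{m+n,0},$$ $$[\alpha_m,x^+(z)]=-\tfrac{\kappa_m}{m}\tfrac{1-p^m}{1-p^{*m}}\gamma^{-3m/2}z^mx^+(z),\qquad [\alpha_m,x^-(z)]=\tfrac{\kappa_m}{m}\gamma^{-m/2}z^mx^-(z),$$ $$[x^+(z),x^-(w)]=\tfrac{(1-q)(1-1/t)}{1-q/t}\big(\delta(\gamma^{-1}z/w)\psi^+(w)-\delta(\gamma z/w)\psi^-(\gamma^{-1}w)\big),$$ $$z^3G^+(w/z)g(w/z;p^*)x^+(z)x^+(w)=-w^3G^+(z/w)g(z/w;p^*)x^+(w)x^+(z),$$ $$z^3G^-(w/z)g(w/z;p)^{-1}x^-(z)x^-(w)=-w^3G^-(z/w)g(z/w;p)^{-1}x^-(w)x^-(z),$$ $$g(w/z;p^*)g(y/w;p^*)g(y/z;p^*)\big(\tfrac wy+\tfrac wz-\tfrac zw-\tfrac yw\big)x^+(z)x^+(w)x^+(y)+(\text{permutations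 of }z,w,y)=0,$$ $$g(w/z;p)^{-1}g(y/w;p)^{-1}g(y/z;p)^{-1}\big(\tfrac wy+\tfrac wz-\tfrac zw-\tfrac yw\big)x^-(z)x^-(w)x^-(y)+(\text{permutations of }z,w,y)=0,$$ read coefficientwise as identities of formal series in $z,w,y$. For a complex number $p$, a representation on a complex vector space $V$ on which $\gamma^{1/2}$ acts by a nonzero scalar consists of operators on $V$ for the generators satisfying these relations, where every infinite sum occurring in a coefficient has only finitely many nonzero terms on each vector. Fix a fourth root $(t/q)^{1/4}$ and use it to define all powers $(t/q)^{n/4}$, $n\in\mathbb Z$. The representation has level $(k,l)\in\mathbb Z^2$ if $\gamma^{1/2}$ acts by $(t/q)^{k/4}$ and $\psi_0^+$ by $(t/q)^{-l/2}$. **Theorem.** Let $N\in\mathbb Z$, $u\in\mathbb C^*$, let $p\in\mathbb C$ with $0<|p|<1$, and let $p^*=pq/t$ with $|p^*|<1$. On the Fock space $\mathcal F^{(1,N)}_u=\mathbb C[\alpha_{-m}\ (m>0)]$ let $\gamma^{1/2}$ and $\psi_0^\pm$ act by the scalars $(t/q)^{1/4}$ and $(t/q)^{\mp N/2}$, and for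 $m>0$ let $\alpha_{-m}$ act by multiplication and $\alpha_m$ by $$-\tfrac{\kappa_m}{m}(1-(q/t)^m)\tfrac{1-p^m}{1-p^{*m}}\tfrac{\partial}{\partial\alpha_{-m}}.$$ Put $\alpha'_m=\frac{1-p^{*m}}{1-p^m}(t/q)^{m/2}\alpha_m$ for $m\ne0$. Then the assignment $$x^+(z)=uz^{-N}(t/q)^{3N/4}\exp\Big\{-\sum_{n>0}\tfrac{(t/q)^{n/4}}{1-(t/q)^n}\alpha_{-n}z^n\Big\}\exp\Big\{\sum_{n>0}\tfrac{(t/q)^{3n/4}}{1-(t/q)^n}\alpha_nz^{-n}\Big\},$$ $$x^-(z)=u^{-1}z^{N}(t/q)^{-3N/4}\exp\Big\{\sum_{n>0}\tfrac{(t/q)^{n/4}}{1-(t/q)^n}\alpha'_{-n}z^n\Big\}\exp\Big\{-\sum_{n>0}\tfrac{(t/q)^{3n/4}}{1-(t/q)^n}\alpha'_nz^{-n}\Big\}$$ is well defined (each coefficient has only finitely many nonzero terms on each vector) and gives a level $(1,N)$ representation of $U_{q,t,p}(\mathfrak{gl}_{1,tor})$ on $\mathcal F^{(1,N)}_u$,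 with $p\gamma^{-2}=p^*=pq/t$, in which $$\psi^+(z)=(t/q)^{-N/2}\exp\Big\{-\sum_{n>0}\tfrac{p^n(t/q)^{-n/4}}{1-p^n}\alpha_{-n}z^n\Big\}\exp\Big\{\sum_{n>0}\tfrac{(t/q)^{n/4}}{1-p^n}\alpha_nz^{-n}\Big\},$$ $$\psi^-(z)=(t/q)^{N/2}\exp\Big\{-\sum_{n>0}\tfrac{(t/q)^{n/4}}{1-p^n}\alpha_{-n}z^n\Big\}\exp\Big\{\sum_{n>0}\tfrac{p^n(t/q)^{-n/4}}{1-p^n}\alpha_nz^{-n}\Big\}.$$ -/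

import Mathlib

namespace EllipticToroidal

noncomputable section

/-- The finite-sum convention for families of vectors: only finitely many terms are nonzero,
and their sum is `w`. -/
def HasFiniteSum {ι V : Type*} [AddCommGroup V] (f : ι → V) (w : V) : Prop :=
  (Function.support f).Finite ∧ ∑ᶠ i, f i = w

/-- The formal exponential `exp (∑_{m ≥ 1} b m ζ ^ m)` as a power series in `ζ`. The exponent has
no constant term, so its `j`-th power does not contribute to the coefficient of `ζ ^ k` if
`j > k`. The value `b 0` is not used. -/
def formalExp {A : Type*} [Ring A] [Algebra ℂ A] (b : ℕ → A) : PowerSeries A :=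
  PowerSeries.mk fun k => ∑ j ∈ Finset.range (k + 1),
    ((j.factorial : ℂ)⁻¹) •
      PowerSeries.coeff k ((PowerSeries.mk fun m => if m = 0 then 0 else b m) ^ j)

/-- `κ_m = (1 - q ^ m) (1 - t ^ (-m)) (1 - (t / q) ^ m)`. -/
def kappa (q t : ℂ) (m : ℤ) : ℂ :=
  (1 - q ^ m) * (1 - t ^ (-m)) * (1 - (t / q) ^ m)

/-- `G⁺(ζ) = (1 - q ζ) (1 - t⁻¹ ζ) (1 - (q / t)⁻¹ ζ)`. -/
def GPlus (q t : ℂ) : PowerSeries ℂ :=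
  (1 - PowerSeries.C q * PowerSeries.X) * (1 - PowerSeries.C t⁻¹ * PowerSeries.X) *
    (1 - PowerSeries.C (q / t)⁻¹ * PowerSeries.X)

/-- `G⁻(ζ) = (1 - q⁻¹ ζ) (1 - t ζ) (1 - (q / t) ζ)`. -/
def GMinus (q t : ℂ) : PowerSeries ℂ :=
  (1 - PowerSeries.C q⁻¹ * PowerSeries.X) * (1 - PowerSeries.C t * PowerSeries.X) *
    (1 - PowerSeries.C (q / t) * PowerSeries.X)

/-- `g(ζ; σ) = exp (∑_{m > 0} (κ_m / m) (σ ^ m / (1 - σ ^ m)) ζ ^ m)`. -/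
def gSeries (q t σ : ℂ) : PowerSeries ℂ :=
  formalExp fun m => kappa q t m / m * (σ ^ m / (1 - σ ^ m))

/-- `F(z) = ∑_n F n z ^ (-n)` is the operator-valued formal series `C z ^ M A(z) B(z⁻¹)`:
applied to any vector `v`, the coefficient of each `z ^ (-n)` on the right is a sum with finitely
many nonzero terms, and it equals `F n v`. -/
def IsVertexOperator {V : Type*} [AddCommGroup V] [Module ℂ V] (F : ℤ → Module.End ℂ V)
    (C : Module.End ℂ V) (M : ℤ) (A B : PowerSeries (Module.End ℂ V)) : Prop :=
  ∀ (n : ℤ) (v : V), HasFiniteSum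
    (fun k : ℕ × ℕ => if M + (k.1 : ℤ) - (k.2 : ℤ) = -n then
      C (PowerSeries.coeff k.1 A (PowerSeries.coeff k.2 B v)) else 0)
    (F n v)

/-- Coefficient of `z ^ (-a) w ^ (-b)` in `h(w / z) x(z) x(w)`, applied to `v`, where
`x(z) = ∑_n x n z ^ (-n)`. -/
def quadCoeff {V : Type*} [AddCommGroup V] [Module ℂ V] (h : PowerSeries ℂ)
    (x : ℤ → Module.End ℂ V) (a b : ℤ) (v : V) : V :=
  ∑ᶠ k : ℕ, PowerSeries.coeff k h • x (a - k) (x (b + k) v)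

/-- Coefficient of `z ^ (-a) w ^ (-b) y ^ (-c)` in
`h(w / z) h(y / w) h(y / z) x(z) x(w) x(y)`, applied to `v`. -/
def cubicCoeff {V : Type*} [AddCommGroup V] [Module ℂ V] (h : PowerSeries ℂ)
    (x : ℤ → Module.End ℂ V) (a b c : ℤ) (v : V) : V :=
  ∑ᶠ k : ℕ × ℕ × ℕ,
    (PowerSeries.coeff k.1 h * PowerSeries.coeff k.2.1 h * PowerSeries.coeff k.2.2 h) •
      x (a - k.1 - k.2.2) (x (b + k.1 - k.2.1) (x (c + k.2.1 + k.2.2) v))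

/-- Coefficient of `z ^ (-a) w ^ (-b) y ^ (-c)` in
`h(w / z) h(y / w) h(y / z) (w / y + w / z - z / w - y / w) x(z) x(w) x(y)`, applied to `v`. -/
def serreCoeff {V : Type*} [AddCommGroup V] [Module ℂ V] (h : PowerSeries ℂ)
    (x : ℤ → Module.End ℂ V) (a b c : ℤ) (v : V) : V :=
  cubicCoeff h x a (b + 1) (c - 1) v + cubicCoeff h x (a - 1) (b + 1) c v
    - cubicCoeff h x (a + 1) (b - 1) c v - cubicCoeff h x a (b - 1) (c + 1) v

/-- All products of two and of three modes of `x(z)` entering the quadratic and cubic relations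
are locally finite, so that multiplying `x(z) x(w)` by a power series in `w / z`, or
`x(z) x(w) x(y)` by power series in `w / z`, `y / w`, `y / z`, makes sense on every vector. -/
structure IsLocallyFinite {V : Type*} [AddCommGroup V] [Module ℂ V]
    (x : ℤ → Module.End ℂ V) : Prop where
  quad : ∀ (a b : ℤ) (v : V), {k : ℕ | x (a - k) (x (b + k) v) ≠ 0}.Finite
  cubic : ∀ (a b c : ℤ) (v : V), {k : ℕ × ℕ × ℕ |
    x (a - k.1 - k.2.2) (x (b + k.1 - k.2.1) (x (c + k.2.1 + k.2.2) v)) ≠ 0}.Finite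

/-- Operators on `V` assigned to the generators of `U_{q,t,p}(gl_{1,tor})` and to the modes of the
series `ψ^±(z)`. Modes follow the convention `x(z) = ∑_n x n z ^ (-n)`. The generators are
`α_m` with `m ≠ 0`; the value `alpha 0` plays no role in the relations. -/
structure Generators (V : Type*) [AddCommGroup V] [Module ℂ V] where
  /-- `γ ^ (1/2)` -/
  gammaHalf : Module.End ℂ V
  /-- `ψ⁺_0` -/
  psiZeroPlus : Module.End ℂ V
  /-- `ψ⁻_0` -/
  psiZeroMinus : Module.End ℂ V
  /-- `α_m` -/
  alpha : ℤ → Module.End ℂ V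
  /-- modes of `x⁺(z)` -/
  xPlus : ℤ → Module.End ℂ V
  /-- modes of `x⁻(z)` -/
  xMinus : ℤ → Module.End ℂ V
  /-- modes of `ψ⁺(z)` -/
  psiPlus : ℤ → Module.End ℂ V
  /-- modes of `ψ⁻(z)` -/
  psiMinus : ℤ → Module.End ℂ V

/-- The elliptic nome `p^* = p γ ^ (-2)`, where `s` is the value of `γ ^ (1/2)`. -/
def pStar (p s : ℂ) : ℂ := p * (s ^ 2) ^ (-2 : ℤ)

/-- The operators `ρ` on `V` form a representation of `U_{q,t,p}(gl_{1,tor})`, with complex nome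
`p`, on which the central element `γ ^ (1/2)` acts by the nonzero scalar `s` (so `γ = s ^ 2`).
The defining relations of the algebra are imposed on all coefficients of the formal series in
`z`, `w`, `y`; every infinite sum occurring in them is required to be locally finite. -/
structure IsRepresentation (q t p s : ℂ) {V : Type*} [AddCommGroup V] [Module ℂ V]
    (ρ : Generators V) : Prop where
  /-- `γ ^ (1/2)` is an invertible scalar, hence central -/
  s_ne_zero : s ≠ 0
  gammaHalf_eq : ρ.gammaHalf = s • (1 : Module.End ℂ V)
  /-- `ψ^±_0` are invertible and central -/
  psiZeroPlus_isUnit : IsUnit ρ.psiZeroPlus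
  psiZeroMinus_isUnit : IsUnit ρ.psiZeroMinus
  psiZero_comm : Commute ρ.psiZeroPlus ρ.psiZeroMinus
  psiZeroPlus_alpha : ∀ m : ℤ, m ≠ 0 → Commute ρ.psiZeroPlus (ρ.alpha m)
  psiZeroPlus_xPlus : ∀ n : ℤ, Commute ρ.psiZeroPlus (ρ.xPlus n)
  psiZeroPlus_xMinus : ∀ n : ℤ, Commute ρ.psiZeroPlus (ρ.xMinus n)
  psiZeroMinus_alpha : ∀ m : ℤ, m ≠ 0 → Commute ρ.psiZeroMinus (ρ.alpha m)
  psiZeroMinus_xPlus : ∀ n : ℤ, Commute ρ.psiZeroMinus (ρ.xPlus n)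
  psiZeroMinus_xMinus : ∀ n : ℤ, Commute ρ.psiZeroMinus (ρ.xMinus n)
  /-- `ψ⁺(z) = ψ⁺_0 exp (-∑ p^m / (1 - p^m) α_{-m} (γ^{-1/2} z)^m)
  exp (∑ 1 / (1 - p^m) α_m (γ^{-1/2} z)^{-m})` -/
  psiPlus_eq : IsVertexOperator ρ.psiPlus ρ.psiZeroPlus 0
    (formalExp fun m : ℕ => (-(p ^ m / (1 - p ^ m) * s⁻¹ ^ m)) • ρ.alpha (-m))
    (formalExp fun m : ℕ => (1 / (1 - p ^ m) * s ^ m) • ρ.alpha m)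
  /-- `ψ⁻(z) = ψ⁻_0 exp (-∑ 1 / (1 - p^m) α_{-m} (γ^{1/2} z)^m)
  exp (∑ p^m / (1 - p^m) α_m (γ^{1/2} z)^{-m})` -/
  psiMinus_eq : IsVertexOperator ρ.psiMinus ρ.psiZeroMinus 0
    (formalExp fun m : ℕ => (-(1 / (1 - p ^ m) * s ^ m)) • ρ.alpha (-m))
    (formalExp fun m : ℕ => (p ^ m / (1 - p ^ m) * s⁻¹ ^ m) • ρ.alpha m)
  /-- `[α_m, α_n] = -(κ_m / m) (γ^m - γ^{-m}) γ^{-m} (1 - p^m) / (1 - p^{*m}) δ_{m+n,0}` -/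
  alpha_alpha : ∀ m n : ℤ, m ≠ 0 → n ≠ 0 →
    ρ.alpha m * ρ.alpha n - ρ.alpha n * ρ.alpha m =
      (if m + n = 0 then
        -(kappa q t m / m) * ((s ^ 2) ^ m - (s ^ 2) ^ (-m)) * (s ^ 2) ^ (-m) *
          ((1 - p ^ m) / (1 - pStar p s ^ m)) else 0) • (1 : Module.End ℂ V)
  /-- `[α_m, x⁺(z)] = -(κ_m / m) (1 - p^m) / (1 - p^{*m}) γ^{-3m/2} z^m x⁺(z)` -/
  alpha_xPlus : ∀ m n : ℤ, m ≠ 0 →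
    ρ.alpha m * ρ.xPlus n - ρ.xPlus n * ρ.alpha m =
      (-(kappa q t m / m) * ((1 - p ^ m) / (1 - pStar p s ^ m)) * s ^ (-3 * m)) •
        ρ.xPlus (n + m)
  /-- `[α_m, x⁻(z)] = (κ_m / m) γ^{-m/2} z^m x⁻(z)` -/
  alpha_xMinus : ∀ m n : ℤ, m ≠ 0 →
    ρ.alpha m * ρ.xMinus n - ρ.xMinus n * ρ.alpha m =
      (kappa q t m / m * s ^ (-m)) • ρ.xMinus (n + m)
  /-- `[x⁺(z), x⁻(w)] = (1 - q) (1 - 1/t) / (1 - q/t)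
  (δ(γ⁻¹ z / w) ψ⁺(w) - δ(γ z / w) ψ⁻(γ⁻¹ w))`, with `δ(ζ) = ∑_n ζ^n`; this is the
  coefficient of `z ^ (-a) w ^ (-b)` -/
  xPlus_xMinus : ∀ a b : ℤ,
    ρ.xPlus a * ρ.xMinus b - ρ.xMinus b * ρ.xPlus a =
      ((1 - q) * (1 - 1 / t) / (1 - q / t)) •
        ((s ^ 2) ^ a • ρ.psiPlus (a + b) - (s ^ 2) ^ b • ρ.psiMinus (a + b))
  xPlus_finite : IsLocallyFinite ρ.xPlus
  xMinus_finite : IsLocallyFinite ρ.xMinus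
  /-- `z³ G⁺(w/z) g(w/z; p^*) x⁺(z) x⁺(w) = -w³ G⁺(z/w) g(z/w; p^*) x⁺(w) x⁺(z)` -/
  xPlus_xPlus : ∀ (a b : ℤ) (v : V),
    quadCoeff (GPlus q t * gSeries q t (pStar p s)) ρ.xPlus (a + 3) b v =
      -quadCoeff (GPlus q t * gSeries q t (pStar p s)) ρ.xPlus (b + 3) a v
  /-- `z³ G⁻(w/z) g(w/z; p)⁻¹ x⁻(z) x⁻(w) = -w³ G⁻(z/w) g(z/w; p)⁻¹ x⁻(w) x⁻(z)` -/
  xMinus_xMinus : ∀ (a b : ℤ) (v : V),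
    quadCoeff (GMinus q t * (gSeries q t p)⁻¹) ρ.xMinus (a + 3) b v =
      -quadCoeff (GMinus q t * (gSeries q t p)⁻¹) ρ.xMinus (b + 3) a v
  /-- `g(w/z; p^*) g(y/w; p^*) g(y/z; p^*) (w/y + w/z - z/w - y/w) x⁺(z) x⁺(w) x⁺(y)
  + permutations in z, w, y = 0` -/
  xPlus_serre : ∀ (n : Fin 3 → ℤ) (v : V), ∑ τ : Equiv.Perm (Fin 3),
    serreCoeff (gSeries q t (pStar p s)) ρ.xPlus (n (τ 0)) (n (τ 1)) (n (τ 2)) v = 0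
  /-- `g(w/z; p)⁻¹ g(y/w; p)⁻¹ g(y/z; p)⁻¹ (w/y + w/z - z/w - y/w) x⁻(z) x⁻(w) x⁻(y)
  + permutations in z, w, y = 0` -/
  xMinus_serre : ∀ (n : Fin 3 → ℤ) (v : V), ∑ τ : Equiv.Perm (Fin 3),
    serreCoeff (gSeries q t p)⁻¹ ρ.xMinus (n (τ 0)) (n (τ 1)) (n (τ 2)) v = 0

/-- Level `(k, l)`: `γ ^ (1/2)` acts by `(t/q) ^ (k/4)` and `ψ⁺_0` by `(t/q) ^ (-l/2)`, where
`r = (t/q) ^ (1/4)` is the chosen fourth root. -/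
def HasLevel (r : ℂ) (k l : ℤ) {V : Type*} [AddCommGroup V] [Module ℂ V]
    (ρ : Generators V) : Prop :=
  ∀ v : V, ρ.gammaHalf v = r ^ k • v ∧ ρ.psiZeroPlus v = r ^ (-2 * l) • v

/-- The Fock space `ℂ[α_{-m} (m > 0)]`; the variable `X m` is `α_{-m}`, the constant `1` is the
vacuum vector. -/
abbrev Fock : Type := MvPolynomial ℕ+ ℂ

/-- The Heisenberg operators on the Fock space: for `m > 0`, `α_{-m}` is multiplication by
`α_{-m}` and
`α_m = -(κ_m / m) (1 - (q/t)^m) (1 - p^m) / (1 - p^{*m}) ∂/∂α_{-m}` with `p^* = p q / t`.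
The value at `0` is a convention. -/
def fockAlpha (q t p : ℂ) (m : ℤ) : Module.End ℂ Fock :=
  if hm : 0 < m then
    (-(kappa q t m / m) * (1 - (q / t) ^ m) * ((1 - p ^ m) / (1 - (p * q / t) ^ m))) •
      (MvPolynomial.pderiv (R := ℂ) (⟨m.toNat, by omega⟩ : ℕ+)).toLinearMap
  else if hm' : m < 0 then
    LinearMap.mulLeft ℂ (MvPolynomial.X (⟨(-m).toNat, by omega⟩ : ℕ+) : Fock)
  else 0

/-- `α'_m = (1 - p^{*m}) / (1 - p^m) γ^m α_m` on the Fock space, with `p^* = p q / t` and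
`γ = r ^ 2`. -/
def fockAlphaPrime (q t p r : ℂ) (m : ℤ) : Module.End ℂ Fock :=
  ((1 - (p * q / t) ^ m) / (1 - p ^ m) * (r ^ 2) ^ m) • fockAlpha q t p m

end

end EllipticToroidal

open EllipticToroidal

/-! The currents `x⁺(z)`, `x⁻(z)` are vertex operators: a scalar times a power of `z`, a creation
exponential and an annihilation exponential. Heisenberg brackets are scalars, so moving annihilation
modes past creation modes costs only a scalar power series in the ratio of the two variables, the
contraction. A product of two or three currents is therefore a normally ordered product times
contractions (`Contracts.op_op`, `Contracts.op_op_op`). Normally ordered products are symmetric in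
their variables (`nord_comm`, `cube_perm`), so the quadratic and cubic relations become statements
about contractions alone.

For two currents of the same sign, the factor `g(ζ; p^*)` or `g(ζ; p)⁻¹` cancels all dependence on
`p` and leaves `(1 - ζ)(1 - abζ) / ((1 - aζ)(1 - bζ))`, with `(a, b) = (q, 1/t)` for `x⁺` and `(1/q,
t)` for `x⁻`. Multiplication by `G^±` turns this into an antipalindromic cubic polynomial, which
gives the quadratic relations. The cubic relations reduce to the rational function identity
`serre_rational_identity`. Its six terms are expanded in different directions and do not live in a
common ring of series; replacing `a, b` by `aX, bX` puts them all into power series in `X` over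
Laurent polynomials. The value `X = 1` is taken only after applying a linear form with values in the
representation space, where all sums are finite (`serre_sum_eq_zero`).

For opposite signs the contraction is free of `p`, the same in both orders, and has simple poles at
`ζ = γ^{±1}`. The difference of its two expansions is a combination of two delta functions, and on
their supports the normally ordered product of `x⁺` and `x⁻` is `ψ⁺` or `ψ⁻` (`op_commutator`,
`Fuses`).

Exponentials with operator coefficients are controlled by their differential equation: for commuting
exponents, `formalExp b` is the only series with constant term 1 whose Euler derivative is that of
the exponent times itself (`eq_formalExp`). With `t = q r⁴`, the facts about exponents are rational
identities in `q^n`, `r^n`, `p^n`. -/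

namespace EllipticToroidal

noncomputable section

/-! ### Formal exponentials over a noncommutative algebra -/

section FormalExp

open PowerSeries Finset

/-- The Euler operator `X d/dX` on power series with coefficients in a ring. -/
def euler {A : Type*} [Ring A] (F : PowerSeries A) : PowerSeries A :=
  mk fun k => k • coeff k F

theorem coeff_euler {A : Type*} [Ring A] (F : PowerSeries A) (k : ℕ) :
    coeff k (euler F) = k • coeff k F := by
  simp [euler]

theorem euler_mul {A : Type*} [Ring A] (F G : PowerSeries A) :
    euler (F * G) = euler F * G + F * euler G := by
  ext n
  rw [coeff_euler, map_add, coeff_mul, coeff_mul, coeff_mul, smul_sum, ← sum_add_distrib]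
  refine sum_congr rfl fun x hx => ?_
  rw [coeff_euler, coeff_euler, smul_mul_assoc, mul_smul_comm, ← add_smul,
    mem_antidiagonal.mp hx]

theorem euler_sub {A : Type*} [Ring A] (F G : PowerSeries A) :
    euler (F - G) = euler F - euler G := by
  ext n
  simp [coeff_euler, mul_sub]

theorem euler_C {A : Type*} [Ring A] (a : A) : euler (C a) = 0 := by
  ext n
  rw [coeff_euler, coeff_C]
  split_ifs with h <;> simp [h]

/-- The exponent of `formalExp b`. -/
def expArg {A : Type*} [Ring A] (b : ℕ → A) : PowerSeries A :=
  mk fun m => if m = 0 then 0 else b m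

theorem coeff_euler_expArg {A : Type*} [Ring A] (b : ℕ → A) (k : ℕ) :
    coeff k (euler (expArg b)) = k • b k := by
  rw [coeff_euler, expArg, coeff_mk]
  split_ifs with h <;> simp [h]

theorem commute_of_coeff {A : Type*} [Ring A] {F G : PowerSeries A}
    (h : ∀ i j, Commute (coeff i F) (coeff j G)) : Commute F G := by
  ext n
  rw [coeff_mul, coeff_mul, ← Finset.Nat.sum_antidiagonal_swap]
  exact sum_congr rfl fun x _ => (h _ _).eq

/-- The exponent has no constant term, so its `j`-th power starts in degree at least `j`. This
justifies the truncation in `formalExp`. -/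
theorem coeff_expArg_pow_eq_zero {A : Type*} [Ring A] (b : ℕ → A) :
    ∀ {j k : ℕ}, k < j → coeff k (expArg b ^ j) = 0 := by
  intro j
  induction j with
  | zero => intro k h; omega
  | succ j ih =>
    intro k h
    rw [pow_succ, coeff_mul]
    refine sum_eq_zero fun x hx => ?_
    have hx' := mem_antidiagonal.mp hx
    by_cases h0 : x.2 = 0
    · simp [expArg, h0]
    · rw [ih (by omega), zero_mul]

theorem euler_pow {A : Type*} [Ring A] {F : PowerSeries A} (h : Commute (euler F) F) (j : ℕ) :
    euler (F ^ (j + 1)) = (j + 1) • (euler F * F ^ j) := by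
  induction j with
  | zero => simp
  | succ j ih =>
    rw [pow_succ, euler_mul, ih, smul_mul_assoc, mul_assoc, ← pow_succ,
      ← (h.pow_right (j + 1)).eq, ← succ_nsmul]

theorem euler_expArg_add {A : Type*} [Ring A] (b b' : ℕ → A) :
    euler (expArg (b + b')) = euler (expArg b) + euler (expArg b') := by
  ext k
  simp only [map_add, coeff_euler_expArg, Pi.add_apply, smul_add]

/-- Coefficients of a power series, extended by zero to negative degrees. -/
def intCoeff {A : Type*} [Ring A] (F : PowerSeries A) (i : ℤ) : A :=
  if 0 ≤ i then coeff i.toNat F else 0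

theorem intCoeff_natCast {A : Type*} [Ring A] (F : PowerSeries A) (i : ℕ) :
    intCoeff F i = coeff i F := by
  simp [intCoeff]

theorem intCoeff_of_neg {A : Type*} [Ring A] (F : PowerSeries A) {i : ℤ} (h : i < 0) :
    intCoeff F i = 0 := by
  rw [intCoeff, if_neg (by omega)]

theorem commute_intCoeff {A : Type*} [Ring A] {F : PowerSeries A} {y : A}
    (h : ∀ k, Commute y (coeff k F)) (i : ℤ) : Commute y (intCoeff F i) := by
  unfold intCoeff
  split_ifs
  exacts [h _, Commute.zero_right _]

variable {A : Type*} [Ring A] [Algebra ℂ A]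

theorem nsmul_eq_zero_complex {n : ℕ} (hn : n ≠ 0) {a : A} (h : n • a = 0) : a = 0 := by
  rw [← Nat.cast_smul_eq_nsmul ℂ] at h
  exact (smul_eq_zero.mp h).resolve_left (by exact_mod_cast hn)

/-- Since `B` has no constant term, the coefficient of degree `n` in `B * Δ` involves only lower
coefficients of `Δ`; induction gives `n • Δ_n = 0`. This uniqueness for a linear differential
equation proves all the exponential identities below, applied to the difference of the two sides. -/
theorem eq_zero_of_euler_eq {B Δ : PowerSeries A} (hB : coeff 0 B = 0) (h0 : coeff 0 Δ = 0)
    (h : euler Δ = B * Δ) : Δ = 0 := by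
  ext n
  induction n using Nat.strong_induction_on with
  | _ n ih =>
    rcases Nat.eq_zero_or_pos n with rfl | hn
    · simpa using h0
    · have h1 := congrArg (coeff n) h
      rw [coeff_euler, coeff_mul, sum_eq_zero] at h1
      · simpa using nsmul_eq_zero_complex hn.ne' h1
      · intro x hx
        have hx' := mem_antidiagonal.mp hx
        by_cases hx1 : x.1 = 0
        · rw [hx1, hB, zero_mul]
        · rw [ih x.2 (by omega), map_zero, mul_zero]

theorem coeff_formalExp (b : ℕ → A) (k : ℕ) : coeff k (formalExp b) =
    ∑ j ∈ range (k + 1), ((j.factorial : ℂ)⁻¹) • coeff k (expArg b ^ j) := by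
  simp [formalExp, expArg]

theorem coeff_formalExp_of_le (b : ℕ → A) {k n : ℕ} (h : k ≤ n) : coeff k (formalExp b) =
    ∑ j ∈ range (n + 1), ((j.factorial : ℂ)⁻¹) • coeff k (expArg b ^ j) := by
  rw [coeff_formalExp]
  refine sum_subset (range_subset_range.mpr (by omega)) fun j _ hj => ?_
  rw [coeff_expArg_pow_eq_zero b (by simpa using hj), smul_zero]

theorem coeff_zero_formalExp (b : ℕ → A) : coeff 0 (formalExp b) = 1 := by
  rw [coeff_formalExp]
  simp

/-- Commutativity of the `b m` makes the exponent commute with its derivative, so that the power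
rule holds term by term. -/
theorem euler_formalExp {b : ℕ → A} (hb : ∀ m n, Commute (b m) (b n)) :
    euler (formalExp b) = euler (expArg b) * formalExp b := by
  have hc : Commute (euler (expArg b)) (expArg b) := by
    refine commute_of_coeff fun i j => ?_
    rw [coeff_euler_expArg]
    simp only [expArg, coeff_mk]
    split_ifs
    · exact Commute.zero_right _
    · exact (hb i j).smul_left i
  ext k
  rw [coeff_euler, coeff_formalExp, sum_range_succ']
  rcases Nat.eq_zero_or_pos k with rfl | hk
  · rw [zero_smul, coeff_mul]
    simp [coeff_euler_expArg, -coeff_zero_eq_constantCoeff]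
  obtain ⟨n, rfl⟩ : ∃ n, k = n + 1 := ⟨k - 1, by omega⟩
  have h0 : coeff (n + 1) (expArg b ^ 0) = 0 := by simp [coeff_one]
  -- The term `j = 0` drops out; the derivative of the term `j + 1` is the derivative of the
  -- exponent times the term `j`.
  rw [h0, smul_zero, add_zero, smul_sum]
  have h1 : ∀ j, (n + 1) • (((j + 1).factorial : ℂ)⁻¹ • coeff (n + 1) (expArg b ^ (j + 1))) =
      ((j.factorial : ℂ)⁻¹) • coeff (n + 1) (euler (expArg b) * expArg b ^ j) := by
    intro j
    rw [smul_comm, ← coeff_euler, euler_pow hc, map_nsmul, ← Nat.cast_smul_eq_nsmul ℂ, smul_smul]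
    congr 1
    have : (j.factorial : ℂ) ≠ 0 := by exact_mod_cast j.factorial_ne_zero
    have h2 : (j : ℂ) + 1 ≠ 0 := by exact_mod_cast j.succ_ne_zero
    rw [Nat.factorial_succ]
    push_cast
    field_simp
  simp only [h1, coeff_mul, smul_sum]
  rw [sum_comm]
  refine sum_congr rfl fun x hx => ?_
  have hx' := mem_antidiagonal.mp hx
  by_cases hx1 : x.1 = 0
  · simp [hx1, coeff_euler_expArg, -coeff_zero_eq_constantCoeff]
  · rw [coeff_formalExp_of_le b (show x.2 ≤ n by omega), mul_sum]
    simp only [mul_smul_comm]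

theorem eq_formalExp {b : ℕ → A} (hb : ∀ m n, Commute (b m) (b n)) {F : PowerSeries A}
    (h0 : coeff 0 F = 1) (h : euler F = euler (expArg b) * F) : F = formalExp b := by
  refine sub_eq_zero.mp (eq_zero_of_euler_eq (B := euler (expArg b)) ?_ ?_ ?_)
  · rw [coeff_euler_expArg, zero_smul]
  · rw [map_sub, h0, coeff_zero_formalExp, sub_self]
  · rw [euler_sub, h, euler_formalExp hb, mul_sub]

theorem commute_coeff_formalExp {b : ℕ → A} {y : A} (h : ∀ m, Commute y (b m)) (k : ℕ) :
    Commute y (coeff k (formalExp b)) := by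
  have h1 : ∀ j k, Commute y (coeff k (expArg b ^ j)) := by
    intro j
    induction j with
    | zero =>
      intro k
      rw [pow_zero, coeff_one]
      split_ifs
      exacts [Commute.one_right _, Commute.zero_right _]
    | succ j ih =>
      intro k
      rw [pow_succ, coeff_mul]
      refine Commute.sum_right _ _ _ fun x _ => (ih _).mul_right ?_
      simp only [expArg, coeff_mk]
      split_ifs
      exacts [Commute.zero_right _, h _]
  rw [coeff_formalExp]
  exact Commute.sum_right _ _ _ fun j _ => (h1 j k).smul_right _

theorem commute_coeff_formalExp_formalExp {b b' : ℕ → A} (h : ∀ m n, Commute (b m) (b' n))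
    (k l : ℕ) : Commute (coeff k (formalExp b)) (coeff l (formalExp b')) :=
  commute_coeff_formalExp (fun m => (commute_coeff_formalExp (fun n => (h n m).symm) k).symm) l

/-- The product solves the differential equation of the sum, once the derivative of the second
exponent is moved past the first exponential. -/
theorem formalExp_add {b b' : ℕ → A} (hb : ∀ m n, Commute (b m) (b n))
    (hb' : ∀ m n, Commute (b' m) (b' n)) (h : ∀ m n, Commute (b m) (b' n)) :
    formalExp (b + b') = formalExp b * formalExp b' := by
  refine (eq_formalExp ?_ ?_ ?_).symm
  · intro m n
    exact ((hb m n).add_right (h m n)).add_left ((h n m).symm.add_right (hb' m n))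
  · rw [coeff_mul]
    simp [coeff_zero_formalExp, -coeff_zero_eq_constantCoeff]
  · have hc : Commute (formalExp b) (euler (expArg b')) := by
      refine commute_of_coeff fun i j => ?_
      rw [coeff_euler_expArg]
      exact ((commute_coeff_formalExp (fun m => (h m j).symm) i).symm).smul_right j
    rw [euler_mul, euler_formalExp hb, euler_formalExp hb', ← mul_assoc, hc.eq,
      euler_expArg_add, add_mul, mul_assoc, mul_assoc]

theorem coeff_formalExp_scale {b : ℕ → A} (hb : ∀ m n, Commute (b m) (b n)) (s : ℂ) (k : ℕ) :
    coeff k (formalExp fun n => s ^ n • b n) = s ^ k • coeff k (formalExp b) := by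
  have h : (mk fun k => s ^ k • coeff k (formalExp b)) = formalExp fun n => s ^ n • b n := by
    refine eq_formalExp (fun m n => ((hb m n).smul_left _).smul_right _) ?_ ?_
    · rw [coeff_mk, coeff_zero_formalExp, pow_zero, one_smul]
    · ext k
      rw [coeff_euler, coeff_mk, smul_comm, ← coeff_euler, euler_formalExp hb, coeff_mul, coeff_mul,
        smul_sum]
      refine sum_congr rfl fun x hx => ?_
      rw [coeff_euler_expArg, coeff_euler_expArg, coeff_mk, ← mem_antidiagonal.mp hx, pow_add,
        smul_comm x.1, smul_mul_smul_comm]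
  rw [← h, coeff_mk]

/-- If `y` has a scalar bracket with `b n` and commutes with the other `b m`, its bracket with the
formal exponential of `b` is a shift. -/
theorem bracket_coeff_formalExp {b : ℕ → A} (hb : ∀ m n, Commute (b m) (b n)) {y : A} {n : ℕ}
    (hn : n ≠ 0) {c : ℂ}
    (h : ∀ m, m ≠ 0 → y * b m - b m * y = (if m = n then c else 0) • (1 : A)) (k : ℕ) :
    y * coeff k (formalExp b) - coeff k (formalExp b) * y =
      if n ≤ k then c • coeff (k - n) (formalExp b) else 0 := by
  set F := formalExp b with hF
  -- `S` is the bracket of `y` with the exponent. It has scalar coefficients, hence is central, and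
  -- the claim reads `[y, F] = S F`.
  set S : PowerSeries A := X ^ n * C (c • (1 : A)) with hS
  have hSc : ∀ G : PowerSeries A, S * G = G * S := by
    intro G
    refine (Commute.mul_left ((commute_X_pow G n).symm) ?_).eq
    refine commute_of_coeff fun i j => ?_
    rw [coeff_C]
    split_ifs
    · exact (Commute.one_left _).smul_left c
    · exact Commute.zero_left _
  have hB : C y * euler (expArg b) - euler (expArg b) * C y = euler S := by
    ext m
    rw [map_sub, coeff_C_mul, coeff_mul_C, coeff_euler_expArg, coeff_euler, mul_smul_comm,
      smul_mul_assoc, ← smul_sub]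
    rcases Nat.eq_zero_or_pos m with rfl | hm
    · simp
    · rw [h m hm.ne', hS, coeff_mul_C, coeff_X_pow]
      split_ifs <;> simp
  -- By Leibniz, `[y, F] - S F` satisfies the same linear equation as `F`, but with vanishing
  -- constant term.
  have key : C y * F - F * C y - S * F = 0 := by
    refine eq_zero_of_euler_eq (B := euler (expArg b)) ?_ ?_ ?_
    · rw [coeff_euler_expArg, zero_smul]
    · rw [map_sub, map_sub, coeff_C_mul, coeff_mul_C, hF, coeff_zero_formalExp, hS, mul_assoc,
        coeff_X_pow_mul', if_neg (by omega)]
      simp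
    · have e : euler F = euler (expArg b) * F := euler_formalExp hb
      have e2 : C y * euler (expArg b) = euler (expArg b) * C y + euler S := by
        rw [← hB]; abel
      rw [euler_sub, euler_sub, euler_mul, euler_mul, euler_mul, euler_C, e, ← mul_assoc, e2,
        ← mul_assoc S, hSc (euler (expArg b))]
      noncomm_ring
  have := congrArg (coeff k) (sub_eq_zero.mp key)
  rw [map_sub, coeff_C_mul, coeff_mul_C, hS, mul_assoc, coeff_X_pow_mul'] at this
  rw [this]
  split_ifs
  · rw [coeff_C_mul, smul_mul_assoc, one_mul]
  · rfl

theorem bracket_intCoeff_formalExp {b : ℕ → A} (hb : ∀ m n, Commute (b m) (b n)) {y : A} {n : ℕ}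
    (hn : n ≠ 0) {c : ℂ}
    (h : ∀ m, m ≠ 0 → y * b m - b m * y = (if m = n then c else 0) • (1 : A)) (i : ℤ) :
    y * intCoeff (formalExp b) i - intCoeff (formalExp b) i * y =
      c • intCoeff (formalExp b) (i - n) := by
  rcases lt_or_ge i 0 with hi | hi
  · rw [intCoeff_of_neg _ hi, intCoeff_of_neg _ (by omega)]
    simp
  · obtain ⟨k, rfl⟩ := Int.eq_ofNat_of_zero_le hi
    rw [intCoeff_natCast, bracket_coeff_formalExp hb hn h]
    split_ifs with hk
    · rw [← Nat.cast_sub hk, intCoeff_natCast]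
    · rw [intCoeff_of_neg _ (by omega), smul_zero]

/-- Exchange of an annihilation and a creation exponential. -/
theorem formalExp_exchange {P Q : ℕ → A} (hP : ∀ m n, Commute (P m) (P n))
    (hQ : ∀ m n, Commute (Q m) (Q n)) {c : ℕ → ℂ}
    (h : ∀ m n, m ≠ 0 → n ≠ 0 → P m * Q n - Q n * P m = (if n = m then c m else 0) • (1 : A))
    (j : ℕ) (i : ℤ) :
    coeff j (formalExp P) * intCoeff (formalExp Q) i =
      ∑ x ∈ antidiagonal j, coeff x.1 (formalExp c) •
        (intCoeff (formalExp Q) (i - x.1) * coeff x.2 (formalExp P)) := by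
  set B := formalExp P with hB
  set e := intCoeff (formalExp Q) with he
  set H := formalExp c with hH
  -- `K` is the candidate for the conjugate of the mode `e i` by the exponential `B`. It satisfies
  -- `[euler (expArg P), K] = euler K`, and this makes `K * B` and `B * C (e i)` solutions of the
  -- same equation.
  set K : PowerSeries A := mk fun k => coeff k H • e (i - k) with hK
  have hH' : ∀ n, n • coeff n H = ∑ x ∈ antidiagonal n, (x.1 • c x.1) * coeff x.2 H := by
    intro n
    rw [← coeff_euler, hH, euler_formalExp fun _ _ => Commute.all _ _, coeff_mul]
    simp only [coeff_euler_expArg]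
  have hPK : euler (expArg P) * K - K * euler (expArg P) = euler K := by
    ext n
    rw [map_sub, coeff_mul, coeff_mul, ← Finset.Nat.sum_antidiagonal_swap (n := n)
      (f := fun x => coeff x.1 K * coeff x.2 (euler (expArg P))), ← sum_sub_distrib, coeff_euler,
      hK, coeff_mk, ← smul_assoc, hH', sum_smul]
    refine sum_congr rfl fun x hx => ?_
    rw [coeff_euler_expArg, Prod.fst_swap, Prod.snd_swap, coeff_mk, coeff_euler_expArg]
    by_cases hx1 : x.1 = 0
    · simp [hx1]
    · have h1 := bracket_intCoeff_formalExp hQ hx1 (fun m hm => h x.1 m hx1 hm) (i - x.2)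
      rw [← he, show i - (x.2 : ℤ) - x.1 = i - n by
        rw [← mem_antidiagonal.mp hx]; push_cast; ring] at h1
      rw [mul_smul_comm, smul_mul_assoc, smul_mul_assoc, mul_smul_comm, ← smul_sub,
        ← smul_sub, h1, ← smul_assoc x.1 (c x.1), smul_smul, mul_comm]
  have key : B * C (e i) - K * B = 0 := by
    refine eq_zero_of_euler_eq (B := euler (expArg P)) ?_ ?_ ?_
    · rw [coeff_euler_expArg, zero_smul]
    · rw [map_sub, coeff_mul_C, coeff_mul]
      simp only [Finset.Nat.antidiagonal_zero, sum_singleton, hK, coeff_mk]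
      rw [hB, coeff_zero_formalExp, hH, coeff_zero_formalExp]
      simp
    · have e1 : euler B = euler (expArg P) * B := euler_formalExp hP
      rw [euler_sub, euler_mul, euler_mul, euler_C, e1, ← hPK]
      noncomm_ring
  have := congrArg (coeff j) (sub_eq_zero.mp key)
  rw [coeff_mul_C, coeff_mul] at this
  rw [this]
  refine sum_congr rfl fun x _ => ?_
  rw [hK, coeff_mk, smul_mul_assoc]

end FormalExp

end

end EllipticToroidal

namespace EllipticToroidal

noncomputable section

/-! ### Rearrangement of finitely supported sums -/

section FiniteSums

open Finset

theorem finsum_sum_fiber {κ ι M : Type*} [AddCommMonoid M] (fib : ι → Finset κ) (g : κ → ι)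
    (h : ∀ i x, x ∈ fib i ↔ g x = i) {F : κ → M} (hF : (Function.support F).Finite) :
    ∑ᶠ i, ∑ x ∈ fib i, F x = ∑ᶠ x, F x := by
  classical
  rw [finsum_eq_sum_of_support_subset F (s := hF.toFinset) (by simp),
    finsum_eq_sum_of_support_subset _ (s := hF.toFinset.image g)]
  · rw [← sum_fiberwise_of_maps_to (s := hF.toFinset) (t := hF.toFinset.image g) (g := g)
      fun x hx => mem_image_of_mem g hx]
    refine sum_congr rfl fun i _ => (sum_subset ?_ ?_).symm
    · intro x hx
      exact (h i x).mpr (mem_filter.mp hx).2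
    · intro x hx hx'
      by_contra h0
      exact hx' (mem_filter.mpr ⟨hF.mem_toFinset.mpr h0, (h i x).mp hx⟩)
  · intro i hi
    obtain ⟨x, hx, hx0⟩ := exists_ne_zero_of_sum_ne_zero hi
    rw [coe_image]
    exact ⟨x, by simpa using hx0, (h i x).mp hx⟩

theorem finsum_finsum_comm {α β M : Type*} [AddCommMonoid M] (f : α → β → M)
    (hf : {p : α × β | f p.1 p.2 ≠ 0}.Finite) : ∑ᶠ a, ∑ᶠ b, f a b = ∑ᶠ b, ∑ᶠ a, f a b := by
  rw [← finsum_curry (fun p : α × β => f p.1 p.2) hf,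
    ← finsum_curry (fun p : β × α => f p.2 p.1),
    ← finsum_comp_equiv (Equiv.prodComm β α)]
  · rfl
  · exact hf.preimage (Equiv.prodComm β α).injective.injOn

theorem map_finsum_of_finite {V W : Type*} [AddCommGroup V] [Module ℂ V] [AddCommGroup W]
    [Module ℂ W] {ι : Type*} (L : V →ₗ[ℂ] W) {f : ι → V} (hf : (Function.support f).Finite) :
    L (∑ᶠ i, f i) = ∑ᶠ i, L (f i) :=
  L.toAddMonoidHom.map_finsum hf

theorem finite_of_forall_lt {P : ℕ → ℕ → Prop} (h1 : ∃ d, ∀ a b, P a b → a < d)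
    (h2 : ∀ a, ∃ e, ∀ b, P a b → b < e) : {p : ℕ × ℕ | P p.1 p.2}.Finite := by
  obtain ⟨d, hd⟩ := h1
  choose e he using h2
  refine Set.Finite.subset ((range d).biUnion fun a => {a} ×ˢ range (e a)).finite_toSet ?_
  rintro ⟨a, b⟩ hp
  simp only [coe_biUnion, Set.mem_iUnion, mem_coe, mem_product, mem_singleton, mem_range]
  exact ⟨a, hd a b hp, rfl, he a b hp⟩

/-- Shaped for three contractions: two of the indices are bounded outright, the remaining one only
after those two are fixed. -/
theorem finite_of_forall_lt₃ {P : ℕ → ℕ → ℕ → Prop} (d : ℕ)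
    (h2 : ∀ a b c, P a b c → b < d) (h3 : ∀ a b c, P a b c → c < d)
    (h1 : ∀ b c, ∃ e, ∀ a, P a b c → a < e) : {p : ℕ × ℕ × ℕ | P p.1 p.2.1 p.2.2}.Finite := by
  choose e he using h1
  refine Set.Finite.subset ((range d).biUnion fun b => (range d).biUnion fun c =>
    range (e b c) ×ˢ {b} ×ˢ {c}).finite_toSet ?_
  rintro ⟨a, b, c⟩ hp
  simp only [coe_biUnion, Set.mem_iUnion, mem_coe, mem_product, mem_singleton, mem_range]
  exact ⟨b, h2 a b c hp, c, h3 a b c hp, he b c a hp, rfl, rfl⟩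

/-- Makes the convolution lemmas below apply both to single indices and to the index triples of the
cubic relation. -/
instance prodHasAntidiagonal {α β : Type*} [AddMonoid α] [AddMonoid β] [HasAntidiagonal α]
    [HasAntidiagonal β] : HasAntidiagonal (α × β) where
  antidiagonal n :=
    (antidiagonal n.1 ×ˢ antidiagonal n.2).map (Equiv.prodProdProdComm α α β β).toEmbedding
  mem_antidiagonal {n a} := by
    rw [mem_map_equiv, mem_product, HasAntidiagonal.mem_antidiagonal,
      HasAntidiagonal.mem_antidiagonal, Prod.ext_iff]
    rfl

theorem sum_antidiagonal_prod {α β M : Type*} [AddMonoid α] [AddMonoid β] [HasAntidiagonal α]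
    [HasAntidiagonal β] [AddCommMonoid M] (n : α × β) (f : (α × β) × (α × β) → M) :
    ∑ x ∈ antidiagonal n, f x =
      ∑ x ∈ antidiagonal n.1, ∑ y ∈ antidiagonal n.2, f ((x.1, y.1), (x.2, y.2)) := by
  rw [← sum_product']
  exact sum_map _ _ _

section Convolution

theorem finite_add_support {ι V : Type*} [AddMonoid ι] [HasAntidiagonal ι] [AddCommGroup V]
    {f : ι → V} (hf : (Function.support f).Finite) :
    {x : ι × ι | f (x.1 + x.2) ≠ 0}.Finite := by
  classical
  refine Set.Finite.subset (hf.toFinset.biUnion antidiagonal).finite_toSet fun x hx => ?_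
  simpa using hx

variable {ι V : Type*} [AddMonoid ι] [HasAntidiagonal ι] [AddCommGroup V] [Module ℂ V]

theorem finite_finsum_add_ne_zero {f : ι → V} (hf : (Function.support f).Finite) (E : ι → ℂ) :
    {k | ∑ᶠ l, E l • f (k + l) ≠ 0}.Finite := by
  refine ((finite_add_support hf).image Prod.fst).subset fun k hk => ?_
  by_contra h0
  refine hk (finsum_eq_zero_of_forall_eq_zero fun l => ?_)
  by_contra h1
  exact h0 ⟨(k, l), fun h2 => h1 (by rw [show f (k + l) = 0 from h2, smul_zero]), rfl⟩

/-- Associativity of multiplication by two scalar series. Finite support is needed only for the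
vectors `f`, so `H` and `E` may be infinite series, such as a structure function and a contraction.
-/
theorem finsum_smul_finsum_add {f : ι → V} (hf : (Function.support f).Finite) (H E : ι → ℂ) :
    ∑ᶠ k, H k • ∑ᶠ l, E l • f (k + l) =
      ∑ᶠ n, (∑ x ∈ antidiagonal n, H x.1 * E x.2) • f n := by
  have hfin := finite_add_support hf
  have h1 : (Function.support fun x : ι × ι => (H x.1 * E x.2) • f (x.1 + x.2)).Finite :=
    hfin.subset fun x hx h0 => hx (by
      show (H x.1 * E x.2) • f (x.1 + x.2) = 0
      rw [h0, smul_zero])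
  have h2 : ∀ n, (∑ x ∈ antidiagonal n, H x.1 * E x.2) • f n =
      ∑ x ∈ antidiagonal n, (H x.1 * E x.2) • f (x.1 + x.2) := by
    intro n
    rw [sum_smul]
    exact sum_congr rfl fun x hx => by rw [mem_antidiagonal.mp hx]
  simp only [h2]
  rw [finsum_sum_fiber antidiagonal (fun x => x.1 + x.2) (fun i x => mem_antidiagonal) h1,
    finsum_curry _ h1]
  refine finsum_congr fun k => ?_
  rw [smul_finsum]
  simp only [mul_smul]

end Convolution

/-- Product of the coefficients of three power series in one variable. -/
def tripleCoeff (h : PowerSeries ℂ) (k : ℕ × ℕ × ℕ) : ℂ :=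
  PowerSeries.coeff k.1 h * PowerSeries.coeff k.2.1 h * PowerSeries.coeff k.2.2 h

theorem sum_antidiagonal_tripleCoeff (h e : PowerSeries ℂ) (n : ℕ × ℕ × ℕ) :
    ∑ x ∈ antidiagonal n, tripleCoeff h x.1 * tripleCoeff e x.2 = tripleCoeff (h * e) n := by
  rw [sum_antidiagonal_prod]
  simp only [sum_antidiagonal_prod, tripleCoeff, PowerSeries.coeff_mul]
  rw [sum_mul_sum, sum_mul]
  refine sum_congr rfl fun x _ => ?_
  rw [sum_mul]
  refine sum_congr rfl fun y _ => ?_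
  rw [mul_sum]
  refine sum_congr rfl fun z _ => ?_
  ring

end FiniteSums

/-! ### Normal ordering and Wick's theorem -/

section NormalOrdering

open Finset

/-- The modes of a creation and of an annihilation series, subject to the bounds which make the
vertex operator `∑_{i, j} creation i * annihilation j z^(i-j)` well defined. -/
structure VertexData (V : Type*) [AddCommGroup V] [Module ℂ V] where
  /-- modes of the creation series -/
  creation : ℤ → Module.End ℂ V
  /-- modes of the annihilation series -/
  annihilation : ℕ → Module.End ℂ V
  /-- lower bound for the degrees of the creation modes -/
  bound : ℤ
  creation_eq_zero : ∀ i, i < bound → creation i = 0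
  annihilation_eq_zero : ∀ v, ∃ d, ∀ j, d ≤ j → annihilation j v = 0

namespace VertexData

variable {V : Type*} [AddCommGroup V] [Module ℂ V]

theorem finite_support (X : VertexData V) (m : ℤ) (Y : Module.End ℂ V) (v : V) :
    (Function.support fun j : ℕ => X.creation (j - m) (Y (X.annihilation j v))).Finite := by
  obtain ⟨d, hd⟩ := X.annihilation_eq_zero v
  refine (range d).finite_toSet.subset fun j hj => ?_
  by_contra h
  exact hj (by simp [hd j (by simpa using h)])

/-- The mode of index `m` of the product of an operator `Y` with the vertex operator of `X`, with
the creation modes to the left and the annihilation modes to the right of `Y`. -/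
def nord (X : VertexData V) (m : ℤ) (Y : Module.End ℂ V) : Module.End ℂ V where
  toFun v := ∑ᶠ j : ℕ, X.creation (j - m) (Y (X.annihilation j v))
  map_add' v w := by
    rw [← finsum_add_distrib (X.finite_support m Y v) (X.finite_support m Y w)]
    simp
  map_smul' c v := by
    rw [RingHom.id_apply, smul_finsum]
    simp

theorem nord_apply (X : VertexData V) (m : ℤ) (Y : Module.End ℂ V) (v : V) :
    X.nord m Y v = ∑ᶠ j : ℕ, X.creation (j - m) (Y (X.annihilation j v)) := rfl

/-- The modes of the vertex operator of `X`. -/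
def op (X : VertexData V) (m : ℤ) : Module.End ℂ V := X.nord m 1

theorem op_apply (X : VertexData V) (m : ℤ) (v : V) :
    X.op m v = ∑ᶠ j : ℕ, X.creation (j - m) (X.annihilation j v) := rfl

/-- The annihilation modes act first and only finitely many survive on `v`; for large `m` the
creation degrees left over lie below the bound. The threshold does not depend on `Y`, which allows
nested normal orderings. -/
theorem exists_forall_nord_eq_zero (X : VertexData V) (v : V) :
    ∃ D : ℤ, ∀ m, D < m → ∀ Y, X.nord m Y v = 0 := by
  obtain ⟨d, hd⟩ := X.annihilation_eq_zero v
  refine ⟨d - X.bound, fun m hm Y => finsum_eq_zero_of_forall_eq_zero fun j => ?_⟩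
  rcases le_or_gt d j with h | h
  · simp [hd j h]
  · rw [X.creation_eq_zero _ (by omega), LinearMap.zero_apply]

theorem finite_pair (X X' : VertexData V) (v : V) :
    {p : ℕ × ℕ | X'.annihilation p.2 (X.annihilation p.1 v) ≠ 0}.Finite := by
  refine finite_of_forall_lt (P := fun a b => X'.annihilation b (X.annihilation a v) ≠ 0) ?_ ?_
  · obtain ⟨d, hd⟩ := X.annihilation_eq_zero v
    refine ⟨d, fun a b h => ?_⟩
    by_contra h'
    exact h (by rw [hd a (by omega), map_zero])
  · intro a
    obtain ⟨d, hd⟩ := X'.annihilation_eq_zero (X.annihilation a v)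
    refine ⟨d, fun b h => ?_⟩
    by_contra h'
    exact h (hd b (by omega))

theorem nord_nord_apply (X X' : VertexData V) (m m' : ℤ) (Y : Module.End ℂ V) (v : V) :
    X.nord m (X'.nord m' Y) v = ∑ᶠ j : ℕ, ∑ᶠ j' : ℕ, X.creation (j - m)
      (X'.creation (j' - m') (Y (X'.annihilation j' (X.annihilation j v)))) := by
  rw [nord_apply]
  refine finsum_congr fun j => ?_
  rw [nord_apply]
  exact map_finsum_of_finite _ (X'.finite_support m' Y _)

/-- Normal ordering is symmetric. -/
theorem nord_comm {X X' : VertexData V} (hc : ∀ i j, Commute (X.creation i) (X'.creation j))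
    (ha : ∀ i j, Commute (X.annihilation i) (X'.annihilation j)) (m m' : ℤ)
    (Y : Module.End ℂ V) : X.nord m (X'.nord m' Y) = X'.nord m' (X.nord m Y) := by
  ext v
  rw [nord_nord_apply, nord_nord_apply, finsum_finsum_comm]
  · refine finsum_congr fun j' => finsum_congr fun j => ?_
    have h1 := fun w => LinearMap.congr_fun (hc (j - m) (j' - m')).eq w
    have h2 := LinearMap.congr_fun (ha j j').eq v
    simp only [Module.End.mul_apply] at h1 h2
    rw [h1, h2]
  · refine (finite_pair X X' v).subset fun p hp h => hp ?_
    simp [h]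

theorem nord_eq_finsum (X : VertexData V) (m : ℤ) {Y : Module.End ℂ V} {h : ℕ → ℂ}
    {Y' : ℕ → Module.End ℂ V} (hY : ∀ v, Y v = ∑ᶠ k, h k • Y' k v)
    (hfin : ∀ v, ∃ d, ∀ k, d ≤ k → Y' k v = 0) (v : V) :
    X.nord m Y v = ∑ᶠ k, h k • X.nord m (Y' k) v := by
  simp only [nord_apply, hY, smul_finsum]
  rw [← finsum_finsum_comm (fun (j k : ℕ) => h k • X.creation (j - m) (Y' k (X.annihilation j v)))]
  · refine finsum_congr fun j => ?_
    rw [map_finsum_of_finite]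
    · simp only [map_smul]
    · obtain ⟨d, hd⟩ := hfin (X.annihilation j v)
      refine (range d).finite_toSet.subset fun k hk => ?_
      by_contra h'
      exact hk (by simp [hd k (by simpa using h')])
  · refine finite_of_forall_lt
      (P := fun (j k : ℕ) => h k • X.creation (j - m) (Y' k (X.annihilation j v)) ≠ 0) ?_ ?_
    · obtain ⟨d, hd⟩ := X.annihilation_eq_zero v
      refine ⟨d, fun a b h => ?_⟩
      by_contra h'
      exact h (by simp [hd a (by omega)])
    · intro j
      obtain ⟨d, hd⟩ := hfin (X.annihilation j v)
      refine ⟨d, fun b h => ?_⟩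
      by_contra h'
      exact h (by simp [hd b (by omega)])

/-- The operators `Z m` can be moved to the right of the creation modes of `X` at the cost of the
contraction function `h`. -/
def Contracts (Z : ℤ → Module.End ℂ V) (X : VertexData V) (h : PowerSeries ℂ) : Prop :=
  ∀ (m i : ℤ) (v : V), Z m (X.creation i v) =
    ∑ᶠ k : ℕ, PowerSeries.coeff k h • X.creation (i - k) (Z (m - k) v)

/-- Only creation modes lie to the left of `Y`, so `Z` contracts with them alone and ends up next to
`Y`, inside the normal ordering. -/
theorem Contracts.apply_nord {Z : ℤ → Module.End ℂ V} {X : VertexData V} {h : PowerSeries ℂ}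
    (hZ : Contracts Z X h) (m m' : ℤ) (Y : Module.End ℂ V) (v : V) :
    Z m (X.nord m' Y v) =
      ∑ᶠ k : ℕ, PowerSeries.coeff k h • X.nord (m' + k) (Z (m - k) * Y) v := by
  rw [nord_apply, map_finsum_of_finite _ (X.finite_support m' Y v)]
  simp only [hZ m, nord_apply, smul_finsum]
  rw [finsum_finsum_comm]
  · simp only [sub_sub, Module.End.mul_apply]
  · refine finite_of_forall_lt (P := fun (j k : ℕ) => PowerSeries.coeff k h •
      X.creation (j - m' - k) (Z (m - k) (Y (X.annihilation j v))) ≠ 0) ?_ ?_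
    · obtain ⟨d, hd⟩ := X.annihilation_eq_zero v
      refine ⟨d, fun a b h => ?_⟩
      by_contra h'
      exact h (by simp [hd a (by omega)])
    · intro j
      refine ⟨(j - m' - X.bound + 1).toNat, fun k h => ?_⟩
      by_contra h'
      exact h (by rw [X.creation_eq_zero _ (by omega), LinearMap.zero_apply, smul_zero])

/-- The annihilation modes of `X` produce the contraction when they cross a creation mode of `X'`;
the creation modes of `X` cross it freely. -/
theorem contracts_op {X X' : VertexData V} {h : PowerSeries ℂ}
    (hc : ∀ i j, Commute (X.creation i) (X'.creation j))
    (hx : ∀ (j : ℕ) (i : ℤ), X.annihilation j * X'.creation i = ∑ x ∈ antidiagonal j,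
      PowerSeries.coeff x.1 h • (X'.creation (i - x.1) * X.annihilation x.2)) :
    Contracts X.op X' h := by
  intro m i v
  have h1 : ∀ j : ℕ, X.creation (j - m) (X.annihilation j (X'.creation i v)) =
      ∑ x ∈ antidiagonal j, PowerSeries.coeff x.1 h • X'.creation (i - x.1)
        (X.creation (x.2 - (m - x.1)) (X.annihilation x.2 v)) := by
    intro j
    rw [← Module.End.mul_apply (X.annihilation j), hx, LinearMap.sum_apply, map_sum]
    refine sum_congr rfl fun x hx => ?_
    rw [LinearMap.smul_apply, map_smul, Module.End.mul_apply, ← Module.End.mul_apply,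
      (hc _ _).eq, Module.End.mul_apply]
    congr 4
    rw [← mem_antidiagonal.mp hx]
    push_cast
    ring
  have hfin : (Function.support fun x : ℕ × ℕ => PowerSeries.coeff x.1 h •
      X'.creation (i - x.1) (X.creation (x.2 - (m - x.1)) (X.annihilation x.2 v))).Finite := by
    refine finite_of_forall_lt (P := fun (a b : ℕ) => PowerSeries.coeff a h •
      X'.creation (i - a) (X.creation (b - (m - a)) (X.annihilation b v)) ≠ 0) ?_ ?_
    · refine ⟨(i - X'.bound + 1).toNat, fun a b h => ?_⟩
      by_contra h'
      exact h (by rw [X'.creation_eq_zero _ (by omega), LinearMap.zero_apply, smul_zero])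
    · intro a
      obtain ⟨d, hd⟩ := X.annihilation_eq_zero v
      refine ⟨d, fun b h => ?_⟩
      by_contra h'
      exact h (by simp [hd b (by omega)])
  rw [op_apply]
  simp only [h1]
  rw [finsum_sum_fiber antidiagonal (fun x => x.1 + x.2) (fun _ _ => mem_antidiagonal) hfin,
    finsum_curry _ hfin]
  refine finsum_congr fun k => ?_
  rw [op, nord_apply, map_finsum_of_finite _ (X.finite_support (m - k) 1 v), smul_finsum]
  rfl

theorem Contracts.op_op {X X' : VertexData V} {h : PowerSeries ℂ} (hX : Contracts X.op X' h)
    (m m' : ℤ) (v : V) : X.op m (X'.op m' v) =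
      ∑ᶠ k : ℕ, PowerSeries.coeff k h • X'.nord (m' + k) (X.op (m - k)) v := by
  rw [show X'.op m' v = X'.nord m' 1 v from rfl, hX.apply_nord]
  simp only [mul_one]

/-- The modes of the normally ordered cube of the vertex operator of `X`. -/
def cube (X : VertexData V) (v : V) (g : Fin 3 → ℤ) : V :=
  X.nord (g 2) (X.nord (g 1) (X.nord (g 0) 1)) v

theorem cube_swap_snd {X : VertexData V} (hc : ∀ i j, Commute (X.creation i) (X.creation j))
    (ha : ∀ i j, Commute (X.annihilation i) (X.annihilation j)) (v : V) (a b c : ℤ) :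
    X.cube v ![a, b, c] = X.cube v ![a, c, b] :=
  LinearMap.congr_fun (nord_comm hc ha c b (X.nord a 1)) v

theorem cube_swap_fst {X : VertexData V} (hc : ∀ i j, Commute (X.creation i) (X.creation j))
    (ha : ∀ i j, Commute (X.annihilation i) (X.annihilation j)) (v : V) (a b c : ℤ) :
    X.cube v ![a, b, c] = X.cube v ![b, a, c] := by
  show X.nord c (X.nord b (X.nord a 1)) v = X.nord c (X.nord a (X.nord b 1)) v
  rw [nord_comm hc ha b a]

/-- The transpositions of the first two and of the last two indices generate all permutations. -/
theorem cube_perm {X : VertexData V} (hc : ∀ i j, Commute (X.creation i) (X.creation j))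
    (ha : ∀ i j, Commute (X.annihilation i) (X.annihilation j)) (v : V) (g : Fin 3 → ℤ)
    (τ : Equiv.Perm (Fin 3)) : X.cube v (g ∘ τ) = X.cube v g := by
  have e : ∀ f : Fin 3 → ℤ, f = ![f 0, f 1, f 2] := fun f => by
    ext i; fin_cases i <;> rfl
  have hτ : ∀ τ : Equiv.Perm (Fin 3), (τ 0, τ 1, τ 2) = (0, 1, 2) ∨ (τ 0, τ 1, τ 2) = (0, 2, 1) ∨
      (τ 0, τ 1, τ 2) = (1, 0, 2) ∨ (τ 0, τ 1, τ 2) = (1, 2, 0) ∨ (τ 0, τ 1, τ 2) = (2, 0, 1) ∨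
      (τ 0, τ 1, τ 2) = (2, 1, 0) := by decide
  have h1 := cube_swap_fst hc ha v
  have h2 := cube_swap_snd hc ha v
  rw [e (g ∘ τ)]
  conv_rhs => rw [e g]
  simp only [Function.comp_apply]
  have h := hτ τ
  simp only [Prod.mk.injEq] at h
  rcases h with h | h | h | h | h | h <;> rw [h.1, h.2.1, h.2.2]
  · rw [h2]
  · rw [h1]
  · rw [h2, h1]
  · rw [h1, h2]
  · rw [h1, h2, h1]

theorem exists_forall_cube_eq_zero {X : VertexData V}
    (hc : ∀ i j, Commute (X.creation i) (X.creation j))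
    (ha : ∀ i j, Commute (X.annihilation i) (X.annihilation j)) (v : V) :
    ∃ D : ℤ, ∀ g, (∃ i, D < g i) → X.cube v g = 0 := by
  obtain ⟨D, hD⟩ := X.exists_forall_nord_eq_zero v
  refine ⟨D, fun g ⟨i, hi⟩ => ?_⟩
  -- Symmetry moves the large index to the outermost mode, where the uniform bound applies.
  rw [← cube_perm hc ha v g (Equiv.swap 2 i)]
  exact hD _ (by simpa using hi) _

theorem finite_cube_support {X : VertexData V}
    (hc : ∀ i j, Commute (X.creation i) (X.creation j))
    (ha : ∀ i j, Commute (X.annihilation i) (X.annihilation j)) (a b c : ℤ) (v : V) :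
    (Function.support fun k : ℕ × ℕ × ℕ =>
      X.cube v ![a - k.1 - k.2.2, b + k.1 - k.2.1, c + k.2.1 + k.2.2]).Finite := by
  obtain ⟨D, hD⟩ := exists_forall_cube_eq_zero hc ha v
  refine finite_of_forall_lt₃ (P := fun k l m =>
    X.cube v ![a - k - m, b + k - l, c + l + m] ≠ 0) (D - c + 1).toNat ?_ ?_ ?_
  · intro k l m h
    by_contra h'
    exact h (hD _ ⟨2, by show D < c + l + m; omega⟩)
  · intro k l m h
    by_contra h'
    exact h (hD _ ⟨2, by show D < c + l + m; omega⟩)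
  · intro l m
    refine ⟨(D - b + l + 1).toNat, fun k h => ?_⟩
    by_contra h'
    exact h (hD _ ⟨1, by show D < b + k - l; omega⟩)

/-- Wick's theorem for three factors: the last two are contracted first, then the first factor is
contracted with the outer mode and with the inner one. -/
theorem Contracts.op_op_op {X : VertexData V} {h : PowerSeries ℂ} (hX : Contracts X.op X h)
    (hc : ∀ i j, Commute (X.creation i) (X.creation j))
    (ha : ∀ i j, Commute (X.annihilation i) (X.annihilation j)) (a b c : ℤ) (v : V) :
    X.op a (X.op b (X.op c v)) = ∑ᶠ k : ℕ × ℕ × ℕ, tripleCoeff h k •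
      X.cube v ![a - k.1 - k.2.2, b + k.1 - k.2.1, c + k.2.1 + k.2.2] := by
  have h1 : ∀ k l : ℕ, X.nord (c + k + l) (X.op (a - l) * X.op (b - k)) v =
      ∑ᶠ m : ℕ, PowerSeries.coeff m h •
        X.nord (c + k + l) (X.nord (b - k + m) (X.op (a - l - m))) v := by
    intro k l
    refine X.nord_eq_finsum _ (fun w => ?_) (fun w => ?_) v
    · exact hX.op_op _ _ w
    · obtain ⟨D, hD⟩ := X.exists_forall_nord_eq_zero w
      exact ⟨(D - b + k + 1).toNat, fun m hm => hD _ (by omega) _⟩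
  rw [hX.op_op b c, map_finsum_of_finite]
  · simp only [map_smul, hX.apply_nord, h1, smul_finsum, smul_smul]
    have hfin := finite_cube_support hc ha a b c v
    -- The contractions arise in the order `y/w`, `y/z`, `w/z`; `σ` restores the order `w/z`, `y/w`,
    -- `y/z`.
    let σ : ℕ × ℕ × ℕ ≃ ℕ × ℕ × ℕ :=
      ⟨fun k => (k.2.2, k.1, k.2.1), fun k => (k.2.1, k.2.2, k.1), fun _ => rfl, fun _ => rfl⟩
    rw [← finsum_comp_equiv σ, finsum_curry₃]
    · refine finsum_congr fun k => finsum_congr fun l => finsum_congr fun m => ?_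
      have e1 : a - (m : ℤ) - l = a - l - m := by ring
      have e2 : b + (m : ℤ) - k = b - k + m := by ring
      show _ = tripleCoeff h (m, k, l) • X.cube v ![a - m - l, b + m - k, c + k + l]
      rw [e1, e2, tripleCoeff, cube]
      congr 1
      ring
    · refine (hfin.preimage σ.injective.injOn).subset fun k hk h0 => hk ?_
      show _ • X.cube v _ = 0
      rw [show X.cube v _ = 0 from h0, smul_zero]
  · obtain ⟨D, hD⟩ := X.exists_forall_nord_eq_zero v
    refine (range (D - c + 1).toNat).finite_toSet.subset fun k hk => ?_
    by_contra h'
    simp only [coe_range, Set.mem_Iio] at h'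
    exact hk (by simp [hD (c + k) (by omega)])

end VertexData

end NormalOrdering
end
end EllipticToroidal

namespace EllipticToroidal

noncomputable section

/-! ### Calculus of finite sums of vectors -/

section FiniteSumPredicate

open Finset

variable {ι V : Type*} [AddCommGroup V] {f g : ι → V} {v w : V}

theorem HasFiniteSum.add (hf : HasFiniteSum f v) (hg : HasFiniteSum g w) :
    HasFiniteSum (fun i => f i + g i) (v + w) :=
  ⟨(hf.1.union hg.1).subset (Function.support_add f g),
    by rw [finsum_add_distrib hf.1 hg.1, hf.2, hg.2]⟩

theorem hasFiniteSum_zero : HasFiniteSum (fun _ : ι => (0 : V)) 0 :=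
  ⟨by simp, finsum_zero⟩

theorem HasFiniteSum.sum {κ : Type*} {s : Finset κ} {f : κ → ι → V} {v : κ → V}
    (h : ∀ k ∈ s, HasFiniteSum (f k) (v k)) :
    HasFiniteSum (fun i => ∑ k ∈ s, f k i) (∑ k ∈ s, v k) := by
  classical
  induction s using Finset.induction_on with
  | empty => simpa using hasFiniteSum_zero
  | insert a s ha ih =>
    simp only [sum_insert ha]
    exact (h a (mem_insert_self a s)).add (ih fun k hk => h k (mem_insert_of_mem hk))

theorem HasFiniteSum.sum_fiber {κ : Type*} (fib : ι → Finset κ) (p : κ → ι)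
    (h : ∀ i x, x ∈ fib i ↔ p x = i) {F : κ → V} (hF : HasFiniteSum F v) :
    HasFiniteSum (fun i => ∑ x ∈ fib i, F x) v := by
  refine ⟨(hF.1.image p).subset fun i hi => ?_, by rw [finsum_sum_fiber fib p h hF.1, hF.2]⟩
  obtain ⟨x, hx, hx0⟩ := exists_ne_zero_of_sum_ne_zero hi
  exact ⟨x, hx0, (h i x).mp hx⟩

end FiniteSumPredicate

/-! ### The rational identity behind the cubic relations -/

section Serre

open Finset PowerSeries

/-- Only the shape of `P` matters: a binary cubic form with opposite coefficients at `a³` and `b³`.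
The signs are those of the permutations, and compensate the antisymmetric factor `(x - y)(y - z)(x -
z)` extracted in `serre_term`. -/
theorem serre_polynomial_identity {R : Type*} [CommRing R] (x y z p A B : R) (P : R → R → R)
    (hP : ∀ a b, P a b = p * (a ^ 3 - b ^ 3) + A * a * b ^ 2 - B * a ^ 2 * b) :
    P x y * P y z * P x z * (x * y ^ 2 + z * y ^ 2 - x ^ 2 * z - z ^ 2 * x)
    - P x z * P z y * P x y * (x * z ^ 2 + y * z ^ 2 - x ^ 2 * y - y ^ 2 * x)
    - P y x * P x z * P y z * (y * x ^ 2 + z * x ^ 2 - y ^ 2 * z - z ^ 2 * y)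
    + P y z * P z x * P y x * (y * z ^ 2 + x * z ^ 2 - y ^ 2 * x - x ^ 2 * y)
    + P z x * P x y * P z y * (z * x ^ 2 + y * x ^ 2 - z ^ 2 * y - y ^ 2 * z)
    - P z y * P y x * P z x * (z * y ^ 2 + x * y ^ 2 - z ^ 2 * x - x ^ 2 * z) = 0 := by
  simp only [hP]
  ring

/-- The numerator and denominator of the contraction of one ordering, cleared by the denominators
of the opposite ordering. -/
theorem contraction_pair {R : Type*} [CommRing R] {x y ux uy α β G : R} (hx : x * ux = 1)
    (hy : y * uy = 1) (hG : G * ((1 - α * (x * uy)) * (1 - β * (x * uy))) = 1) :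
    (1 - y * ux) * (1 - α * β * (y * ux)) =
      G * (ux ^ 2 * uy ^ 2 * ((x - y) * ((x - α * β * y) * (y - α * x) * (y - β * x)))) := by
  have h1 : 1 - y * ux = ux * (x - y) := by linear_combination -hx
  have h2 : 1 - α * β * (y * ux) = ux * (x - α * β * y) := by linear_combination -hx
  have h3 : 1 - α * (x * uy) = uy * (y - α * x) := by linear_combination -hy
  have h4 : 1 - β * (x * uy) = uy * (y - β * x) := by linear_combination -hy
  rw [h3, h4] at hG
  rw [h1, h2]
  linear_combination -(ux * (x - y) * (ux * (x - α * β * y))) * hG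

/-- Brings one ordering over a common denominator. The product of all six `G` and the power of `ux *
uy * uz` are symmetric in the variables, the Vandermonde factor is antisymmetric, and the rest is a
term of the polynomial identity. -/
theorem serre_term {R : Type*} [CommRing R] {x y z ux uy uz α β Gyx Gzy Gzx : R} (hx : x * ux = 1)
    (hy : y * uy = 1) (hz : z * uz = 1)
    (h1 : Gyx * ((1 - α * (x * uy)) * (1 - β * (x * uy))) = 1)
    (h2 : Gzy * ((1 - α * (y * uz)) * (1 - β * (y * uz))) = 1)
    (h3 : Gzx * ((1 - α * (x * uz)) * (1 - β * (x * uz))) = 1) (Gxy Gyz Gxz : R) {P : R → R → R}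
    (hP : ∀ a b, (a - α * β * b) * (b - α * a) * (b - β * a) = P a b) :
    Gxy * (Gyz * Gxz) * ((y * uz + y * ux - x * uy - z * uy) *
      ((1 - y * ux) * (1 - α * β * (y * ux)) * ((1 - z * uy) * (1 - α * β * (z * uy))) *
        ((1 - z * ux) * (1 - α * β * (z * ux))))) =
    Gxy * Gyz * Gxz * Gyx * Gzy * Gzx * (ux * uy * uz) ^ 5 * ((x - y) * (y - z) * (x - z) *
      (P x y * P y z * P x z * (x * y ^ 2 + z * y ^ 2 - x ^ 2 * z - z ^ 2 * x))) := by
  have hq : y * uz + y * ux - x * uy - z * uy =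
      ux * uy * uz * (x * y ^ 2 + z * y ^ 2 - x ^ 2 * z - z ^ 2 * x) := by
    linear_combination (-(y * uz) * (y * uy) + x * uy * (z * uz)) * hx - y * uz * hy
      - y * ux * (z * uz) * hy - y * ux * hz + x * uy * hz + z * uy * (z * uz) * hx + z * uy * hz
  rw [contraction_pair hx hy h1, contraction_pair hy hz h2, contraction_pair hx hz h3, hq,
    hP, hP, hP]
  ring

/-- The rational function identity behind the cubic relations. -/
theorem serre_rational_identity {R : Type*} [CommRing R] {α β : R} {z u : Fin 3 → R}
    {G : Fin 3 → Fin 3 → R} (hz : ∀ i, z i * u i = 1)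
    (hG : ∀ i j, G i j * ((1 - α * (z j * u i)) * (1 - β * (z j * u i))) = 1)
    {T : Fin 3 → Fin 3 → Fin 3 → R}
    (hT : ∀ i j k, T i j k = G i j * (G j k * G i k) *
      ((z j * u k + z j * u i - z i * u j - z k * u j) *
      ((1 - z j * u i) * (1 - α * β * (z j * u i)) * ((1 - z k * u j) * (1 - α * β * (z k * u j))) *
        ((1 - z k * u i) * (1 - α * β * (z k * u i)))))) :
    T 0 1 2 + T 0 2 1 + T 1 0 2 + T 1 2 0 + T 2 0 1 + T 2 1 0 = 0 := by
  obtain ⟨P, hP⟩ : ∃ P : R → R → R, ∀ a b, (a - α * β * b) * (b - α * a) * (b - β * a) = P a b :=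
    ⟨_, fun _ _ => rfl⟩
  have h := fun i j k : Fin 3 => (hT i j k).trans
    (serre_term (hz i) (hz j) (hz k) (hG j i) (hG k j) (hG k i) (G i j) (G j k) (G i k) hP)
  -- The coefficients come from expanding `(a - αβb)(b - αa)(b - βa)`.
  have key := serre_polynomial_identity (z 0) (z 1) (z 2) (α * β) (1 + α * β * (α + β))
    (α + β + (α * β) ^ 2) P (fun a b => by rw [← hP]; ring)
  simp only [h]
  linear_combination (G 0 1 * G 1 2 * G 0 2 * G 1 0 * G 2 1 * G 2 0 * (u 0 * u 1 * u 2) ^ 5 *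
    ((z 0 - z 1) * (z 1 - z 2) * (z 0 - z 2))) * key

end Serre
end
end EllipticToroidal

namespace EllipticToroidal

noncomputable section

/-! ### An auxiliary variable and its specialization at 1 -/

section Specialization

open Finset PowerSeries

variable {L V : Type*} [CommRing L] [Algebra ℂ L] [AddCommGroup V] [Module ℂ V]

/-- The substitution `X ↦ r X` with values in power series over `L`. -/
def evalSeries (r : L) : PowerSeries ℂ →+* PowerSeries L :=
  (rescale r).comp (PowerSeries.map (algebraMap ℂ L))

theorem coeff_evalSeries (r : L) (g : PowerSeries ℂ) (n : ℕ) :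
    coeff n (evalSeries r g) = r ^ n * algebraMap ℂ L (coeff n g) := by
  simp [evalSeries, coeff_rescale]

theorem evalSeries_C (r : L) (a : ℂ) : evalSeries r (C a) = C (algebraMap ℂ L a) := by
  ext n
  rw [coeff_evalSeries, coeff_C, coeff_C]
  split_ifs with h <;> simp [h]

theorem evalSeries_X (r : L) : evalSeries r X = C r * X := by
  ext n
  rw [coeff_evalSeries, coeff_C_mul, coeff_X, coeff_X]
  split_ifs with h <;> simp [h]

theorem finite_support_smul {ι : Type*} {f : ι → V} (hf : (Function.support f).Finite)
    (c : ι → ℂ) : (Function.support fun i => c i • f i).Finite :=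
  hf.subset fun i hi h0 => hi (by
    show c i • f i = 0
    rw [h0, smul_zero])

/-- The monomial `r₁ ^ k₁ r₂ ^ k₂ r₃ ^ k₃`. -/
def tripleMonomial (r : L × L × L) (k : ℕ × ℕ × ℕ) : L :=
  r.1 ^ k.1 * r.2.1 ^ k.2.1 * r.2.2 ^ k.2.2

/-- A product of three power series and a polynomial can be specialized at `X = 1` under a
linear form which is locally finite on the monomials. -/
theorem hasFiniteSum_specialize (Λ : L →ₗ[ℂ] V) (r : L × L × L)
    (hfin : ∀ M, (Function.support fun k => Λ (tripleMonomial r k * M)).Finite)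
    (g : PowerSeries ℂ) (P : Polynomial L) :
    HasFiniteSum (fun d => Λ (coeff d
      (evalSeries r.1 g * (evalSeries r.2.1 g * evalSeries r.2.2 g) * (P : PowerSeries L))))
      (∑ᶠ k, tripleCoeff g k • Λ (tripleMonomial r k * P.eval 1)) := by
  have hfin' : ∀ M, (Function.support fun k =>
      tripleCoeff g k • Λ (tripleMonomial r k * M)).Finite := fun M =>
    finite_support_smul (hfin M) _
  induction P using Polynomial.induction_on' with
  | add P Q hP hQ =>
    have h := hP.add hQ
    rw [← finsum_add_distrib (hfin' _) (hfin' _)] at h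
    simpa only [← map_add, ← mul_add, ← smul_add, Polynomial.coe_add, Polynomial.eval_add] using h
  | monomial e M =>
    rw [Polynomial.eval_monomial, one_pow, mul_one]
    have h1 : HasFiniteSum (fun k => tripleCoeff g k • Λ (tripleMonomial r k * M))
      (∑ᶠ k, tripleCoeff g k • Λ (tripleMonomial r k * M)) := ⟨hfin' M, rfl⟩
    -- The sum over triples is regrouped in three stages, matching the nested products of series and
    -- the shift by the degree `e` of the monomial.
    have h2 := h1.sum_fiber (fun x : ℕ × ℕ => {x.1} ×ˢ antidiagonal x.2)
      (fun k => (k.1, k.2.1 + k.2.2)) fun x k => by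
        rw [mem_product, mem_singleton, HasAntidiagonal.mem_antidiagonal, Prod.ext_iff]
    have h3 := h2.sum_fiber antidiagonal (fun x => x.1 + x.2)
      fun _ _ => HasAntidiagonal.mem_antidiagonal
    have h4 := h3.sum_fiber (fun d => if e ≤ d then {d - e} else ∅) (fun x => x + e) fun d x => by
      split_ifs with h
      · rw [mem_singleton]; omega
      · simp only [notMem_empty, false_iff]; omega
    convert h4 using 2 with d
    have e1 : ((Polynomial.monomial e M : Polynomial L) : PowerSeries L) = C M * X ^ e := by
      rw [← Polynomial.C_mul_X_pow_eq_monomial, Polynomial.coe_mul, Polynomial.coe_C,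
        Polynomial.coe_pow, Polynomial.coe_X]
    rw [e1, ← mul_assoc, coeff_mul_X_pow']
    split_ifs with h
    · rw [sum_singleton, coeff_mul_C, coeff_mul, sum_mul, map_sum]
      refine sum_congr rfl fun x _ => ?_
      rw [sum_product, sum_singleton, coeff_mul, mul_sum, sum_mul, map_sum]
      refine sum_congr rfl fun y _ => ?_
      rw [← map_smul, coeff_evalSeries, coeff_evalSeries, coeff_evalSeries, Algebra.smul_def,
        tripleCoeff, tripleMonomial]
      congr 1
      rw [map_mul, map_mul]
      ring
    · rw [sum_empty, map_zero]

theorem coeff_contraction_numerator (c : ℂ) (n : ℕ) :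
    coeff n ((1 - X) * (1 - C c * X) : PowerSeries ℂ) =
      if n = 0 then 1 else if n = 1 then -(1 + c) else if n = 2 then c else 0 := by
  have h : ((1 - X) * (1 - C c * X) : PowerSeries ℂ) = 1 - C (1 + c) * X + C c * X ^ 2 := by
    rw [map_add, map_one]; ring
  rw [h, map_add, map_sub, coeff_one, coeff_C_mul, coeff_C_mul, coeff_X, coeff_X_pow]
  rcases n with _ | _ | _ | n <;> simp

theorem finsum_numerator_smul (Λ : L →ₗ[ℂ] V) (r : L × L × L) (c : ℂ) (k : ℕ × ℕ × ℕ) (M : L) :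
    ∑ᶠ l, tripleCoeff ((1 - X) * (1 - C c * X)) l • Λ (tripleMonomial r (k + l) * M) =
      Λ (tripleMonomial r k * (M * ((1 - r.1) * (1 - algebraMap ℂ L c * r.1) *
        ((1 - r.2.1) * (1 - algebraMap ℂ L c * r.2.1)) *
        ((1 - r.2.2) * (1 - algebraMap ℂ L c * r.2.2))))) := by
  rw [finsum_eq_sum_of_support_subset (s := range 3 ×ˢ range 3 ×ˢ range 3)]
  · simp only [← map_smul, ← map_sum]
    congr 1
    have hs : ∀ x : L, (1 - x) * (1 - algebraMap ℂ L c * x) = ∑ n ∈ range 3,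
        algebraMap ℂ L (coeff n ((1 - X) * (1 - C c * X) : PowerSeries ℂ)) * x ^ n := by
      intro x
      simp only [coeff_contraction_numerator, sum_range_succ, sum_range_zero]
      norm_num
      ring
    rw [hs, hs, hs, sum_mul_sum, sum_mul, mul_sum, mul_sum, sum_product]
    refine sum_congr rfl fun x _ => ?_
    rw [sum_mul, mul_sum, mul_sum, sum_product]
    refine sum_congr rfl fun y _ => ?_
    rw [mul_sum, mul_sum, mul_sum]
    refine sum_congr rfl fun z _ => ?_
    rw [Algebra.smul_def, tripleCoeff, tripleMonomial, tripleMonomial, map_mul, map_mul]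
    simp only [Prod.fst_add, Prod.snd_add, pow_add]
    ring
  · rintro ⟨l1, l2, l3⟩ hl
    have h : ∀ n, coeff n ((1 - X) * (1 - C c * X) : PowerSeries ℂ) ≠ 0 → n < 3 := by
      intro n hn
      by_contra h
      refine hn ?_
      rw [coeff_contraction_numerator, if_neg (by omega), if_neg (by omega), if_neg (by omega)]
    have h0 := left_ne_zero_of_smul hl
    simp only [tripleCoeff] at h0
    simp only [coe_product, Set.mem_prod, coe_range, Set.mem_Iio]
    exact ⟨h _ (left_ne_zero_of_mul (left_ne_zero_of_mul h0)),
      h _ (right_ne_zero_of_mul (left_ne_zero_of_mul h0)), h _ (right_ne_zero_of_mul h0)⟩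

/-- Moves the polynomial numerators of the contractions from the scalar coefficients into the
argument of `Λ`, so that only the inverted denominators remain as infinite series. -/
theorem finsum_numerator_mul (Λ : L →ₗ[ℂ] V) (r : L × L × L)
    (hfin : ∀ M, (Function.support fun k => Λ (tripleMonomial r k * M)).Finite) (c : ℂ)
    (g : PowerSeries ℂ) (M : L) :
    ∑ᶠ k, tripleCoeff ((1 - X) * (1 - C c * X) * g) k • Λ (tripleMonomial r k * M) =
      ∑ᶠ k, tripleCoeff g k • Λ (tripleMonomial r k *
        (M * ((1 - r.1) * (1 - algebraMap ℂ L c * r.1) *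
        ((1 - r.2.1) * (1 - algebraMap ℂ L c * r.2.1)) *
        ((1 - r.2.2) * (1 - algebraMap ℂ L c * r.2.2))))) := by
  have h := finsum_smul_finsum_add (hfin M) (tripleCoeff g)
    (tripleCoeff ((1 - X) * (1 - C c * X)))
  simp only [sum_antidiagonal_tripleCoeff] at h
  rw [mul_comm _ g, ← h]
  exact finsum_congr fun k => by rw [finsum_numerator_smul]

theorem sum_perm_fin_three {M : Type*} [AddCommMonoid M] (F : Fin 3 → Fin 3 → Fin 3 → M) :
    ∑ τ : Equiv.Perm (Fin 3), F (τ 0) (τ 1) (τ 2) =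
      F 0 1 2 + F 0 2 1 + F 1 0 2 + F 1 2 0 + F 2 0 1 + F 2 1 0 := by
  have h : (univ : Finset (Equiv.Perm (Fin 3))) = {1, Equiv.swap 1 2, Equiv.swap 0 1,
      Equiv.swap 0 1 * Equiv.swap 1 2, Equiv.swap 1 2 * Equiv.swap 0 1, Equiv.swap 0 2} := by
    decide
  rw [h, sum_insert (by decide), sum_insert (by decide), sum_insert (by decide),
    sum_insert (by decide), sum_insert (by decide), sum_singleton]
  simp only [add_assoc]
  rfl

/-- The factor `w / y + w / z - z / w - y / w` of the cubic relation. -/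
def serreFactor (r : Fin 3 → Fin 3 → L) (i j k : Fin 3) : L :=
  r k j + r i j - r j i - r j k

/-- The numerators of the contractions for the ordering `i, j, k` of the variables, times the
factor of the cubic relation, with an auxiliary variable. -/
def serreNumerator (r : Fin 3 → Fin 3 → L) (c : ℂ) (i j k : Fin 3) : Polynomial L :=
  Polynomial.C (serreFactor r i j k) *
    ((1 - Polynomial.C (r i j)) *
      (1 - Polynomial.C (algebraMap ℂ L c * r i j) * Polynomial.X ^ 2) *
    ((1 - Polynomial.C (r j k)) *
      (1 - Polynomial.C (algebraMap ℂ L c * r j k) * Polynomial.X ^ 2)) *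
    ((1 - Polynomial.C (r i k)) *
      (1 - Polynomial.C (algebraMap ℂ L c * r i k) * Polynomial.X ^ 2)))

/-- The exponent 2 of the auxiliary variable is chosen so that `abX² = (aX)(bX)`, the product `α *
β` of `serre_rational_identity`. -/
theorem coe_serreNumerator (r : Fin 3 → Fin 3 → L) (a b : ℂ) (i j k : Fin 3) :
    (serreNumerator r (a * b) i j k : PowerSeries L) =
      (C (r k j) + C (r i j) - C (r j i) - C (r j k)) *
      ((1 - C (r i j)) * (1 - C (algebraMap ℂ L a) * X * (C (algebraMap ℂ L b) * X) * C (r i j)) *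
      ((1 - C (r j k)) * (1 - C (algebraMap ℂ L a) * X * (C (algebraMap ℂ L b) * X) * C (r j k))) *
      ((1 - C (r i k)) *
        (1 - C (algebraMap ℂ L a) * X * (C (algebraMap ℂ L b) * X) * C (r i k)))) := by
  have h : ∀ x : L, C (algebraMap ℂ L (a * b) * x) * X ^ 2 =
      C (algebraMap ℂ L a) * X * (C (algebraMap ℂ L b) * X) * C x := by
    intro x
    rw [map_mul, map_mul, map_mul]
    ring
  simp only [serreNumerator, serreFactor, Polynomial.coe_mul, Polynomial.coe_sub,
    Polynomial.coe_add, Polynomial.coe_one, Polynomial.coe_pow, Polynomial.coe_X,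
    Polynomial.coe_C, h, map_sub, map_add]

theorem eval_serreNumerator (r : Fin 3 → Fin 3 → L) (c : ℂ) (i j k : Fin 3) :
    (serreNumerator r c i j k).eval 1 = serreFactor r i j k *
      ((1 - r i j) * (1 - algebraMap ℂ L c * r i j) *
        ((1 - r j k) * (1 - algebraMap ℂ L c * r j k)) *
        ((1 - r i k) * (1 - algebraMap ℂ L c * r i k))) := by
  simp [serreNumerator]

/-- The cubic sum for the ordering `i, j, k` of the variables, as a power series in an auxiliary
variable. -/
def serreSeries (r : Fin 3 → Fin 3 → L) (g : PowerSeries ℂ) (c : ℂ) (i j k : Fin 3) :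
    PowerSeries L :=
  evalSeries (r i j) g * (evalSeries (r j k) g * evalSeries (r i k) g) *
    (serreNumerator r c i j k : PowerSeries L)

/-- In power series in `X` over `L` the denominators `1 - aX z_j/z_i` are invertible for both orders
of `i` and `j`, so the rational identity holds there literally. -/
theorem sum_serreSeries {z u : Fin 3 → L} (hz : ∀ i, z i * u i = 1) {a b : ℂ} {g : PowerSeries ℂ}
    (hg : g * ((1 - C a * X) * (1 - C b * X)) = 1) :
    ∑ τ : Equiv.Perm (Fin 3),
      serreSeries (fun i j => z j * u i) g (a * b) (τ 0) (τ 1) (τ 2) = 0 := by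
  rw [sum_perm_fin_three]
  refine serre_rational_identity (α := C (algebraMap ℂ L a) * X)
    (β := C (algebraMap ℂ L b) * X) (z := fun i => C (z i)) (u := fun i => C (u i))
    (G := fun i j => evalSeries (z j * u i) g) ?_ ?_ ?_
  · intro i
    rw [← map_mul, hz, map_one]
  · intro i j
    have h := congrArg (evalSeries (z j * u i)) hg
    simp only [map_mul, map_sub, map_one, evalSeries_C, evalSeries_X] at h
    refine Eq.trans ?_ h
    ring
  · intro i j k
    rw [serreSeries, coe_serreNumerator]
    simp only [map_mul C]

end Specialization

/-! ### The cubic relation for symmetric Laurent series -/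

section SerreSum

open Finset PowerSeries

/-- Laurent polynomials in three variables. -/
abbrev Laurent : Type := AddMonoidAlgebra ℂ (Fin 3 → ℤ)

/-- The Laurent monomial with exponent `g`. -/
def laurentMonomial (g : Fin 3 → ℤ) : Laurent := AddMonoidAlgebra.single g 1

theorem laurentMonomial_mul (g g' : Fin 3 → ℤ) :
    laurentMonomial g * laurentMonomial g' = laurentMonomial (g + g') := by
  rw [laurentMonomial, laurentMonomial, AddMonoidAlgebra.single_mul_single, one_mul]
  rfl

theorem laurentMonomial_pow (g : Fin 3 → ℤ) (n : ℕ) :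
    laurentMonomial g ^ n = laurentMonomial (n • g) := by
  rw [laurentMonomial, AddMonoidAlgebra.single_pow, one_pow]
  rfl

variable {V : Type*} [AddCommGroup V] [Module ℂ V]

/-- The linear form on Laurent polynomials with prescribed values on monomials. -/
def laurentForm (N : (Fin 3 → ℤ) → V) : Laurent →ₗ[ℂ] V :=
  Finsupp.linearCombination ℂ N ∘ₗ (AddMonoidAlgebra.coeffLinearEquiv ℂ).toLinearMap

theorem laurentForm_single (N : (Fin 3 → ℤ) → V) (g : Fin 3 → ℤ) (c : ℂ) :
    laurentForm N (AddMonoidAlgebra.single g c) = c • N g :=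
  Finsupp.linearCombination_single ℂ c g

/-- The ratio `z_j / z_i`. -/
def ratio (i j : Fin 3) : Laurent :=
  laurentMonomial (Pi.single j 1) * laurentMonomial (Pi.single i (-1))

theorem ratio_pow (i j : Fin 3) (n : ℕ) :
    ratio i j ^ n = laurentMonomial (Pi.single j (n : ℤ) + Pi.single i (-n : ℤ)) := by
  rw [ratio, laurentMonomial_mul, laurentMonomial_pow, smul_add, ← Pi.single_smul,
    ← Pi.single_smul]
  simp

/-- The three ratios entering the cubic relation for one ordering of the variables. -/
def ratios (τ : Equiv.Perm (Fin 3)) : Laurent × Laurent × Laurent :=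
  (ratio (τ 0) (τ 1), ratio (τ 1) (τ 2), ratio (τ 0) (τ 2))

/-- Symmetry of `N` permits reading the exponents in the order given by `τ`, where the three ratios
become the shifts of the cubic sum. -/
theorem laurentForm_ratios {N : (Fin 3 → ℤ) → V}
    (hN : ∀ g (τ : Equiv.Perm (Fin 3)), N (g ∘ τ) = N g) (n m : Fin 3 → ℤ)
    (τ : Equiv.Perm (Fin 3)) (c : ℂ) (k : ℕ × ℕ × ℕ) :
    laurentForm (fun g => N (n + g))
      (tripleMonomial (ratios τ) k * AddMonoidAlgebra.single m c) =
    c • N ![(n + m) (τ 0) - k.1 - k.2.2, (n + m) (τ 1) + k.1 - k.2.1,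
      (n + m) (τ 2) + k.2.1 + k.2.2] := by
  rw [tripleMonomial, ratios, ratio_pow, ratio_pow, ratio_pow, laurentMonomial_mul,
    laurentMonomial_mul, laurentMonomial, AddMonoidAlgebra.single_mul_single, laurentForm_single,
    one_mul, ← hN _ τ]
  congr 2
  ext i
  fin_cases i <;> simp <;> ring

theorem finite_laurentForm_support {N : (Fin 3 → ℤ) → V}
    (hN : ∀ g (τ : Equiv.Perm (Fin 3)), N (g ∘ τ) = N g)
    (hD : ∃ D : ℤ, ∀ g, (∃ i, D < g i) → N g = 0) (n : Fin 3 → ℤ) (τ : Equiv.Perm (Fin 3))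
    (M : Laurent) : (Function.support fun k =>
      laurentForm (fun g => N (n + g)) (tripleMonomial (ratios τ) k * M)).Finite := by
  induction M using AddMonoidAlgebra.induction_linear with
  | zero => simp
  | add M M' h h' =>
    simp only [mul_add, map_add]
    exact (h.union h').subset (Function.support_add _ _)
  | single m c =>
    simp only [laurentForm_ratios hN]
    obtain ⟨D, hD⟩ := hD
    refine finite_of_forall_lt₃ (P := fun k l j => c • N ![(n + m) (τ 0) - k - j,
      (n + m) (τ 1) + k - l, (n + m) (τ 2) + l + j] ≠ 0) (D - (n + m) (τ 2) + 1).toNat ?_ ?_ ?_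
    · intro k l j h
      by_contra h'
      refine h ?_
      rw [hD _ ⟨2, by show D < (n + m) (τ 2) + l + j; omega⟩, smul_zero]
    · intro k l j h
      by_contra h'
      refine h ?_
      rw [hD _ ⟨2, by show D < (n + m) (τ 2) + l + j; omega⟩, smul_zero]
    · intro l j
      refine ⟨(D - (n + m) (τ 1) + l + 1).toNat, fun k h => ?_⟩
      by_contra h'
      refine h ?_
      rw [hD _ ⟨1, by show D < (n + m) (τ 1) + k - l; omega⟩, smul_zero]

/-- The cubic relation for a symmetric three-variable series multiplied by contractions of the
form `(1 - ζ) (1 - a b ζ) / ((1 - a ζ) (1 - b ζ))`. -/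
theorem serre_sum_eq_zero {a b : ℂ} {f : PowerSeries ℂ}
    (hf : f * ((1 - C a * X) * (1 - C b * X)) = (1 - X) * (1 - C (a * b) * X))
    {N : (Fin 3 → ℤ) → V} (hN : ∀ g (τ : Equiv.Perm (Fin 3)), N (g ∘ τ) = N g)
    (hD : ∃ D : ℤ, ∀ g, (∃ i, D < g i) → N g = 0) {Φ : ℤ → ℤ → ℤ → V}
    (hΦ : ∀ a b c, Φ a b c = ∑ᶠ k : ℕ × ℕ × ℕ, tripleCoeff f k •
      N ![a - k.1 - k.2.2, b + k.1 - k.2.1, c + k.2.1 + k.2.2]) (n : Fin 3 → ℤ) :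
    ∑ τ : Equiv.Perm (Fin 3), (Φ (n (τ 0)) (n (τ 1) + 1) (n (τ 2) - 1) +
      Φ (n (τ 0) - 1) (n (τ 1) + 1) (n (τ 2)) - Φ (n (τ 0) + 1) (n (τ 1) - 1) (n (τ 2)) -
      Φ (n (τ 0)) (n (τ 1) - 1) (n (τ 2) + 1)) = 0 := by
  set d : PowerSeries ℂ := (1 - C a * X) * (1 - C b * X) with hd
  have hd0 : d * d⁻¹ = 1 := PowerSeries.mul_inv_cancel _ (by simp [hd])
  have hf' : f = (1 - X) * (1 - C (a * b) * X) * d⁻¹ := by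
    rw [← hf, mul_assoc, hd0, mul_one]
  set Λ := laurentForm fun g => N (n + g) with hΛ
  have hfin := finite_laurentForm_support hN hD n
  -- For each ordering, the Serre combination is the sum over `e` of the images under `Λ` of the
  -- coefficients of `serreSeries`, i.e. its value at `X = 1`.
  have key : ∀ τ : Equiv.Perm (Fin 3),
      HasFiniteSum (fun e => Λ (coeff e (serreSeries ratio d⁻¹ (a * b) (τ 0) (τ 1) (τ 2))))
        (Φ (n (τ 0)) (n (τ 1) + 1) (n (τ 2) - 1) +
      Φ (n (τ 0) - 1) (n (τ 1) + 1) (n (τ 2)) - Φ (n (τ 0) + 1) (n (τ 1) - 1) (n (τ 2)) -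
      Φ (n (τ 0)) (n (τ 1) - 1) (n (τ 2) + 1)) := by
    intro τ
    have hfin' : ∀ M, (Function.support fun k =>
        tripleCoeff f k • Λ (tripleMonomial (ratios τ) k * M)).Finite := fun M =>
      finite_support_smul (hfin τ M) _
    -- Multiplication by the ratio `z_j / z_i` is a shift of the indices by `±1`; the four ratios in
    -- `serreFactor` give the four terms.
    have hΦ' : ∀ i j, Φ ((n + (Pi.single j 1 + Pi.single i (-1) : Fin 3 → ℤ)) (τ 0))
        ((n + (Pi.single j 1 + Pi.single i (-1) : Fin 3 → ℤ)) (τ 1))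
        ((n + (Pi.single j 1 + Pi.single i (-1) : Fin 3 → ℤ)) (τ 2)) =
        ∑ᶠ k, tripleCoeff f k • Λ (tripleMonomial (ratios τ) k * ratio i j) := by
      intro i j
      rw [hΦ]
      refine finsum_congr fun k => ?_
      rw [ratio, laurentMonomial_mul, laurentMonomial, hΛ, laurentForm_ratios hN, one_smul]
    have h1 := hΦ' (τ 2) (τ 1)
    have h2 := hΦ' (τ 0) (τ 1)
    have h3 := hΦ' (τ 1) (τ 0)
    have h4 := hΦ' (τ 1) (τ 2)
    simp [← sub_eq_add_neg] at h1 h2 h3 h4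
    have h5 : Φ (n (τ 0)) (n (τ 1) + 1) (n (τ 2) - 1) +
        Φ (n (τ 0) - 1) (n (τ 1) + 1) (n (τ 2)) - Φ (n (τ 0) + 1) (n (τ 1) - 1) (n (τ 2)) -
        Φ (n (τ 0)) (n (τ 1) - 1) (n (τ 2) + 1) = ∑ᶠ k, tripleCoeff f k •
          Λ (tripleMonomial (ratios τ) k * serreFactor ratio (τ 0) (τ 1) (τ 2)) := by
      simp only [serreFactor, mul_sub, mul_add, map_sub, map_add, smul_sub, smul_add]
      rw [finsum_sub_distrib, finsum_sub_distrib, finsum_add_distrib, h1, h2, h3, h4]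
      · exact hfin' _
      · exact hfin' _
      · simpa only [Function.HasFiniteSupport, mul_add, map_add, smul_add] using
          hfin' (ratio (τ 2) (τ 1) + ratio (τ 0) (τ 1))
      · exact hfin' _
      · simpa only [Function.HasFiniteSupport, mul_sub, mul_add, map_sub, map_add, smul_sub,
          smul_add] using
          hfin' (ratio (τ 2) (τ 1) + ratio (τ 0) (τ 1) - ratio (τ 1) (τ 0))
      · exact hfin' _
    rw [h5, hf', finsum_numerator_mul Λ (ratios τ) (hfin τ)]
    have h6 := hasFiniteSum_specialize Λ (ratios τ) (hfin τ) d⁻¹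
      (serreNumerator ratio (a * b) (τ 0) (τ 1) (τ 2))
    rw [eval_serreNumerator] at h6
    exact h6
  have hz : ∀ i : Fin 3,
      laurentMonomial (Pi.single i 1) * laurentMonomial (Pi.single i (-1)) = 1 := by
    intro i
    rw [laurentMonomial_mul, ← Pi.single_add, add_neg_cancel, Pi.single_zero]
    rfl
  have := HasFiniteSum.sum (s := univ) fun τ _ => key τ
  have h0 : ∑ τ : Equiv.Perm (Fin 3), serreSeries ratio d⁻¹ (a * b) (τ 0) (τ 1) (τ 2) = 0 :=
    sum_serreSeries hz ((mul_comm _ _).trans hd0)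
  simp only [← map_sum, h0, map_zero] at this
  rw [← this.2, finsum_zero]

end SerreSum
end
end EllipticToroidal

namespace EllipticToroidal

noncomputable section

/-! ### Exchange, Serre and commutation relations of vertex operators -/

section Relations

open Finset PowerSeries

namespace VertexData

variable {V : Type*} [AddCommGroup V] [Module ℂ V] {S S' T T' : VertexData V}

theorem finite_nord_support (S : VertexData V) (Y : ℕ → Module.End ℂ V) (b : ℤ) (v : V) :
    (Function.support fun k : ℕ => S.nord (b + k) (Y k) v).Finite := by
  obtain ⟨D, hD⟩ := S.exists_forall_nord_eq_zero v
  refine (range (D - b + 1).toNat).finite_toSet.subset fun k hk => ?_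
  by_contra h'
  simp only [coe_range, Set.mem_Iio] at h'
  exact hk (hD _ (by omega) _)

theorem cubic_shift_add (a b c : ℤ) (k l : ℕ × ℕ × ℕ) :
    ![a - (k + l).1 - (k + l).2.2, b + (k + l).1 - (k + l).2.1,
      c + (k + l).2.1 + (k + l).2.2] =
    ![a - k.1 - k.2.2 - l.1 - l.2.2, b + k.1 - k.2.1 + l.1 - l.2.1,
      c + k.2.1 + k.2.2 + l.2.1 + l.2.2] := by
  ext i
  fin_cases i <;> simp <;> ring

/-- By Wick's theorem, the product of modes shifted by `k` is a combination of normally ordered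
terms depending only on `k + l`, which vanish for all but finitely many values of `k + l`. -/
theorem Contracts.isLocallyFinite {e : PowerSeries ℂ}
    (hS : Contracts S.op S e) (hc : ∀ i j, Commute (S.creation i) (S.creation j))
    (ha : ∀ i j, Commute (S.annihilation i) (S.annihilation j)) : IsLocallyFinite S.op where
  quad a b v := by
    refine (finite_finsum_add_ne_zero (S.finite_nord_support (fun k => S.op (a - k)) b v)
      fun k => coeff k e).subset fun k hk => ?_
    rw [Set.mem_ofPred_eq, hS.op_op] at hk
    simpa only [Set.mem_ofPred_eq, Nat.cast_add, sub_sub, add_assoc] using hk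
  cubic a b c v := by
    refine (finite_finsum_add_ne_zero (finite_cube_support hc ha a b c v)
      (tripleCoeff e)).subset fun k hk => ?_
    rw [Set.mem_ofPred_eq, hS.op_op_op hc ha] at hk
    simp only [Set.mem_ofPred_eq, cubic_shift_add]
    exact hk

theorem Contracts.quadCoeff_eq {e : PowerSeries ℂ}
    (hS : Contracts S.op S e) (h : PowerSeries ℂ) (a b : ℤ) (v : V) :
    quadCoeff h S.op a b v =
      ∑ᶠ k : ℕ, coeff k (h * e) • S.nord (b + k) (S.op (a - k)) v := by
  simp only [coeff_mul]
  rw [← finsum_smul_finsum_add (S.finite_nord_support (fun k => S.op (a - k)) b v)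
    (fun k => coeff k h) (fun k => coeff k e), quadCoeff]
  simp only [hS.op_op, Nat.cast_add, sub_sub, add_assoc]

theorem Contracts.cubicCoeff_eq {e : PowerSeries ℂ}
    (hS : Contracts S.op S e) (hc : ∀ i j, Commute (S.creation i) (S.creation j))
    (ha : ∀ i j, Commute (S.annihilation i) (S.annihilation j)) (h : PowerSeries ℂ)
    (a b c : ℤ) (v : V) :
    cubicCoeff h S.op a b c v = ∑ᶠ k : ℕ × ℕ × ℕ, tripleCoeff (h * e) k •
      S.cube v ![a - k.1 - k.2.2, b + k.1 - k.2.1, c + k.2.1 + k.2.2] := by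
  simp only [← sum_antidiagonal_tripleCoeff]
  rw [← finsum_smul_finsum_add (finite_cube_support hc ha a b c v), cubicCoeff]
  refine finsum_congr fun k => ?_
  rw [hS.op_op_op hc ha, tripleCoeff]
  simp only [cubic_shift_add]

theorem op_eq_nord (S : VertexData V) (m : ℤ) : S.op m = S.nord m 1 := rfl

theorem nord_op_comm (hc : ∀ i j, Commute (S.creation i) (S'.creation j))
    (ha : ∀ i j, Commute (S.annihilation i) (S'.annihilation j)) (m m' : ℤ) :
    S.nord m (S'.op m') = S'.nord m' (S.op m) :=
  nord_comm hc ha m m' 1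

/-- The quadratic exchange relation of a vertex operator whose contraction, multiplied by `h`, is
a self-reciprocal cubic polynomial. -/
theorem Contracts.quad_relation {e h : PowerSeries ℂ}
    (hS : Contracts S.op S e) (hc : ∀ i j, Commute (S.creation i) (S.creation j))
    (ha : ∀ i j, Commute (S.annihilation i) (S.annihilation j)) {c c' : ℂ} (hcc : c * c' = 1)
    (hh : h * e = (1 - X) * (1 - C c * X) * (1 - C c' * X)) (a b : ℤ) (v : V) :
    quadCoeff h S.op (a + 3) b v = -quadCoeff h S.op (b + 3) a v := by
  have hC : (C c * C c' : PowerSeries ℂ) = 1 := by rw [← map_mul, hcc, map_one]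
  -- Because `c * c' = 1`, the coefficients are antipalindromic; exchanging the two variables then
  -- reverses the four terms and changes the sign.
  have hpoly : h * e = 1 - C (1 + c + c') * X + C (1 + c + c') * X ^ 2 - X ^ 3 := by
    rw [hh, map_add, map_add, map_one]
    linear_combination (X ^ 2 - X ^ 3) * hC
  have hcoeff : ∀ k, coeff k (h * e) = if k = 0 then 1 else if k = 1 then -(1 + c + c') else
      if k = 2 then 1 + c + c' else if k = 3 then -1 else 0 := by
    intro k
    rw [hpoly, map_sub, map_add, map_sub, coeff_one, coeff_C_mul, coeff_C_mul, coeff_X,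
      coeff_X_pow, coeff_X_pow]
    rcases k with _ | _ | _ | _ | k <;> simp
  have hq : ∀ a b : ℤ, quadCoeff h S.op (a + 3) b v = S.nord b (S.op (a + 3)) v -
      (1 + c + c') • S.nord (b + 1) (S.op (a + 2)) v +
      (1 + c + c') • S.nord (b + 2) (S.op (a + 1)) v - S.nord (b + 3) (S.op a) v := by
    intro a b
    rw [hS.quadCoeff_eq, finsum_eq_sum_of_support_subset (s := range 4)]
    · simp only [sum_range_succ, sum_range_zero, hcoeff]
      norm_num
      rw [show a + 3 - 1 = a + 2 by ring, show a + 3 - 2 = a + 1 by ring]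
      module
    · intro k hk
      by_contra h'
      simp only [coe_range, Set.mem_Iio] at h'
      refine hk ?_
      show coeff k (h * e) • _ = 0
      rw [hcoeff, if_neg (by omega), if_neg (by omega), if_neg (by omega), if_neg (by omega),
        zero_smul]
  rw [hq, hq, nord_op_comm hc ha b, nord_op_comm hc ha (b + 1), nord_op_comm hc ha (b + 2),
    nord_op_comm hc ha (b + 3)]
  module

/-- The cubic (Serre) relation of a vertex operator. -/
theorem Contracts.serre_relation {e h : PowerSeries ℂ}
    (hS : Contracts S.op S e) (hc : ∀ i j, Commute (S.creation i) (S.creation j))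
    (ha : ∀ i j, Commute (S.annihilation i) (S.annihilation j)) {a b : ℂ}
    (hh : h * e * ((1 - C a * X) * (1 - C b * X)) = (1 - X) * (1 - C (a * b) * X))
    (n : Fin 3 → ℤ) (v : V) :
    ∑ τ : Equiv.Perm (Fin 3), serreCoeff h S.op (n (τ 0)) (n (τ 1)) (n (τ 2)) v = 0 :=
  serre_sum_eq_zero (Φ := fun a b c => cubicCoeff h S.op a b c v) hh (cube_perm hc ha v)
    (exists_forall_cube_eq_zero hc ha v) (fun a b c => hS.cubicCoeff_eq hc ha h a b c v) n

/-- Difference of the expansions of one function in opposite directions. The constant terms cancel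
whatever `h 0` is, and oddness of `s` merges the two half-sums into one over `ℤ`. -/
theorem finsum_sub_finsum_neg {h : ℕ → ℂ} {s : ℤ → ℂ} (hs : ∀ k : ℕ, k ≠ 0 → h k = s k)
    (hodd : ∀ k, s (-k) = -s k) {F : ℤ → V} (hF : (Function.support F).Finite) :
    ∑ᶠ k : ℕ, h k • F k - ∑ᶠ k : ℕ, h k • F (-k) = ∑ᶠ k : ℤ, s k • F k := by
  have h0 : s 0 = 0 := by
    have := hodd 0
    rw [neg_zero] at this
    exact self_eq_neg.mp this
  have hf1 : (Function.support fun k : ℕ => F k).Finite :=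
    hF.preimage (f := fun k : ℕ => (k : ℤ)) Nat.cast_injective.injOn
  have hf2 : (Function.support fun k : ℕ => F (-k)).Finite :=
    hF.preimage (f := fun k : ℕ => -(k : ℤ)) (neg_injective.comp Nat.cast_injective).injOn
  rw [← finsum_sub_distrib (finite_support_smul hf1 h) (finite_support_smul hf2 h),
    ← finsum_sum_fiber (fun n : ℕ => {(n : ℤ), -(n : ℤ)}) Int.natAbs (fun n k => ?_)
      (finite_support_smul hF s)]
  · refine finsum_congr fun k => ?_
    rcases Nat.eq_zero_or_pos k with rfl | hk
    · simp [h0]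
    · rw [sum_pair (by omega), hodd, hs k hk.ne', neg_smul, sub_eq_add_neg]
  · rw [mem_insert, mem_singleton]
    omega

/-- `T` is obtained from the normally ordered product of `S` at `s w` and `S'` at `w`. -/
structure Fuses (S S' T : VertexData V) (s : ℂ) : Prop where
  creation : ∀ (I : ℤ) (v : V),
    T.creation I v = ∑ᶠ i : ℤ, s ^ i • S'.creation (I - i) (S.creation i v)
  annihilation : ∀ J : ℕ, T.annihilation J =
    ∑ x ∈ antidiagonal J, s ^ (-(x.2 : ℤ)) • (S.annihilation x.2 * S'.annihilation x.1)

/-- Annihilation of `v` by the high modes of `S'` bounds `k` above; exchanging the factors, that by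
the high modes of `S` bounds `k` below. -/
theorem finite_int_support (hc : ∀ i j, Commute (S.creation i) (S'.creation j))
    (ha : ∀ i j, Commute (S.annihilation i) (S'.annihilation j)) (a b : ℤ) (v : V) :
    (Function.support fun k : ℤ => S'.nord (b + k) (S.op (a - k)) v).Finite := by
  obtain ⟨D, hD⟩ := S.exists_forall_nord_eq_zero v
  obtain ⟨D', hD'⟩ := S'.exists_forall_nord_eq_zero v
  refine (Icc (a - D) (D' - b)).finite_toSet.subset fun k hk => ?_
  rw [mem_coe, mem_Icc]
  constructor
  · by_contra h
    refine hk ?_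
    show S'.nord (b + k) (S.op (a - k)) v = 0
    rw [← nord_op_comm hc ha]
    exact hD _ (by omega) _
  · by_contra h
    exact hk (hD' _ (by omega) _)

theorem nord_op_apply (S S' : VertexData V) (m m' : ℤ) (v : V) :
    S'.nord m' (S.op m) v = ∑ᶠ p : ℕ × ℕ, S'.creation (p.1 - m')
      (S.creation (p.2 - m) (S.annihilation p.2 (S'.annihilation p.1 v))) := by
  rw [op_eq_nord, nord_nord_apply, ← finsum_curry (fun p : ℕ × ℕ => S'.creation (p.1 - m')
    (S.creation (p.2 - m) ((1 : Module.End ℂ V) (S.annihilation p.2 (S'.annihilation p.1 v)))))]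
  · rfl
  · exact (finite_pair S' S v).subset fun p hp h => hp (by simp [h])

/-- The left side is a mode of `δ(s w / z)` times the normally ordered product of `S` at `z` and
`S'` at `w`. The delta function sets `z = s w`, which is the specialization recorded by `Fuses`. -/
theorem Fuses.finsum_eq {s : ℂ} (hs : s ≠ 0) (h : Fuses S S' T s)
    (a b : ℤ) (v : V) :
    ∑ᶠ k : ℤ, s ^ k • S'.nord (b + k) (S.op (a - k)) v = s ^ a • T.op (a + b) v := by
  have hP := finite_pair S' S v
  set w : ℕ × ℕ → V := fun p => S.annihilation p.2 (S'.annihilation p.1 v) with hw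
  have hsub : ∀ L : ℕ × ℕ → Module.End ℂ V, (Function.support fun p => L p (w p)).Finite :=
    fun L => hP.subset fun p hp h0 => hp (by
      show L p (w p) = 0
      rw [show w p = 0 from h0, map_zero])
  have h1 : ∀ k : ℤ, s ^ k • S'.nord (b + k) (S.op (a - k)) v = ∑ᶠ p : ℕ × ℕ,
      s ^ k • S'.creation (p.1 - (b + k)) (S.creation (p.2 - (a - k)) (w p)) := by
    intro k
    rw [nord_op_apply, smul_finsum]
  simp only [h1]
  rw [finsum_finsum_comm]
  · have h2 : ∀ p : ℕ × ℕ, ∑ᶠ k : ℤ,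
        s ^ k • S'.creation (p.1 - (b + k)) (S.creation (p.2 - (a - k)) (w p)) =
        s ^ a • (s ^ (-(p.2 : ℤ)) • T.creation ((p.1 + p.2 : ℕ) - (a + b))) (w p) := by
      intro p
      -- Substituting `i = k + p.2 - a` turns the sum over `k` into the sum over creation degrees of
      -- `S`.
      rw [LinearMap.smul_apply, h.creation, ← finsum_comp_equiv (Equiv.addRight ((p.2 : ℤ) - a))
        (f := fun i : ℤ => s ^ i • S'.creation ((p.1 + p.2 : ℕ) - (a + b) - i)
          (S.creation i (w p))), smul_finsum, smul_finsum]
      refine finsum_congr fun k => ?_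
      simp only [Equiv.coe_addRight]
      have e1 : ((p.1 + p.2 : ℕ) : ℤ) - (a + b) - (k + (p.2 - a)) = p.1 - (b + k) := by
        push_cast
        ring
      rw [smul_smul, smul_smul, ← zpow_add₀ hs, ← zpow_add₀ hs, e1,
        show a + -(p.2 : ℤ) + (k + (p.2 - a)) = k by ring,
        show k + ((p.2 : ℤ) - a) = p.2 - (a - k) by ring]
    simp only [h2]
    rw [← smul_finsum, op_apply]
    congr 1
    rw [← finsum_sum_fiber antidiagonal (fun p => p.1 + p.2)
      (fun _ _ => HasAntidiagonal.mem_antidiagonal)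
      (hsub fun p => s ^ (-(p.2 : ℤ)) • T.creation ((p.1 + p.2 : ℕ) - (a + b)))]
    refine finsum_congr fun J => ?_
    rw [h.annihilation, LinearMap.sum_apply, map_sum]
    refine sum_congr rfl fun x hx => ?_
    rw [HasAntidiagonal.mem_antidiagonal.mp hx, LinearMap.smul_apply, LinearMap.smul_apply,
      map_smul]
    rfl
  · refine Set.Finite.subset (hP.toFinset.biUnion fun p =>
      Icc (S.bound + a - p.2) (p.1 - b - S'.bound) ×ˢ {p}).finite_toSet ?_
    rintro ⟨k, p⟩ hk
    simp only [coe_biUnion, Set.mem_iUnion, mem_coe, mem_product, mem_singleton, mem_Icc]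
    refine ⟨p, ?_, ⟨?_, ?_⟩, rfl⟩
    · rw [Set.Finite.mem_toFinset]
      intro h0
      exact hk (by simp [show w p = 0 from h0])
    · by_contra h'
      exact hk (by simp [S.creation_eq_zero (p.2 - (a - k)) (by omega)])
    · by_contra h'
      exact hk (by simp [S'.creation_eq_zero (p.1 - (b + k)) (by omega)])

/-- Both products have the same normally ordered part and the same contraction `h`, expanded in `w /
z` and in `z / w`. By `hh` the difference of expansions is `A (δ(s w / z) - δ(s⁻¹ w / z))`, and each
delta function fuses the product into `T` or `T'`. -/
theorem op_commutator {s A : ℂ} {h : PowerSeries ℂ} (hs : s ≠ 0)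
    (hS : Contracts S.op S' h) (hS' : Contracts S'.op S h)
    (hh : ∀ k : ℕ, k ≠ 0 → coeff k h = A * (s ^ (k : ℤ) - s ^ (-(k : ℤ))))
    (hc : ∀ i j, Commute (S.creation i) (S'.creation j))
    (ha : ∀ i j, Commute (S.annihilation i) (S'.annihilation j))
    (hT : Fuses S S' T s) (hT' : Fuses S' S T' s) (a b : ℤ) :
    S.op a * S'.op b - S'.op b * S.op a =
      A • (s ^ a • T.op (a + b) - s ^ b • T'.op (a + b)) := by
  ext v
  set F : ℤ → V := fun k => S'.nord (b + k) (S.op (a - k)) v with hF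
  have hfin : (Function.support F).Finite := finite_int_support hc ha a b v
  have h1 : S.op a (S'.op b v) = ∑ᶠ k : ℕ, coeff k h • F k := hS.op_op a b v
  have h2 : S'.op b (S.op a v) = ∑ᶠ k : ℕ, coeff k h • F (-k) := by
    rw [hS'.op_op]
    refine finsum_congr fun k => ?_
    rw [nord_op_comm hc ha, hF]
    simp only [sub_neg_eq_add, ← sub_eq_add_neg]
  have h3 := finsum_sub_finsum_neg (h := fun k => coeff k h)
    (s := fun k : ℤ => A * (s ^ k - s ^ (-k))) hh (fun k => by rw [neg_neg]; ring) hfin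
  have h4 : ∑ᶠ k : ℤ, s ^ k • F k = s ^ a • T.op (a + b) v := hT.finsum_eq hs a b v
  have h5 : ∑ᶠ k : ℤ, s ^ (-k) • F k = s ^ b • T'.op (a + b) v := by
    rw [add_comm a b, ← hT'.finsum_eq hs b a v, ← finsum_comp_equiv (Equiv.neg ℤ)]
    refine finsum_congr fun k => ?_
    rw [nord_op_comm hc ha, hF]
    simp only [Equiv.neg_apply, sub_neg_eq_add, ← sub_eq_add_neg, neg_neg]
  rw [LinearMap.sub_apply, Module.End.mul_apply, Module.End.mul_apply, h1, h2, h3,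
    LinearMap.smul_apply, LinearMap.sub_apply, LinearMap.smul_apply, LinearMap.smul_apply, ← h4,
    ← h5, ← finsum_sub_distrib (finite_support_smul hfin _) (finite_support_smul hfin _),
    smul_finsum]
  refine finsum_congr fun k => ?_
  rw [mul_smul, sub_smul]

theorem commutator_op_of_creation {y : Module.End ℂ V} {c : ℂ} {m : ℤ}
    (hc : ∀ i, y * S.creation i - S.creation i * y = c • S.creation (i - m))
    (ha : ∀ j, Commute y (S.annihilation j)) (n : ℤ) :
    y * S.op n - S.op n * y = c • S.op (n + m) := by
  ext v
  rw [LinearMap.sub_apply, Module.End.mul_apply, Module.End.mul_apply, LinearMap.smul_apply,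
    op_eq_nord, op_eq_nord, nord_apply, nord_apply, nord_apply,
    map_finsum_of_finite _ (S.finite_support n 1 v), smul_finsum, ← finsum_sub_distrib]
  · refine finsum_congr fun j => ?_
    have h1 := LinearMap.congr_fun (hc (j - n)) (S.annihilation j v)
    have h2 := LinearMap.congr_fun (ha j).eq v
    simp only [LinearMap.sub_apply, Module.End.mul_apply, LinearMap.smul_apply, sub_sub] at h1 h2
    simp only [Module.End.one_apply]
    rw [← h1, h2]
  · exact (S.finite_support n 1 v).subset fun j hj h0 => hj (by
      show y (S.creation (j - n) ((1 : Module.End ℂ V) (S.annihilation j v))) = 0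
      rw [show S.creation (j - n) ((1 : Module.End ℂ V) (S.annihilation j v)) = 0 from h0,
        map_zero])
  · exact S.finite_support n 1 (y v)

theorem commutator_op_of_annihilation {y : Module.End ℂ V} {c : ℂ} {m : ℕ}
    (hc : ∀ i, Commute y (S.creation i))
    (ha : ∀ j, y * S.annihilation j - S.annihilation j * y =
      if m ≤ j then c • S.annihilation (j - m) else 0) (n : ℤ) :
    y * S.op n - S.op n * y = c • S.op (n - m) := by
  ext v
  have h1 : ∀ j : ℕ, y (S.creation (j - n) (S.annihilation j v)) -
      S.creation (j - n) (S.annihilation j (y v)) =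
      ∑ i ∈ if m ≤ j then {j - m} else (∅ : Finset ℕ),
        c • S.creation (i - (n - m)) (S.annihilation i v) := by
    intro j
    have h1 := LinearMap.congr_fun (ha j) v
    have h2 := LinearMap.congr_fun (hc (j - n)).eq (S.annihilation j v)
    simp only [LinearMap.sub_apply, Module.End.mul_apply] at h1 h2
    rw [h2, ← map_sub, h1]
    split_ifs with h
    · rw [sum_singleton, LinearMap.smul_apply, map_smul, Nat.cast_sub h]
      congr 3
      ring
    · simp
  have h2 := finite_support_smul (S.finite_support (n - m) 1 v) (fun _ => c)
  rw [LinearMap.sub_apply, Module.End.mul_apply, Module.End.mul_apply, LinearMap.smul_apply,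
    op_eq_nord, op_eq_nord, nord_apply, nord_apply, nord_apply,
    map_finsum_of_finite _ (S.finite_support n 1 v), smul_finsum, ← finsum_sub_distrib]
  · simp only [Module.End.one_apply, h1]
    refine finsum_sum_fiber _ (fun i => i + m) (fun j i => ?_) h2
    split_ifs with h
    · rw [mem_singleton]; omega
    · simp only [notMem_empty, false_iff]; omega
  · exact (S.finite_support n 1 v).subset fun j hj h0 => hj (by
      show y (S.creation (j - n) ((1 : Module.End ℂ V) (S.annihilation j v))) = 0
      rw [show S.creation (j - n) ((1 : Module.End ℂ V) (S.annihilation j v)) = 0 from h0,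
        map_zero])
  · exact S.finite_support n 1 (y v)

end VertexData

end Relations
end
end EllipticToroidal

namespace EllipticToroidal

noncomputable section

/-! ### Vertex operators given by formal exponentials -/

section Exponential

open Finset PowerSeries

theorem formalExp_congr {A : Type*} [Ring A] [Algebra ℂ A] {b b' : ℕ → A}
    (h : ∀ n, n ≠ 0 → b n = b' n) : formalExp b = formalExp b' := by
  have : (fun m => if m = 0 then 0 else b m) = fun m => if m = 0 then 0 else b' m := by
    funext m
    split_ifs with hm
    · rfl
    · exact h m hm
  rw [formalExp, formalExp, this]

variable {V : Type*} [AddCommGroup V] [Module ℂ V]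

theorem finsum_intCoeff_mul (F G : PowerSeries (Module.End ℂ V)) (L : ℤ) (v : V) :
    ∑ᶠ k : ℤ, intCoeff F (L - k) (intCoeff G k v) = intCoeff (F * G) L v := by
  rcases lt_or_ge L 0 with hL | hL
  · rw [intCoeff_of_neg _ hL, finsum_eq_zero_of_forall_eq_zero]
    · rfl
    · intro k
      rcases lt_or_ge k 0 with hk | hk
      · rw [intCoeff_of_neg _ hk, LinearMap.zero_apply, map_zero]
      · rw [intCoeff_of_neg _ (by omega), LinearMap.zero_apply]
  · obtain ⟨l, rfl⟩ := Int.eq_ofNat_of_zero_le hL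
    rw [intCoeff_natCast, coeff_mul, LinearMap.sum_apply, ← Finset.Nat.sum_antidiagonal_swap,
      Finset.Nat.sum_antidiagonal_eq_sum_range_succ_mk,
      finsum_eq_sum_of_support_subset (s := (range (l + 1)).map Nat.castEmbedding), sum_map]
    · refine sum_congr rfl fun k hk => ?_
      rw [Nat.castEmbedding_apply, ← Nat.cast_sub (by rw [mem_range] at hk; omega),
        intCoeff_natCast, intCoeff_natCast]
      rfl
    · intro k hk
      by_contra h
      simp only [coe_map, coe_range, Set.mem_image, Set.mem_Iio, not_exists, not_and] at h
      refine hk ?_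
      rcases lt_or_ge k 0 with hk | hk
      · simp only [intCoeff_of_neg _ hk, LinearMap.zero_apply, map_zero]
      · have : (l : ℤ) - k < 0 := by
          by_contra h'
          exact h k.toNat (by omega) (by rw [Nat.castEmbedding_apply]; omega)
        simp only [intCoeff_of_neg _ this, LinearMap.zero_apply]

namespace VertexData

/-- The vertex operator `C z ^ M exp (∑ Q n z ^ n) exp (∑ P n z ^ (-n))`. -/
def ofExp (C : ℂ) (M : ℤ) (Q P : ℕ → Module.End ℂ V)
    (hP : ∀ v, ∃ d, ∀ j, d ≤ j → coeff j (formalExp P) v = 0) : VertexData V where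
  creation i := C • intCoeff (formalExp Q) (i - M)
  annihilation j := coeff j (formalExp P)
  bound := M
  creation_eq_zero i hi := by rw [intCoeff_of_neg _ (by omega), smul_zero]
  annihilation_eq_zero := hP

variable {C C' : ℂ} {M M' : ℤ} {Q P Q' P' : ℕ → Module.End ℂ V}
  {hP : ∀ v, ∃ d, ∀ j, d ≤ j → coeff j (formalExp P) v = 0}
  {hP' : ∀ v, ∃ d, ∀ j, d ≤ j → coeff j (formalExp P') v = 0}

theorem isVertexOperator_ofExp : IsVertexOperator (ofExp C M Q P hP).op
    (C • (1 : Module.End ℂ V)) M (formalExp Q) (formalExp P) := by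
  intro n v
  obtain ⟨d, hd⟩ := hP v
  set F : ℕ × ℕ → V := fun k => if M + (k.1 : ℤ) - (k.2 : ℤ) = -n then
      (C • (1 : Module.End ℂ V)) (coeff k.1 (formalExp Q) (coeff k.2 (formalExp P) v)) else 0
    with hF
  have hfin : (Function.support F).Finite := by
    refine ((range d).image fun j : ℕ => ((j - n - M).toNat, j)).finite_toSet.subset
      fun k hk => ?_
    rw [Function.mem_support, hF] at hk
    simp only [coe_image, coe_range, Set.mem_image, Set.mem_Iio]
    refine ⟨k.2, ?_, Prod.ext ?_ rfl⟩
    · by_contra h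
      exact hk (by simp [hd k.2 (by omega)])
    · have : M + (k.1 : ℤ) - (k.2 : ℤ) = -n := by
        by_contra h
        exact hk (if_neg h)
      show ((k.2 : ℤ) - n - M).toNat = k.1
      omega
  refine ⟨hfin, ?_⟩
  rw [← finsum_comp_equiv (Equiv.prodComm ℕ ℕ), finsum_curry, op_apply]
  · refine finsum_congr fun j => ?_
    show ∑ᶠ i : ℕ, F (i, j) = C • intCoeff (formalExp Q) (j - n - M) (coeff j (formalExp P) v)
    rcases lt_or_ge ((j : ℤ) - n - M) 0 with h | h
    · rw [intCoeff_of_neg _ h, LinearMap.zero_apply, smul_zero,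
        finsum_eq_zero_of_forall_eq_zero]
      intro i
      exact if_neg (by omega)
    · obtain ⟨i, hi⟩ := Int.eq_ofNat_of_zero_le h
      rw [hi, intCoeff_natCast, finsum_eq_single _ i]
      · simp only [hF]
        rw [if_pos (by omega), LinearMap.smul_apply, Module.End.one_apply]
      · intro i' hi'
        exact if_neg (by omega)
  · exact hfin.preimage (Equiv.injective _).injOn

theorem commute_creation_ofExp (hQ : ∀ m n, Commute (Q m) (Q' n)) (i j : ℤ) :
    Commute ((ofExp C M Q P hP).creation i) ((ofExp C' M' Q' P' hP').creation j) :=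
  ((commute_intCoeff (fun k => (commute_intCoeff (fun l =>
    (commute_coeff_formalExp_formalExp hQ l k).symm) _).symm) _).smul_left C).smul_right C'

theorem commute_annihilation_ofExp (hP2 : ∀ m n, Commute (P m) (P' n)) (i j : ℕ) :
    Commute ((ofExp C M Q P hP).annihilation i) ((ofExp C' M' Q' P' hP').annihilation j) :=
  commute_coeff_formalExp_formalExp hP2 i j

theorem contracts_ofExp (hQQ' : ∀ m n, Commute (Q m) (Q' n)) (hPP : ∀ m n, Commute (P m) (P n))
    (hQQ : ∀ m n, Commute (Q' m) (Q' n)) {c : ℕ → ℂ}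
    (h : ∀ m n, m ≠ 0 → n ≠ 0 → P m * Q' n - Q' n * P m = (if n = m then c m else 0) • 1) :
    Contracts (ofExp C M Q P hP).op (ofExp C' M' Q' P' hP') (formalExp c) := by
  refine contracts_op (commute_creation_ofExp hQQ') fun j i => ?_
  show coeff j (formalExp P) * (C' • intCoeff (formalExp Q') (i - M')) = ∑ x ∈ antidiagonal j,
    coeff x.1 (formalExp c) • ((C' • intCoeff (formalExp Q') (i - x.1 - M')) *
      coeff x.2 (formalExp P))
  rw [mul_smul_comm, formalExp_exchange hPP hQQ h, smul_sum]
  refine sum_congr rfl fun x _ => ?_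
  rw [smul_mul_assoc, smul_comm, sub_right_comm]

/-- Putting `z = s w` scales the `n`-th creation exponent by `s ^ n`, the annihilation exponent by
`s ^ (-n)` and the prefactor by `s ^ M`; exponentials of commuting exponents then multiply. -/
theorem fuses_ofExp {s D : ℂ} (hs : s ≠ 0) {A B : ℕ → Module.End ℂ V}
    {hB : ∀ v, ∃ d, ∀ j, d ≤ j → coeff j (formalExp B) v = 0}
    (hQQ : ∀ m n, Commute (Q m) (Q n)) (hQQ' : ∀ m n, Commute (Q m) (Q' n))
    (hQQ2 : ∀ m n, Commute (Q' m) (Q' n))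
    (hPP : ∀ m n, Commute (P m) (P n)) (hPP' : ∀ m n, Commute (P m) (P' n))
    (hPP2 : ∀ m n, Commute (P' m) (P' n)) (hM : M + M' = 0) (hD : D = C * C' * s ^ M)
    (hA : ∀ n, n ≠ 0 → A n = s ^ n • Q n + Q' n)
    (hB2 : ∀ n, n ≠ 0 → B n = s⁻¹ ^ n • P n + P' n) :
    Fuses (ofExp C M Q P hP) (ofExp C' M' Q' P' hP') (ofExp D 0 A B hB) s where
  creation I v := by
    have hA' : formalExp A = formalExp Q' * formalExp fun n => s ^ n • Q n := by
      rw [← formalExp_add hQQ2 (fun m n => ((hQQ m n).smul_left _).smul_right _)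
        fun m n => ((hQQ' n m).smul_left _).symm]
      exact formalExp_congr fun n hn => (hA n hn).trans (add_comm _ _)
    show D • intCoeff (formalExp A) (I - 0) v = ∑ᶠ i : ℤ, s ^ i •
      C' • intCoeff (formalExp Q') (I - i - M') (C • intCoeff (formalExp Q) (i - M) v)
    rw [hA', sub_zero, ← finsum_intCoeff_mul, smul_finsum,
      ← finsum_comp_equiv (Equiv.subRight M)]
    refine finsum_congr fun i => ?_
    have h1 : intCoeff (formalExp fun n => s ^ n • Q n) (i - M) =
        s ^ (i - M) • intCoeff (formalExp Q) (i - M) := by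
      rcases lt_or_ge (i - M) 0 with h | h
      · rw [intCoeff_of_neg _ h, intCoeff_of_neg _ h, smul_zero]
      · obtain ⟨k, hk⟩ := Int.eq_ofNat_of_zero_le h
        rw [hk, intCoeff_natCast, intCoeff_natCast, coeff_formalExp_scale hQQ, zpow_natCast]
    rw [Equiv.subRight_apply, h1, LinearMap.smul_apply, map_smul, map_smul, smul_smul, smul_smul,
      smul_smul, show I - (i - M) = I - i - M' by omega, hD]
    congr 1
    rw [zpow_sub₀ hs]
    field_simp
  annihilation J := by
    have hB' : formalExp B = (formalExp fun n => s⁻¹ ^ n • P n) * formalExp P' := by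
      rw [← formalExp_add (fun m n => ((hPP m n).smul_left _).smul_right _) hPP2
        fun m n => (hPP' m n).smul_left _]
      exact formalExp_congr hB2
    show coeff J (formalExp B) = ∑ x ∈ antidiagonal J, s ^ (-(x.2 : ℤ)) •
      (coeff x.2 (formalExp P) * coeff x.1 (formalExp P'))
    rw [hB', coeff_mul, ← Finset.Nat.sum_antidiagonal_swap]
    refine sum_congr rfl fun x _ => ?_
    rw [Prod.fst_swap, Prod.snd_swap, coeff_formalExp_scale hPP, smul_mul_assoc, zpow_neg,
      zpow_natCast, inv_pow]

theorem commutator_ofExp_of_creation {y : Module.End ℂ V} {c : ℂ} {m : ℕ} (hm : m ≠ 0)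
    (hQQ : ∀ m n, Commute (Q m) (Q n))
    (hQ : ∀ n, n ≠ 0 → y * Q n - Q n * y = (if n = m then c else 0) • 1)
    (hyP : ∀ n, Commute y (P n)) (n : ℤ) :
    y * (ofExp C M Q P hP).op n - (ofExp C M Q P hP).op n * y =
      c • (ofExp C M Q P hP).op (n + m) := by
  refine commutator_op_of_creation (fun i => ?_) (fun j => commute_coeff_formalExp hyP j) n
  show y * (C • intCoeff (formalExp Q) (i - M)) - (C • intCoeff (formalExp Q) (i - M)) * y =
    c • C • intCoeff (formalExp Q) (i - m - M)
  rw [mul_smul_comm, smul_mul_assoc, ← smul_sub, bracket_intCoeff_formalExp hQQ hm hQ,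
    smul_comm, sub_right_comm]

theorem commutator_ofExp_of_annihilation {y : Module.End ℂ V} {c : ℂ} {m : ℕ} (hm : m ≠ 0)
    (hPP : ∀ m n, Commute (P m) (P n))
    (hP2 : ∀ n, n ≠ 0 → y * P n - P n * y = (if n = m then c else 0) • 1)
    (hyQ : ∀ n, Commute y (Q n)) (n : ℤ) :
    y * (ofExp C M Q P hP).op n - (ofExp C M Q P hP).op n * y =
      c • (ofExp C M Q P hP).op (n - m) :=
  commutator_op_of_annihilation
    (fun _ => (commute_intCoeff (commute_coeff_formalExp hyQ) _).smul_right C)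
    (fun j => bracket_coeff_formalExp hPP hm hP2 j) n

end VertexData

end Exponential

/-! ### Scalar exponentials -/

section Scalar

open Finset PowerSeries

theorem formalExp_mul_formalExp (b b' : ℕ → ℂ) :
    formalExp b * formalExp b' = formalExp fun n => b n + b' n :=
  (formalExp_add (fun _ _ => Commute.all _ _) (fun _ _ => Commute.all _ _)
    fun _ _ => Commute.all _ _).symm

/-- The exponent is the series of `log (1 - aX)`; it is enough to check the Euler equation. -/
theorem formalExp_neg_pow_div (a : ℂ) :
    formalExp (fun n => -(a ^ n / n)) = 1 - C a * X := by
  refine (eq_formalExp (fun _ _ => Commute.all _ _) (by simp) ?_).symm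
  ext n
  rw [coeff_euler, mul_sub, mul_one, mul_comm (C a), ← mul_assoc, map_sub, map_sub, coeff_mul_C,
    coeff_mul_C, coeff_one, coeff_X, coeff_euler_expArg]
  rcases n with _ | _ | n
  · simp
  · rw [coeff_succ_mul_X, coeff_euler_expArg]
    simp
  · rw [coeff_succ_mul_X, coeff_euler_expArg]
    have h1 : ((n : ℂ) + 1 + 1) ≠ 0 := by exact_mod_cast Nat.succ_ne_zero (n + 1)
    have h2 : ((n : ℂ) + 1) ≠ 0 := by exact_mod_cast Nat.succ_ne_zero n
    simp
    field_simp
    ring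

theorem formalExp_inv (b : ℕ → ℂ) : (formalExp b)⁻¹ = formalExp fun n => -b n := by
  rw [PowerSeries.inv_eq_iff_mul_eq_one, formalExp_mul_formalExp]
  · refine (eq_formalExp (fun _ _ => Commute.all _ _) (by simp) ?_).symm
    ext n
    rw [coeff_euler, coeff_mul, sum_eq_zero]
    · rcases n with _ | n <;> simp [coeff_one]
    · intro x _
      rw [coeff_euler_expArg]
      simp
  · rw [← coeff_zero_eq_constantCoeff_apply, coeff_zero_formalExp]
    exact one_ne_zero

end Scalar
end
end EllipticToroidal

namespace EllipticToroidal

noncomputable section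

/-! ### Heisenberg operators and vertex operators on the Fock space -/

section FockOperators

open Finset PowerSeries

theorem bracket_smul {A : Type*} [Ring A] [Algebra ℂ A] {x y : A} {a : ℂ} (b : ℂ)
    (h : x * y - y * x = a • 1) : x * (b • y) - (b • y) * x = (b * a) • 1 := by
  rw [mul_smul_comm, smul_mul_assoc, ← smul_sub, h, smul_smul]

theorem smul_bracket_smul {A : Type*} [Ring A] [Algebra ℂ A] {x y : A} {c : ℂ} (a b : ℂ)
    (h : x * y - y * x = c • 1) :
    (a • x) * (b • y) - (b • y) * (a • x) = (a * b * c) • 1 := by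
  rw [smul_mul_smul_comm, smul_mul_smul_comm, mul_comm b, ← smul_sub, h, smul_smul]

theorem bracket_neg {A : Type*} [Ring A] [Algebra ℂ A] {x y : A} {a : ℂ}
    (h : x * y - y * x = a • 1) : y * x - x * y = (-a) • 1 := by
  rw [neg_smul, ← h, neg_sub]

/-- The scalar bracket `[α_m, α_{-m}]` on the Fock space, `m > 0`. -/
def fockBracket (q t p : ℂ) (m : ℤ) : ℂ :=
  -(kappa q t m / m) * (1 - (q / t) ^ m) * ((1 - p ^ m) / (1 - (p * q / t) ^ m))

variable (q t p : ℂ)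

theorem fockAlpha_zero : fockAlpha q t p 0 = 0 := by
  simp [fockAlpha]

theorem fockAlpha_natCast (n : ℕ+) : fockAlpha q t p (n : ℕ) =
    fockBracket q t p (n : ℕ) • (MvPolynomial.pderiv (R := ℂ) n).toLinearMap := by
  have hn : 0 < ((n : ℕ) : ℤ) := by exact_mod_cast n.pos
  exact dif_pos hn

theorem fockAlpha_neg_natCast (n : ℕ+) : fockAlpha q t p (-(n : ℕ)) =
    LinearMap.mulLeft ℂ (MvPolynomial.X n : Fock) := by
  have hn : 0 < ((n : ℕ) : ℤ) := by exact_mod_cast n.pos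
  refine (dif_neg (by omega)).trans ((dif_pos (by omega)).trans ?_)
  congr 2
  exact PNat.eq (by simp)

/-- The commutator of two derivations is a derivation, and this one kills the variables. -/
theorem pderiv_pderiv_comm (i j : ℕ+) (f : Fock) : MvPolynomial.pderiv i (MvPolynomial.pderiv j f) =
    MvPolynomial.pderiv j (MvPolynomial.pderiv i f) := by
  have h : ⁅MvPolynomial.pderiv (R := ℂ) i, MvPolynomial.pderiv (R := ℂ) j⁆ = 0 := by
    refine MvPolynomial.derivation_ext fun k => ?_
    rw [Derivation.commutator_apply, MvPolynomial.pderiv_X, MvPolynomial.pderiv_X]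
    simp only [Pi.single_apply]
    split_ifs <;> simp
  have := congrArg (fun D => D f) h
  simpa [Derivation.commutator_apply, sub_eq_zero] using this

theorem commute_fockAlpha (m n : ℕ) :
    Commute (fockAlpha q t p m) (fockAlpha q t p n) := by
  rcases Nat.eq_zero_or_pos m with rfl | hm
  · rw [Nat.cast_zero, fockAlpha_zero]
    exact Commute.zero_left _
  rcases Nat.eq_zero_or_pos n with rfl | hn
  · rw [Nat.cast_zero, fockAlpha_zero]
    exact Commute.zero_right _
  lift m to ℕ+ using hm
  lift n to ℕ+ using hn
  rw [fockAlpha_natCast, fockAlpha_natCast]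
  refine (Commute.smul_left ?_ _).smul_right _
  exact LinearMap.ext fun f => pderiv_pderiv_comm m n f

theorem commute_fockAlpha_neg (m n : ℕ) :
    Commute (fockAlpha q t p (-m)) (fockAlpha q t p (-n)) := by
  rcases Nat.eq_zero_or_pos m with rfl | hm
  · rw [Nat.cast_zero, neg_zero, fockAlpha_zero]
    exact Commute.zero_left _
  rcases Nat.eq_zero_or_pos n with rfl | hn
  · rw [Nat.cast_zero, neg_zero, fockAlpha_zero]
    exact Commute.zero_right _
  lift m to ℕ+ using hm
  lift n to ℕ+ using hn
  rw [fockAlpha_neg_natCast, fockAlpha_neg_natCast]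
  exact LinearMap.ext fun f => mul_left_comm _ _ _

theorem fockAlpha_bracket {m n : ℕ} (hm : m ≠ 0) (hn : n ≠ 0) :
    fockAlpha q t p m * fockAlpha q t p (-n) - fockAlpha q t p (-n) * fockAlpha q t p m =
      (if n = m then fockBracket q t p m else 0) • 1 := by
  lift m to ℕ+ using Nat.pos_of_ne_zero hm
  lift n to ℕ+ using Nat.pos_of_ne_zero hn
  rw [fockAlpha_natCast, fockAlpha_neg_natCast]
  refine LinearMap.ext fun f => ?_
  simp only [LinearMap.sub_apply, Module.End.mul_apply, LinearMap.smul_apply,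
    LinearMap.mulLeft_apply, Derivation.coeFn_coe, Derivation.leibniz, MvPolynomial.pderiv_X,
    Pi.single_apply, PNat.coe_inj, Module.End.one_apply, smul_eq_mul]
  split_ifs with h
  · rw [mul_one, smul_add, mul_smul_comm, add_sub_cancel_left]
  · rw [mul_zero, add_zero, zero_smul, mul_smul_comm, sub_self]

theorem fockAlpha_C (m : ℕ) (a : ℂ) : fockAlpha q t p m (MvPolynomial.C a) = 0 := by
  rcases Nat.eq_zero_or_pos m with rfl | hm
  · rw [Nat.cast_zero, fockAlpha_zero, LinearMap.zero_apply]
  lift m to ℕ+ using hm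
  rw [fockAlpha_natCast, LinearMap.smul_apply, Derivation.coeFn_coe, MvPolynomial.pderiv_C,
    smul_zero]

/-- Local finiteness by induction on polynomials: constants are killed by every positive mode, and
multiplication by the variable of index `i` raises the threshold by at most `i`. -/
theorem exists_forall_coeff_formalExp_fockAlpha (a : ℕ → ℂ) (v : Fock) :
    ∃ d, ∀ j, d ≤ j → coeff j (formalExp fun n : ℕ => a n • fockAlpha q t p n) v = 0 := by
  have hcomm : ∀ m n : ℕ, Commute (a m • fockAlpha q t p m) (a n • fockAlpha q t p n) :=
    fun m n => ((commute_fockAlpha q t p m n).smul_left _).smul_right _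
  induction v using MvPolynomial.induction_on with
  | C c =>
    refine ⟨1, fun j hj => ?_⟩
    have h := congrArg (coeff j) (euler_formalExp hcomm)
    rw [coeff_euler, coeff_mul] at h
    refine nsmul_eq_zero_complex (A := Fock) (n := j) (by omega) ?_
    rw [← LinearMap.smul_apply, h, LinearMap.sum_apply]
    refine sum_eq_zero fun x _ => ?_
    rw [coeff_euler_expArg, smul_mul_assoc,
      (commute_coeff_formalExp (hcomm x.1) x.2).eq, LinearMap.smul_apply, Module.End.mul_apply,
      LinearMap.smul_apply, fockAlpha_C, smul_zero, map_zero, smul_zero]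
  | add f g hf hg =>
    obtain ⟨d, hd⟩ := hf
    obtain ⟨d', hd'⟩ := hg
    exact ⟨d + d', fun j hj => by rw [map_add, hd j (by omega), hd' j (by omega), add_zero]⟩
  | mul_X f i hf =>
    obtain ⟨d, hd⟩ := hf
    refine ⟨d + i, fun j hj => ?_⟩
    -- Multiplication by the variable is a creation operator, so commuting it past the coefficient
    -- of degree `j` only produces the coefficient of degree `j - i`.
    have h := bracket_coeff_formalExp hcomm (y := fockAlpha q t p (-(i : ℕ))) (n := i)
      (c := -(a i * fockBracket q t p (i : ℕ))) i.ne_zero (fun m hm => ?_) j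
    · have h1 := LinearMap.congr_fun h f
      rw [if_pos (by omega), LinearMap.sub_apply, Module.End.mul_apply, Module.End.mul_apply,
        LinearMap.smul_apply, hd j (by omega), hd (j - i) (by omega), map_zero, smul_zero,
        zero_sub, neg_eq_zero, fockAlpha_neg_natCast, LinearMap.mulLeft_apply] at h1
      rw [mul_comm, h1]
    · refine (bracket_smul _ (bracket_neg (fockAlpha_bracket q t p hm i.ne_zero))).trans ?_
      congr 1
      split_ifs with h1 h2 h2
      · rw [h1, mul_neg]
      · exact absurd h1.symm h2
      · exact absurd h2.symm h1
      · simp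

/-- The vertex operator `C z ^ M exp (∑ c n α_{-n} z ^ n) exp (∑ a n α_n z ^ (-n))` on the Fock
space. -/
def fockVertex (C : ℂ) (M : ℤ) (c a : ℕ → ℂ) : VertexData Fock :=
  VertexData.ofExp C M (fun n => c n • fockAlpha q t p (-n)) (fun n => a n • fockAlpha q t p n)
    (exists_forall_coeff_formalExp_fockAlpha q t p a)

variable {q t p} {C C' D : ℂ} {M M' : ℤ} {c a c' a' e f : ℕ → ℂ}

theorem commute_smul_fockAlpha_neg (c c' : ℕ → ℂ) (m n : ℕ) :
    Commute (c m • fockAlpha q t p (-m)) (c' n • fockAlpha q t p (-n)) :=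
  ((commute_fockAlpha_neg q t p m n).smul_left _).smul_right _

theorem commute_smul_fockAlpha (a a' : ℕ → ℂ) (m n : ℕ) :
    Commute (a m • fockAlpha q t p m) (a' n • fockAlpha q t p n) :=
  ((commute_fockAlpha q t p m n).smul_left _).smul_right _

theorem commute_fockVertex_creation (i j : ℤ) : Commute
    ((fockVertex q t p C M c a).creation i) ((fockVertex q t p C' M' c' a').creation j) :=
  VertexData.commute_creation_ofExp (commute_smul_fockAlpha_neg c c') i j

theorem commute_fockVertex_annihilation (i j : ℕ) : Commute
    ((fockVertex q t p C M c a).annihilation i) ((fockVertex q t p C' M' c' a').annihilation j) :=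
  VertexData.commute_annihilation_ofExp (commute_smul_fockAlpha a a') i j

theorem isVertexOperator_fockVertex : IsVertexOperator (fockVertex q t p C M c a).op
    (C • (1 : Module.End ℂ Fock)) M (formalExp fun n : ℕ => c n • fockAlpha q t p (-n))
    (formalExp fun n : ℕ => a n • fockAlpha q t p n) :=
  VertexData.isVertexOperator_ofExp

theorem contracts_fockVertex : VertexData.Contracts (fockVertex q t p C M c a).op
    (fockVertex q t p C' M' c' a') (formalExp fun m => a m * c' m * fockBracket q t p m) := by
  refine VertexData.contracts_ofExp (commute_smul_fockAlpha_neg c c')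
    (commute_smul_fockAlpha a a) (commute_smul_fockAlpha_neg c' c') fun m n hm hn => ?_
  refine (smul_bracket_smul _ _ (fockAlpha_bracket q t p hm hn)).trans ?_
  congr 1
  split_ifs with h
  · rw [h]
  · rw [mul_zero]

theorem fuses_fockVertex {s : ℂ} (hs : s ≠ 0) (hM : M + M' = 0) (hD : D = C * C' * s ^ M)
    (he : ∀ n, n ≠ 0 → e n = s ^ n * c n + c' n) (hf : ∀ n, n ≠ 0 → f n = s⁻¹ ^ n * a n + a' n) :
    VertexData.Fuses (fockVertex q t p C M c a) (fockVertex q t p C' M' c' a')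
      (fockVertex q t p D 0 e f) s :=
  VertexData.fuses_ofExp hs (commute_smul_fockAlpha_neg c c) (commute_smul_fockAlpha_neg c c')
    (commute_smul_fockAlpha_neg c' c') (commute_smul_fockAlpha a a) (commute_smul_fockAlpha a a')
    (commute_smul_fockAlpha a' a') hM hD
    (fun n hn => by rw [he n hn, add_smul, mul_smul]) (fun n hn => by
      rw [hf n hn, add_smul, mul_smul])

theorem fockAlpha_fockVertex {m : ℕ} (hm : m ≠ 0) (n : ℤ) :
    fockAlpha q t p m * (fockVertex q t p C M c a).op n -
      (fockVertex q t p C M c a).op n * fockAlpha q t p m =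
        (c m * fockBracket q t p m) • (fockVertex q t p C M c a).op (n + m) := by
  refine VertexData.commutator_ofExp_of_creation hm (commute_smul_fockAlpha_neg c c)
    (fun n hn => ?_) (fun n => (commute_fockAlpha q t p m n).smul_right _) n
  refine (bracket_smul _ (fockAlpha_bracket q t p hm hn)).trans ?_
  congr 1
  split_ifs with h
  · rw [h]
  · rw [mul_zero]

theorem fockAlpha_neg_fockVertex {m : ℕ} (hm : m ≠ 0) (n : ℤ) :
    fockAlpha q t p (-m) * (fockVertex q t p C M c a).op n -
      (fockVertex q t p C M c a).op n * fockAlpha q t p (-m) =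
        (-(a m * fockBracket q t p m)) • (fockVertex q t p C M c a).op (n - m) := by
  refine VertexData.commutator_ofExp_of_annihilation hm (commute_smul_fockAlpha a a)
    (fun n hn => ?_) (fun n => (commute_fockAlpha_neg q t p m n).smul_right _) n
  refine (bracket_smul _ (bracket_neg (fockAlpha_bracket q t p hn hm))).trans ?_
  congr 1
  by_cases h : m = n
  · rw [if_pos h, if_pos h.symm, h, mul_neg]
  · rw [if_neg h, if_neg (Ne.symm h), neg_zero, mul_zero]

end FockOperators
end
end EllipticToroidal

namespace EllipticToroidal

noncomputable section

/-! ### Contraction functions and exponent identities -/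

section OperatorProducts

open PowerSeries

/-- Partial fractions in the form of a recursion: `h` has simple poles at `s` and `s⁻¹`, and `hA`
says that `A (s - s⁻¹)` is its coefficient of degree one. -/
theorem coeff_of_mul_eq {h : PowerSeries ℂ} {s x A : ℂ} (hs : s ≠ 0) (hx : x ≠ 0)
    (hA : A * (s - s⁻¹) = s + s⁻¹ - x - x⁻¹)
    (hh : h * ((1 - C s * X) * (1 - C s⁻¹ * X)) = (1 - C x * X) * (1 - C x⁻¹ * X)) (k : ℕ)
    (hk : k ≠ 0) : coeff k h = A * (s ^ (k : ℤ) - s ^ (-(k : ℤ))) := by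
  have hC : ∀ y : ℂ, y ≠ 0 →
      (1 - C y * X) * (1 - C y⁻¹ * X) = 1 - C (y + y⁻¹) * X + (X * X : PowerSeries ℂ) := by
    intro y hy
    have : (C y * C y⁻¹ : PowerSeries ℂ) = 1 := by rw [← map_mul, mul_inv_cancel₀ hy, map_one]
    rw [map_add]
    linear_combination X * X * this
  rw [hC s hs, hC x hx, mul_add, mul_sub, mul_one, mul_comm (C (s + s⁻¹)), ← mul_assoc,
    ← mul_assoc] at hh
  obtain ⟨S, hSd⟩ : ∃ S, S = s + s⁻¹ := ⟨_, rfl⟩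
  obtain ⟨Y, hYd⟩ : ∃ Y, Y = x + x⁻¹ := ⟨_, rfl⟩
  rw [← hSd, ← hYd] at hh
  have h0 : coeff 0 h = 1 := by
    have := congrArg (coeff 0) hh
    simpa using this
  have hcoeff : ∀ k, coeff (k + 1) h = S * coeff k h - coeff (k + 1) (h * X * X) +
      (if k = 0 then -Y else 0) + if k = 1 then 1 else 0 := by
    intro k
    have := congrArg (coeff (k + 1)) hh
    simp only [map_add, map_sub, coeff_mul_C, coeff_succ_mul_X, coeff_one,
      coeff_X] at this ⊢
    rcases k with _ | _ | k
    · simp at this ⊢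
      linear_combination this
    · simp at this ⊢
      linear_combination this
    · simp at this ⊢
      linear_combination this
  have h1 : coeff 1 h = A * (s - s⁻¹) := by
    have := hcoeff 0
    simp only [zero_add, coeff_one_mul, h0] at this
    simp at this
    rw [this, hA, hSd, hYd]
    ring
  -- In degree two the term `-h_0 = -1` cancels the leading coefficient of the numerator, so from
  -- degree one on the recursion runs as if `h_0` were zero, like `s ^ k - s ^ (-k)`.
  have hrec : ∀ k, coeff (k + 2) h = (s + s⁻¹) * coeff (k + 1) h -
      if k = 0 then 0 else coeff k h := by
    intro k
    rw [hcoeff, coeff_succ_mul_X, coeff_succ_mul_X, hSd]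
    rcases k with _ | k
    · simp [h0]
    · simp
  have key : ∀ k, coeff (k + 1) h = A * (s ^ (k + 1) - s⁻¹ ^ (k + 1)) ∧
      coeff (k + 2) h = A * (s ^ (k + 2) - s⁻¹ ^ (k + 2)) := by
    intro k
    induction k with
    | zero =>
      rw [hrec, h1]
      simp only [zero_add, pow_one, if_true, true_and]
      ring
    | succ k ih =>
      refine ⟨ih.2, ?_⟩
      rw [hrec, ih.2, if_neg (by omega), ih.1]
      have : s * s⁻¹ = 1 := mul_inv_cancel₀ hs
      linear_combination A * (s ^ (k + 1) - s⁻¹ ^ (k + 1)) * this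
  obtain ⟨k, rfl⟩ := Nat.exists_eq_succ_of_ne_zero hk
  rw [zpow_neg, zpow_natCast, ← inv_pow]
  exact (key k).1

theorem formalExp_mul_eq_of_add_eq {b : ℕ → ℂ} {x y z w : ℂ}
    (h : ∀ n : ℕ, n ≠ 0 → b n = (x ^ n + y ^ n - z ^ n - w ^ n) / n) :
    formalExp b * ((1 - C x * X) * (1 - C y * X)) = (1 - C z * X) * (1 - C w * X) := by
  simp only [← formalExp_neg_pow_div, formalExp_mul_formalExp]
  refine formalExp_congr fun n hn => ?_
  rw [h n hn]
  ring

variable {q p r : ℂ}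

/-- Creation exponent of `x⁺`. -/
def creationPlus (r : ℂ) (n : ℕ) : ℂ := -(r ^ n / (1 - (r ^ 4) ^ n))

/-- Annihilation exponent of `x⁺`. -/
def annihilationPlus (r : ℂ) (n : ℕ) : ℂ := r ^ (3 * n) / (1 - (r ^ 4) ^ n)

/-- Ratio of `α'_n` to `α_n`. -/
def primeRatio (p r : ℂ) (n : ℤ) : ℂ := (1 - (p / r ^ 4) ^ n) / (1 - p ^ n) * (r ^ 2) ^ n

/-- Creation exponent of `x⁻`. -/
def creationMinus (p r : ℂ) (n : ℕ) : ℂ := r ^ n / (1 - (r ^ 4) ^ n) * primeRatio p r (-n)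

/-- Annihilation exponent of `x⁻`. -/
def annihilationMinus (p r : ℂ) (n : ℕ) : ℂ :=
  -(r ^ (3 * n) / (1 - (r ^ 4) ^ n)) * primeRatio p r n

/-- The parameters `q`, `p` and `t = q r ^ 4` are generic. -/
structure Generic (q p r : ℂ) : Prop where
  q_ne : q ≠ 0
  p_ne : p ≠ 0
  r_ne : r ≠ 0
  r_pow : ∀ n : ℕ, n ≠ 0 → (r ^ 4) ^ n ≠ 1
  p_pow : ∀ n : ℕ, n ≠ 0 → p ^ n ≠ 1
  pStar_pow : ∀ n : ℕ, n ≠ 0 → (p / r ^ 4) ^ n ≠ 1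

theorem primeRatio_natCast (p r : ℂ) (n : ℕ) : primeRatio p r n =
    (1 - p ^ n / (r ^ n) ^ 4) / (1 - p ^ n) * (r ^ n) ^ 2 := by
  simp only [primeRatio, zpow_natCast, div_pow, ← pow_mul, mul_comm]

/-- The ratio is even in `n`: inverting `p` and `p / r⁴` yields a factor `r ^ (4n)`, which turns `r
^ (-2n)` into `r ^ (2n)`. -/
theorem primeRatio_neg_natCast (h : Generic q p r) {n : ℕ} (hn : n ≠ 0) :
    primeRatio p r (-n) = (1 - p ^ n / (r ^ n) ^ 4) / (1 - p ^ n) * (r ^ n) ^ 2 := by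
  have h1 := pow_ne_zero n h.p_ne
  have h2 := pow_ne_zero n h.r_ne
  have h3 := sub_ne_zero.mpr (h.p_pow n hn)
  have h4 := sub_ne_zero.mpr (h.p_pow n hn).symm
  simp only [primeRatio, zpow_neg, zpow_natCast, div_pow, ← pow_mul]
  simp only [mul_comm _ n, pow_mul]
  generalize p ^ n = P at *
  generalize r ^ n = R at *
  have h5 : 1 - P⁻¹ ≠ 0 := by
    rw [show 1 - P⁻¹ = (P - 1) / P by field_simp]
    exact div_ne_zero h3 h1
  field_simp
  ring

theorem kappa_natCast (h : Generic q p r) (n : ℕ) : kappa q (q * r ^ 4) n =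
    (1 - q ^ n) * (1 - (q ^ n * (r ^ n) ^ 4)⁻¹) * (1 - (r ^ n) ^ 4) := by
  rw [kappa, mul_div_cancel_left₀ _ h.q_ne]
  simp only [zpow_neg, zpow_natCast, mul_pow, ← pow_mul, mul_comm]

theorem kappa_neg_natCast (h : Generic q p r) (n : ℕ) : kappa q (q * r ^ 4) (-n) =
    -((1 - q ^ n) * (1 - (q ^ n * (r ^ n) ^ 4)⁻¹) * (1 - (r ^ n) ^ 4)) := by
  have h1 := pow_ne_zero n h.q_ne
  have h2 := pow_ne_zero n h.r_ne
  rw [kappa, mul_div_cancel_left₀ _ h.q_ne]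
  simp only [zpow_neg, zpow_natCast, mul_pow, ← pow_mul, neg_neg]
  simp only [mul_comm _ n, pow_mul]
  field_simp
  ring

theorem fockBracket_natCast (h : Generic q p r) (n : ℕ) : fockBracket q (q * r ^ 4) p n =
    -((1 - q ^ n) * (1 - (q ^ n * (r ^ n) ^ 4)⁻¹) * (1 - (r ^ n) ^ 4) / n) *
      (1 - ((r ^ n) ^ 4)⁻¹) * ((1 - p ^ n) / (1 - p ^ n / (r ^ n) ^ 4)) := by
  have e1 : q / (q * r ^ 4) = (r ^ 4)⁻¹ := by
    rw [div_mul_eq_div_div, div_self h.q_ne, one_div]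
  have e2 : p * q / (q * r ^ 4) = p / r ^ 4 := by
    rw [mul_comm p, mul_div_mul_left _ _ h.q_ne]
  rw [fockBracket, kappa_natCast h, e1, e2, Int.cast_natCast]
  simp only [zpow_natCast, inv_pow, div_pow, ← pow_mul, mul_comm]

theorem creationPlus_eq (r : ℂ) (n : ℕ) :
    creationPlus r n = -(r ^ n / (1 - (r ^ n) ^ 4)) := by
  rw [creationPlus, pow_right_comm]

theorem annihilationPlus_eq (r : ℂ) (n : ℕ) :
    annihilationPlus r n = (r ^ n) ^ 3 / (1 - (r ^ n) ^ 4) := by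
  rw [annihilationPlus, pow_right_comm, pow_mul']

theorem creationMinus_eq (h : Generic q p r) {n : ℕ} (hn : n ≠ 0) :
    creationMinus p r n = r ^ n / (1 - (r ^ n) ^ 4) *
      ((1 - p ^ n / (r ^ n) ^ 4) / (1 - p ^ n) * (r ^ n) ^ 2) := by
  rw [creationMinus, primeRatio_neg_natCast h hn, pow_right_comm]

theorem annihilationMinus_eq (p r : ℂ) (n : ℕ) :
    annihilationMinus p r n = -((r ^ n) ^ 3 / (1 - (r ^ n) ^ 4)) *
      ((1 - p ^ n / (r ^ n) ^ 4) / (1 - p ^ n) * (r ^ n) ^ 2) := by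
  rw [annihilationMinus, primeRatio_natCast, pow_right_comm, pow_mul']

theorem Generic.pow_facts (h : Generic q p r) {n : ℕ} (hn : n ≠ 0) :
    q ^ n ≠ 0 ∧ p ^ n ≠ 0 ∧ r ^ n ≠ 0 ∧ 1 - (r ^ n) ^ 4 ≠ 0 ∧ 1 - p ^ n ≠ 0 ∧
      (r ^ n) ^ 4 - p ^ n ≠ 0 ∧ (n : ℂ) ≠ 0 := by
  have h3 := h.r_pow n hn
  have h4 := h.pStar_pow n hn
  rw [pow_right_comm] at h3
  rw [div_pow, pow_right_comm] at h4
  refine ⟨pow_ne_zero n h.q_ne, pow_ne_zero n h.p_ne, pow_ne_zero n h.r_ne,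
    sub_ne_zero.mpr h3.symm, sub_ne_zero.mpr (h.p_pow n hn).symm, fun h' => h4 ?_, by
      exact_mod_cast hn⟩
  rw [← sub_eq_zero.mp h', div_self (pow_ne_zero _ (pow_ne_zero _ h.r_ne))]

/-- The factor `g(ζ; p^*)` removes the dependence on `p`, leaving the logarithm of `(1 - ζ)(1 -
(q/t)ζ) / ((1 - qζ)(1 - ζ/t))`. -/
theorem plus_plus_exponent (h : Generic q p r) {n : ℕ} (hn : n ≠ 0) :
    kappa q (q * r ^ 4) n / n * ((p / r ^ 4) ^ n / (1 - (p / r ^ 4) ^ n)) +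
      annihilationPlus r n * creationPlus r n * fockBracket q (q * r ^ 4) p n =
      (q ^ n + (q * r ^ 4)⁻¹ ^ n - 1 ^ n - (r ^ 4)⁻¹ ^ n) / n := by
  obtain ⟨h1, h2, h3, h4, h5, h6, h7⟩ := h.pow_facts hn
  rw [kappa_natCast h, fockBracket_natCast h, annihilationPlus_eq, creationPlus_eq, one_pow,
    inv_pow, inv_pow, mul_pow, div_pow, pow_right_comm r 4 n]
  generalize p ^ n = P at *
  generalize r ^ n = R at *
  generalize q ^ n = Q at *
  field_simp
  ring

theorem minus_minus_exponent (h : Generic q p r) {n : ℕ} (hn : n ≠ 0) :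
    -(kappa q (q * r ^ 4) n / n * (p ^ n / (1 - p ^ n))) +
      annihilationMinus p r n * creationMinus p r n * fockBracket q (q * r ^ 4) p n =
      (q⁻¹ ^ n + (q * r ^ 4) ^ n - 1 ^ n - (r ^ 4) ^ n) / n := by
  obtain ⟨h1, h2, h3, h4, h5, h6, h7⟩ := h.pow_facts hn
  rw [kappa_natCast h, fockBracket_natCast h, annihilationMinus_eq, creationMinus_eq h hn, one_pow,
    inv_pow, mul_pow, pow_right_comm r 4 n]
  generalize p ^ n = P at *
  generalize r ^ n = R at *
  generalize q ^ n = Q at *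
  field_simp
  ring

/-- The ratio of `α'_n` to `α_n` cancels the elliptic factor of the Heisenberg bracket, so no `p`
remains. The poles at `γ^{±1} = r^{±2}` are the source of the delta functions. -/
theorem plus_minus_exponent (h : Generic q p r) {n : ℕ} (hn : n ≠ 0) :
    annihilationPlus r n * creationMinus p r n * fockBracket q (q * r ^ 4) p n =
      ((r ^ 2) ^ n + (r ^ 2)⁻¹ ^ n - (q * r ^ 2) ^ n - (q * r ^ 2)⁻¹ ^ n) / n := by
  obtain ⟨h1, h2, h3, h4, h5, h6, h7⟩ := h.pow_facts hn
  rw [fockBracket_natCast h, annihilationPlus_eq, creationMinus_eq h hn,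
    inv_pow, inv_pow, mul_pow, pow_right_comm r 2 n]
  generalize p ^ n = P at *
  generalize r ^ n = R at *
  generalize q ^ n = Q at *
  field_simp
  ring

theorem minus_plus_exponent (h : Generic q p r) {n : ℕ} (hn : n ≠ 0) :
    annihilationMinus p r n * creationPlus r n * fockBracket q (q * r ^ 4) p n =
      ((r ^ 2) ^ n + (r ^ 2)⁻¹ ^ n - (q * r ^ 2) ^ n - (q * r ^ 2)⁻¹ ^ n) / n := by
  obtain ⟨h1, h2, h3, h4, h5, h6, h7⟩ := h.pow_facts hn
  rw [← plus_minus_exponent h hn, annihilationPlus_eq, creationMinus_eq h hn,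
    annihilationMinus_eq, creationPlus_eq]
  field_simp

/-- This and the next three identities say that the product of `x⁺` and `x⁻`, fused at distance `γ =
r²`, has the exponents of `ψ⁺` or `ψ⁻`. -/
theorem psiPlus_creation (h : Generic q p r) {n : ℕ} (hn : n ≠ 0) :
    -(p ^ n * r⁻¹ ^ n / (1 - p ^ n)) = (r ^ 2) ^ n * creationPlus r n + creationMinus p r n := by
  obtain ⟨h1, h2, h3, h4, h5, h6, h7⟩ := h.pow_facts hn
  rw [creationPlus_eq, creationMinus_eq h hn, pow_right_comm r 2 n, inv_pow]
  generalize p ^ n = P at *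
  generalize r ^ n = R at *
  field_simp
  ring

theorem psiPlus_annihilation (h : Generic q p r) {n : ℕ} (hn : n ≠ 0) :
    r ^ n / (1 - p ^ n) = (r ^ 2)⁻¹ ^ n * annihilationPlus r n + annihilationMinus p r n := by
  obtain ⟨h1, h2, h3, h4, h5, h6, h7⟩ := h.pow_facts hn
  rw [annihilationPlus_eq, annihilationMinus_eq, inv_pow, pow_right_comm r 2 n]
  generalize p ^ n = P at *
  generalize r ^ n = R at *
  field_simp
  ring

theorem psiMinus_creation (h : Generic q p r) {n : ℕ} (hn : n ≠ 0) :
    -(r ^ n / (1 - p ^ n)) = (r ^ 2) ^ n * creationMinus p r n + creationPlus r n := by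
  obtain ⟨h1, h2, h3, h4, h5, h6, h7⟩ := h.pow_facts hn
  rw [creationPlus_eq, creationMinus_eq h hn, pow_right_comm r 2 n]
  generalize p ^ n = P at *
  generalize r ^ n = R at *
  field_simp
  ring

theorem psiMinus_annihilation (h : Generic q p r) {n : ℕ} (hn : n ≠ 0) :
    p ^ n * r⁻¹ ^ n / (1 - p ^ n) =
      (r ^ 2)⁻¹ ^ n * annihilationMinus p r n + annihilationPlus r n := by
  obtain ⟨h1, h2, h3, h4, h5, h6, h7⟩ := h.pow_facts hn
  rw [annihilationPlus_eq, annihilationMinus_eq, inv_pow, inv_pow, pow_right_comm r 2 n]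
  generalize p ^ n = P at *
  generalize r ^ n = R at *
  field_simp
  ring

theorem fockBracket_eq (h : Generic q p r) {n : ℕ} (hn : n ≠ 0) :
    fockBracket q (q * r ^ 4) p n = -(kappa q (q * r ^ 4) n / (n : ℤ)) *
      ((r ^ 2) ^ (n : ℤ) - (r ^ 2) ^ (-(n : ℤ))) * (r ^ 2) ^ (-(n : ℤ)) *
        ((1 - p ^ (n : ℤ)) / (1 - (p / r ^ 4) ^ (n : ℤ))) := by
  obtain ⟨h1, h2, h3, h4, h5, h6, h7⟩ := h.pow_facts hn
  rw [fockBracket_natCast h, kappa_natCast h, Int.cast_natCast]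
  simp only [zpow_neg, zpow_natCast, div_pow, pow_right_comm r _ n]
  generalize p ^ n = P at *
  generalize r ^ n = R at *
  field_simp

theorem neg_fockBracket_eq (h : Generic q p r) {n : ℕ} (hn : n ≠ 0) :
    -fockBracket q (q * r ^ 4) p n = -(kappa q (q * r ^ 4) (-n) / (-n : ℤ)) *
      ((r ^ 2) ^ (-n : ℤ) - (r ^ 2) ^ (-(-n : ℤ))) * (r ^ 2) ^ (-(-n : ℤ)) *
        ((1 - p ^ (-n : ℤ)) / (1 - (p / r ^ 4) ^ (-n : ℤ))) := by
  obtain ⟨h1, h2, h3, h4, h5, h6, h7⟩ := h.pow_facts hn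
  rw [fockBracket_natCast h, kappa_neg_natCast h, Int.cast_neg, Int.cast_natCast]
  simp only [neg_neg, zpow_neg, zpow_natCast, div_pow, pow_right_comm r _ n]
  generalize p ^ n = P at *
  generalize r ^ n = R at *
  have h8 : 1 - (P / R ^ 4)⁻¹ = -((R ^ 4 - P) / P) := by field_simp; ring
  have h9 : 1 - P⁻¹ = -((1 - P) / P) := by field_simp; ring
  rw [h8, h9]
  field_simp
  ring

theorem alpha_xPlus_creation (h : Generic q p r) {n : ℕ} (hn : n ≠ 0) :
    creationPlus r n * fockBracket q (q * r ^ 4) p n = -(kappa q (q * r ^ 4) n / (n : ℤ)) *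
      ((1 - p ^ (n : ℤ)) / (1 - (p / r ^ 4) ^ (n : ℤ))) * r ^ (-3 * (n : ℤ)) := by
  obtain ⟨h1, h2, h3, h4, h5, h6, h7⟩ := h.pow_facts hn
  rw [fockBracket_natCast h, kappa_natCast h, Int.cast_natCast, creationPlus_eq,
    zpow_mul' r (-3) n]
  simp only [zpow_neg, zpow_natCast, div_pow, pow_right_comm r _ n]
  generalize p ^ n = P at *
  generalize r ^ n = R at *
  field_simp
  ring

theorem alpha_xPlus_annihilation (h : Generic q p r) {n : ℕ} (hn : n ≠ 0) :
    -(annihilationPlus r n * fockBracket q (q * r ^ 4) p n) =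
      -(kappa q (q * r ^ 4) (-n) / (-n : ℤ)) *
      ((1 - p ^ (-n : ℤ)) / (1 - (p / r ^ 4) ^ (-n : ℤ))) * r ^ (-3 * (-n : ℤ)) := by
  obtain ⟨h1, h2, h3, h4, h5, h6, h7⟩ := h.pow_facts hn
  rw [fockBracket_natCast h, kappa_neg_natCast h, Int.cast_neg, Int.cast_natCast,
    annihilationPlus_eq, neg_mul_neg, mul_comm 3, zpow_mul]
  simp only [zpow_neg, zpow_natCast, div_pow, pow_right_comm r _ n]
  generalize p ^ n = P at *
  generalize r ^ n = R at *
  have h8 : 1 - (P / R ^ 4)⁻¹ = -((R ^ 4 - P) / P) := by field_simp; ring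
  have h9 : 1 - P⁻¹ = -((1 - P) / P) := by field_simp; ring
  rw [h8, h9]
  field_simp
  ring

theorem alpha_xMinus_creation (h : Generic q p r) {n : ℕ} (hn : n ≠ 0) :
    creationMinus p r n * fockBracket q (q * r ^ 4) p n =
      kappa q (q * r ^ 4) n / (n : ℤ) * r ^ (-(n : ℤ)) := by
  obtain ⟨h1, h2, h3, h4, h5, h6, h7⟩ := h.pow_facts hn
  rw [fockBracket_natCast h, kappa_natCast h, Int.cast_natCast, creationMinus_eq h hn]
  simp only [zpow_neg, zpow_natCast]
  generalize p ^ n = P at *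
  generalize r ^ n = R at *
  field_simp
  ring

theorem alpha_xMinus_annihilation (h : Generic q p r) {n : ℕ} (hn : n ≠ 0) :
    -(annihilationMinus p r n * fockBracket q (q * r ^ 4) p n) =
      kappa q (q * r ^ 4) (-n) / (-n : ℤ) * r ^ (-(-n : ℤ)) := by
  obtain ⟨h1, h2, h3, h4, h5, h6, h7⟩ := h.pow_facts hn
  rw [fockBracket_natCast h, kappa_neg_natCast h, Int.cast_neg, Int.cast_natCast,
    annihilationMinus_eq, neg_neg, zpow_natCast]
  generalize p ^ n = P at *
  generalize r ^ n = R at *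
  field_simp
  ring

end OperatorProducts
end
end EllipticToroidal

namespace EllipticToroidal

noncomputable section

/-! ### Verification of the defining relations -/

section Representation

open PowerSeries

theorem gSeries_mul_formalExp (q t σ : ℂ) (b : ℕ → ℂ) : gSeries q t σ * formalExp b =
    formalExp fun n => kappa q t n / n * (σ ^ n / (1 - σ ^ n)) + b n :=
  formalExp_mul_formalExp _ _

theorem gSeries_inv_mul_formalExp (q t σ : ℂ) (b : ℕ → ℂ) : (gSeries q t σ)⁻¹ * formalExp b =
    formalExp fun n => -(kappa q t n / n * (σ ^ n / (1 - σ ^ n))) + b n := by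
  rw [gSeries, formalExp_inv, formalExp_mul_formalExp]

theorem pStar_eq (p r : ℂ) : pStar p r = p / r ^ 4 := by
  rw [pStar, ← zpow_natCast, ← zpow_mul, div_eq_mul_inv, ← zpow_natCast, ← zpow_neg]
  norm_num

/-- The operators of the theorem on the Fock space. -/
def fockGenerators (q p r u : ℂ) (N : ℤ) : Generators Fock where
  gammaHalf := r • 1
  psiZeroPlus := r ^ (-2 * N) • 1
  psiZeroMinus := r ^ (2 * N) • 1
  alpha := fockAlpha q (q * r ^ 4) p
  xPlus := (fockVertex q (q * r ^ 4) p (u * r ^ (3 * N)) (-N) (creationPlus r)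
    (annihilationPlus r)).op
  xMinus := (fockVertex q (q * r ^ 4) p (u⁻¹ * r ^ (-3 * N)) N (creationMinus p r)
    (annihilationMinus p r)).op
  psiPlus := (fockVertex q (q * r ^ 4) p (r ^ (-2 * N)) 0
    (fun n => -(p ^ n * r⁻¹ ^ n / (1 - p ^ n))) fun n => r ^ n / (1 - p ^ n)).op
  psiMinus := (fockVertex q (q * r ^ 4) p (r ^ (2 * N)) 0
    (fun n => -(r ^ n / (1 - p ^ n))) fun n => p ^ n * r⁻¹ ^ n / (1 - p ^ n)).op

variable {q p r u : ℂ} {N : ℤ}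

theorem fockAlpha_commutator (h : Generic q p r) {m n : ℤ} (hm : m ≠ 0) (hn : n ≠ 0) :
    fockAlpha q (q * r ^ 4) p m * fockAlpha q (q * r ^ 4) p n -
      fockAlpha q (q * r ^ 4) p n * fockAlpha q (q * r ^ 4) p m =
      (if m + n = 0 then
        -(kappa q (q * r ^ 4) m / m) * ((r ^ 2) ^ m - (r ^ 2) ^ (-m)) * (r ^ 2) ^ (-m) *
          ((1 - p ^ m) / (1 - (p / r ^ 4) ^ m)) else 0) • 1 := by
  obtain ⟨k, rfl | rfl⟩ := m.eq_nat_or_neg <;> obtain ⟨l, rfl | rfl⟩ := n.eq_nat_or_neg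
  · rw [if_neg (by omega), zero_smul]
    exact sub_eq_zero.mpr (commute_fockAlpha q (q * r ^ 4) p k l)
  · rw [← fockBracket_eq h (by omega), fockAlpha_bracket q (q * r ^ 4) p (by omega) (by omega)]
    congr 1
    exact if_congr (by omega) rfl rfl
  · rw [← neg_fockBracket_eq h (by omega)]
    refine (bracket_neg (fockAlpha_bracket q (q * r ^ 4) p (m := l) (n := k) (by omega)
      (by omega))).trans ?_
    congr 1
    by_cases hkl : k = l
    · rw [if_pos hkl, if_pos (by omega), hkl]
    · rw [if_neg hkl, if_neg (by omega), neg_zero]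
  · rw [if_neg (by omega), zero_smul]
    exact sub_eq_zero.mpr (commute_fockAlpha_neg q (q * r ^ 4) p k l)

theorem formalExp_plus_plus (h : Generic q p r) : gSeries q (q * r ^ 4) (p / r ^ 4) *
    formalExp (fun n => annihilationPlus r n * creationPlus r n *
      fockBracket q (q * r ^ 4) p n) * ((1 - C q * X) * (1 - C (q * r ^ 4)⁻¹ * X)) =
    (1 - X) * (1 - C (r ^ 4)⁻¹ * X) := by
  rw [gSeries_mul_formalExp, formalExp_mul_eq_of_add_eq fun n hn => plus_plus_exponent h hn,
    map_one, one_mul]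

theorem formalExp_minus_minus (h : Generic q p r) : (gSeries q (q * r ^ 4) p)⁻¹ *
    formalExp (fun n => annihilationMinus p r n * creationMinus p r n *
      fockBracket q (q * r ^ 4) p n) * ((1 - C q⁻¹ * X) * (1 - C (q * r ^ 4) * X)) =
    (1 - X) * (1 - C (r ^ 4) * X) := by
  rw [gSeries_inv_mul_formalExp, formalExp_mul_eq_of_add_eq fun n hn => minus_minus_exponent h hn,
    map_one, one_mul]

theorem isRepresentation_fockGenerators (h : Generic q p r) (hu : u ≠ 0) :
    IsRepresentation q (q * r ^ 4) p r (fockGenerators q p r u N) := by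
  have hr := h.r_ne
  have hr2 : r ^ 2 ≠ 0 := pow_ne_zero 2 hr
  have hr4 : r ^ 4 ≠ 0 := pow_ne_zero 4 hr
  have hcomm : ∀ (c : ℂ) (y : Module.End ℂ Fock), Commute (c • (1 : Module.End ℂ Fock)) y :=
    fun c y => (Commute.one_left y).smul_left c
  have hinv : ∀ k : ℤ, (r ^ k • (1 : Module.End ℂ Fock)) * (r ^ (-k) • 1) = 1 := fun k => by
    rw [smul_mul_smul_comm, mul_one, ← zpow_add₀ hr, add_neg_cancel, zpow_zero, one_smul]
  have hunit : ∀ k : ℤ, IsUnit (r ^ k • (1 : Module.End ℂ Fock)) := fun k =>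
    ⟨⟨r ^ k • 1, r ^ (-k) • 1, hinv k, by simpa only [neg_neg] using hinv (-k)⟩, rfl⟩
  have e1 : q * r ^ 4 / q = r ^ 4 := mul_div_cancel_left₀ _ h.q_ne
  have e2 : q / (q * r ^ 4) = (r ^ 4)⁻¹ := by rw [div_mul_eq_div_div, div_self h.q_ne, one_div]
  have hpp := contracts_fockVertex (q := q) (t := q * r ^ 4) (p := p) (C := u * r ^ (3 * N))
    (C' := u * r ^ (3 * N)) (M := -N) (M' := -N) (c := creationPlus r) (c' := creationPlus r)
    (a := annihilationPlus r) (a' := annihilationPlus r)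
  have hmm := contracts_fockVertex (q := q) (t := q * r ^ 4) (p := p) (C := u⁻¹ * r ^ (-3 * N))
    (C' := u⁻¹ * r ^ (-3 * N)) (M := N) (M' := N) (c := creationMinus p r)
    (c' := creationMinus p r) (a := annihilationMinus p r) (a' := annihilationMinus p r)
  -- The contractions in the two orders agree. As functions they must also agree at the unused index
  -- `0`, where `kappa` vanishes.
  have hexp : (fun m : ℕ => annihilationMinus p r m * creationPlus r m *
      fockBracket q (q * r ^ 4) p m) = fun m : ℕ => annihilationPlus r m * creationMinus p r m *
      fockBracket q (q * r ^ 4) p m := by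
    funext m
    rcases eq_or_ne m 0 with rfl | hm
    · simp [fockBracket, kappa]
    · rw [plus_minus_exponent h hm, minus_plus_exponent h hm]
  constructor
  case s_ne_zero => exact hr
  case gammaHalf_eq => rfl
  case psiZeroPlus_isUnit => exact hunit _
  case psiZeroMinus_isUnit => exact hunit _
  case psiZero_comm => exact hcomm _ _
  case psiZeroPlus_alpha => exact fun _ _ => hcomm _ _
  case psiZeroPlus_xPlus => exact fun _ => hcomm _ _
  case psiZeroPlus_xMinus => exact fun _ => hcomm _ _
  case psiZeroMinus_alpha => exact fun _ _ => hcomm _ _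
  case psiZeroMinus_xPlus => exact fun _ => hcomm _ _
  case psiZeroMinus_xMinus => exact fun _ => hcomm _ _
  case psiPlus_eq =>
    have e : ∀ m : ℕ, p ^ m / (1 - p ^ m) * r⁻¹ ^ m = p ^ m * r⁻¹ ^ m / (1 - p ^ m) :=
      fun m => by ring
    have e' : ∀ m : ℕ, 1 / (1 - p ^ m) * r ^ m = r ^ m / (1 - p ^ m) := fun m => by ring
    simp only [e, e']
    exact isVertexOperator_fockVertex
  case psiMinus_eq =>
    have e : ∀ m : ℕ, p ^ m / (1 - p ^ m) * r⁻¹ ^ m = p ^ m * r⁻¹ ^ m / (1 - p ^ m) :=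
      fun m => by ring
    have e' : ∀ m : ℕ, 1 / (1 - p ^ m) * r ^ m = r ^ m / (1 - p ^ m) := fun m => by ring
    simp only [e, e']
    exact isVertexOperator_fockVertex
  case alpha_alpha =>
    intro m n hm hn
    rw [pStar_eq]
    exact fockAlpha_commutator h hm hn
  case alpha_xPlus =>
    intro m n hm
    rw [pStar_eq]
    obtain ⟨k, rfl | rfl⟩ := m.eq_nat_or_neg
    · rw [← alpha_xPlus_creation h (by omega)]
      exact fockAlpha_fockVertex (by omega) n
    · rw [← alpha_xPlus_annihilation h (by omega)]
      exact fockAlpha_neg_fockVertex (by omega) n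
  case alpha_xMinus =>
    intro m n hm
    obtain ⟨k, rfl | rfl⟩ := m.eq_nat_or_neg
    · rw [← alpha_xMinus_creation h (by omega)]
      exact fockAlpha_fockVertex (by omega) n
    · rw [← alpha_xMinus_annihilation h (by omega)]
      exact fockAlpha_neg_fockVertex (by omega) n
  case xPlus_xMinus =>
    intro a b
    have hD : (u * r ^ (3 * N)) * (u⁻¹ * r ^ (-3 * N)) = 1 := by
      rw [mul_mul_mul_comm, mul_inv_cancel₀ hu, ← zpow_add₀ hr, one_mul]
      ring_nf
      exact zpow_zero r
    refine VertexData.op_commutator hr2 contracts_fockVertex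
      (by rw [← hexp]; exact contracts_fockVertex)
      (coeff_of_mul_eq hr2 (mul_ne_zero h.q_ne hr2) ?_
        (formalExp_mul_eq_of_add_eq fun n hn => plus_minus_exponent h hn))
      commute_fockVertex_creation commute_fockVertex_annihilation
      (fuses_fockVertex hr2 (by ring) ?_ (fun n hn => psiPlus_creation h hn)
        fun n hn => psiPlus_annihilation h hn)
      (fuses_fockVertex hr2 (by ring) ?_ (fun n hn => psiMinus_creation h hn)
        fun n hn => psiMinus_annihilation h hn) a b
    -- The constant `(1 - q)(1 - 1/t) / (1 - q/t)` is the partial fraction coefficient of the mixed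
    -- contraction at `s = γ`.
    · have h1 := h.q_ne
      have h2 : r ^ 4 - 1 ≠ 0 := by
        have := h.r_pow 1 one_ne_zero
        rw [pow_one] at this
        exact sub_ne_zero.mpr this
      rw [e2, show 1 - (r ^ 4)⁻¹ = (r ^ 4 - 1) / r ^ 4 by field_simp]
      field_simp
      ring
    -- The scalar prefactors cancel; substituting `z = γ w` in `z ^ (-N)` leaves `γ ^ (-N) = r ^
    -- (-2N)`, the value of `ψ⁺_0`.
    · rw [hD, one_mul, ← zpow_natCast r 2, ← zpow_mul]
      congr 1
      push_cast
      ring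
    · rw [mul_comm (u⁻¹ * _), hD, one_mul, ← zpow_natCast r 2, ← zpow_mul]
      rfl
  case xPlus_finite =>
    exact hpp.isLocallyFinite commute_fockVertex_creation commute_fockVertex_annihilation
  case xMinus_finite =>
    exact hmm.isLocallyFinite commute_fockVertex_creation commute_fockVertex_annihilation
  case xPlus_xPlus =>
    intro a b v
    rw [pStar_eq]
    refine hpp.quad_relation commute_fockVertex_creation commute_fockVertex_annihilation
      (inv_mul_cancel₀ hr4) ?_ a b v
    -- Two factors of `G⁺` cancel the denominator of the contraction; the third, `1 - r⁴X`, supplies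
    -- the root reciprocal to that of `1 - r⁻⁴X`.
    rw [GPlus, e2, inv_inv, ← formalExp_plus_plus h]
    ring
  case xMinus_xMinus =>
    intro a b v
    refine hmm.quad_relation commute_fockVertex_creation commute_fockVertex_annihilation
      (mul_inv_cancel₀ hr4) ?_ a b v
    rw [GMinus, e2, ← formalExp_minus_minus h]
    ring
  case xPlus_serre =>
    intro n v
    rw [pStar_eq]
    refine hpp.serre_relation commute_fockVertex_creation commute_fockVertex_annihilation
      (a := q) (b := (q * r ^ 4)⁻¹) ?_ n v
    rw [formalExp_plus_plus h, ← div_eq_mul_inv, e2]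
  case xMinus_serre =>
    intro n v
    refine hmm.serre_relation commute_fockVertex_creation commute_fockVertex_annihilation
      (a := q⁻¹) (b := q * r ^ 4) ?_ n v
    rw [formalExp_minus_minus h, inv_mul_cancel_left₀ h.q_ne]

end Representation
end
end EllipticToroidal

/-! ### The theorem -/

theorem theorem3p1 (q t p r u : ℂ) (N : ℤ)
    (hq : q ≠ 0) (ht : t ≠ 0)
    (hq1 : ∀ n : ℕ, 0 < n → q ^ n ≠ 1) (ht1 : ∀ n : ℕ, 0 < n → t ^ n ≠ 1)
    (hqt1 : ∀ n : ℕ, 0 < n → (q / t) ^ n ≠ 1)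
    (hp0 : p ≠ 0) (hp : ‖p‖ < 1) (hps : ‖p * q / t‖ < 1)
    (hr : r ^ 4 = t / q) (hu : u ≠ 0) :
    pStar p r = p * q / t ∧
    ∃ ρ : Generators Fock,
      -- the action of the Heisenberg algebra and of the central elements
      ρ.alpha = fockAlpha q t p ∧
      ρ.gammaHalf = r • (1 : Module.End ℂ Fock) ∧
      ρ.psiZeroPlus = r ^ (-2 * N) • (1 : Module.End ℂ Fock) ∧
      ρ.psiZeroMinus = r ^ (2 * N) • (1 : Module.End ℂ Fock) ∧
      -- `x⁺(z)`
      IsVertexOperator ρ.xPlus ((u * r ^ (3 * N)) • (1 : Module.End ℂ Fock)) (-N)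
        (formalExp fun n : ℕ => (-(r ^ n / (1 - (t / q) ^ n))) • fockAlpha q t p (-n))
        (formalExp fun n : ℕ => (r ^ (3 * n) / (1 - (t / q) ^ n)) • fockAlpha q t p n) ∧
      -- `x⁻(z)`
      IsVertexOperator ρ.xMinus ((u⁻¹ * r ^ (-3 * N)) • (1 : Module.End ℂ Fock)) N
        (formalExp fun n : ℕ => (r ^ n / (1 - (t / q) ^ n)) • fockAlphaPrime q t p r (-n))
        (formalExp fun n : ℕ =>
          (-(r ^ (3 * n) / (1 - (t / q) ^ n))) • fockAlphaPrime q t p r n) ∧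
      -- `ψ⁺(z)`
      IsVertexOperator ρ.psiPlus (r ^ (-2 * N) • (1 : Module.End ℂ Fock)) 0
        (formalExp fun n : ℕ => (-(p ^ n * r⁻¹ ^ n / (1 - p ^ n))) • fockAlpha q t p (-n))
        (formalExp fun n : ℕ => (r ^ n / (1 - p ^ n)) • fockAlpha q t p n) ∧
      -- `ψ⁻(z)`
      IsVertexOperator ρ.psiMinus (r ^ (2 * N) • (1 : Module.End ℂ Fock)) 0
        (formalExp fun n : ℕ => (-(r ^ n / (1 - p ^ n))) • fockAlpha q t p (-n))
        (formalExp fun n : ℕ => (p ^ n * r⁻¹ ^ n / (1 - p ^ n)) • fockAlpha q t p n) ∧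
      -- they form a representation, of level `(1, N)`
      IsRepresentation q t p r ρ ∧
      HasLevel r 1 N ρ := by
  -- Eliminating `t` makes all fractional powers of `t / q` integral powers of `r`.
  obtain rfl : t = q * r ^ 4 := by rw [hr, mul_div_cancel₀ _ hq]
  have hr4 : r ^ 4 ≠ 0 := right_ne_zero_of_mul ht
  have e1 : q * r ^ 4 / q = r ^ 4 := mul_div_cancel_left₀ _ hq
  have e2 : q / (q * r ^ 4) = (r ^ 4)⁻¹ := by rw [div_mul_eq_div_div, div_self hq, one_div]
  have e3 : p * q / (q * r ^ 4) = p / r ^ 4 := by rw [mul_comm p, mul_div_mul_left _ _ hq]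
  have hlt : ∀ x : ℂ, ‖x‖ < 1 → ∀ n : ℕ, n ≠ 0 → x ^ n ≠ 1 := by
    intro x hx n hn h1
    have := pow_lt_one₀ (norm_nonneg x) hx hn
    rw [← norm_pow, h1, norm_one] at this
    exact lt_irrefl _ this
  -- All denominators are nonzero: `1 - (t/q)^n` because `q/t` is not a root of unity, the elliptic
  -- ones because `p` and `p^*` have norm less than 1.
  have h : Generic q p r :=
    { q_ne := hq
      p_ne := hp0
      r_ne := fun h0 => hr4 (by rw [h0, zero_pow four_ne_zero])
      r_pow := fun n hn h1 => hqt1 n (Nat.pos_of_ne_zero hn) (by rw [e2, inv_pow, h1, inv_one])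
      p_pow := hlt p hp
      pStar_pow := hlt _ (by rwa [e3] at hps) }
  have hprime : ∀ (c : ℂ) (m : ℤ), c • fockAlphaPrime q (q * r ^ 4) p r m =
      (c * primeRatio p r m) • fockAlpha q (q * r ^ 4) p m := by
    intro c m
    rw [fockAlphaPrime, smul_smul, e3, primeRatio]
  refine ⟨by rw [pStar_eq, e3], fockGenerators q p r u N, rfl, rfl, rfl, rfl, ?_, ?_,
    isVertexOperator_fockVertex, isVertexOperator_fockVertex,
    isRepresentation_fockGenerators h hu, fun v => ⟨?_, rfl⟩⟩
  · rw [e1]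
    exact isVertexOperator_fockVertex
  · simp only [e1, hprime]
    exact isVertexOperator_fockVertex
  · rw [zpow_one]
    rfl
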